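/- Let $G$ be a finite-dimensional Lie group with Lie algebra $\mathfrak g$ acting smoothly, freely and properly (on the left) on a finite-dimensional smooth manifold $Q$ (manifolds are Hausdorff, second countable and without boundary), and let $k\ge 1$. Let $(T^1_k)^*Q=T^*Q\oplus\cdots\oplus T^*Q$ ($k$ copies) with projections $\pi^a_Q:(T^1_k)^*Q\to T^*Q$ and forms $\omega^a_Q=(\pi_Q^a)^*\omega_Q$, where $\omega_Q=-d\theta_Q$ is the canonical symplectic form of $T^*Q$. Let $G$ act on $(T^1_k)^*Q$ by the lifted action, and let $J:(T^1_k)^*Q\to(\mathfrak g^*)^k$, $\langle J^a(\alpha^1_q,\dots,\alpha^k_q),\xi\rangle=\langle\alpha^a_q,\xi_Q(q)\rangle$, be the canonical momentum map. Let $\mu=(\mu_1,\dots,\mu_k)$ be a regular value of $J$ and $G_\mu$ its isotropy group under the $k$-fold coadjoint action $\mathrm{Coad}_g\nu=\mathrm{Ad}_{g^{-1}}^*\nu$. Let $\mathcal A:TQ\to\mathfrak g$ be a principal connection on $\pi:Q\to Q/G$, that is, a smooth $\mathfrak g$-valued one-form with $\mathcal A(\xi_Q)=\xi$ and $\mathcal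 A(g\cdot v)=\mathrm{Ad}_g\mathcal A(v)$, and put $\mathcal A_{\mu_a}=\langle\mu_a,\mathcal A\rangle\in\Omega^1(Q)$. A family of $k$ closed two-forms $(\omega^1,\dots,\omega^k)$ on a manifold is called a polysymplectic structure if $\bigcap_a\ker\omega^a=0$, and a diffeomorphism that pulls the $a$-th form of one such family back to the $a$-th form of another, for each $a$, is called a polysymplectomorphism. Then: 1. $Q/G$, $Q/G_\mu$ and $J^{-1}(\mu)/G_\mu$ are smooth manifolds (the projections onto them being submersions), $J^{-1}(\mu)$ is an embedded submanifold of $(T^1_k)^*Q$, and the map $p_\mu:Q/G_\mu\to Q/G$, $[q]_\mu\mapsto[q]$, is smooth. 2. For each $a$ there is a unique two-form $\mathcal B_{\mu_a}$ on $Q/G_\mu$ whose pullback to $Q$ is $d\mathcal A_{\mu_a}$; it is smooth. For each $a$ there is a unique two-form $\tilde\omega^a_\mu$ on $J^{-1}(\mu)/G_\mu$ with $\pi_\mu^*\tilde\omega^a_\mu=i_\mu^*\omega_Q^a$, where $\pi_\mu:J^{-1}(\mu)\to J^{-1}(\mu)/G_\mu$ is the projection and $i_\mu$ is the inclusion; the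 family $(\tilde\omega^1_\mu,\dots,\tilde\omega^k_\mu)$ is a polysymplectic structure. 3. On the pullback bundle $p_\mu^*\big((T^1_k)^*(Q/G)\big)=Q/G_\mu\times_{Q/G}\big(T^*(Q/G)\oplus\cdots\oplus T^*(Q/G)\big)$ the forms $$\omega^a_\mu=(\mathrm{pr}_2^a)^*\omega_{Q/G}-(\mathrm{pr}_1)^*\mathcal B_{\mu_a},\qquad a=1,\dots,k,$$ are a polysymplectic structure, where $\mathrm{pr}_1$ is the projection onto $Q/G_\mu$ and $\mathrm{pr}_2^a$ is the projection onto the $a$-th copy of $T^*(Q/G)$. 4. There is a diffeomorphism $\tau_\mu:J^{-1}(\mu)/G_\mu\to p_\mu^*\big((T^1_k)^*(Q/G)\big)$ with $\tau_\mu^*\omega^a_\mu=\tilde\omega^a_\mu$ for all $a$ (a polysymplectomorphism), given by the momentum shift: $$\tau_\mu\big([\alpha_q^1,\dots,\alpha_q^k]_\mu\big)=\big([q]_\mu,\gamma^1_{[q]},\dots,\gamma^k_{[q]}\big),\qquad \langle\gamma^a_{[q]},T_q\pi(v)\rangle=\langle\alpha^a_q,v\rangle-\langle\mu_a,\mathcal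 A(v)\rangle\quad\text{for all } v\in T_qQ .$$ -/

import Mathlib

open scoped Manifold ContDiff Bundle

noncomputable section

namespace PolyRed

/-! ### Differential forms on manifolds without boundary -/

section Forms

variable {E : Type*} [NormedAddCommGroup E] [NormedSpace ℝ E] {H : Type*} [TopologicalSpace H]
  (I : ModelWithCorners ℝ E H) {M : Type*} [TopologicalSpace M] [ChartedSpace H M]
  {E' : Type*} [NormedAddCommGroup E'] [NormedSpace ℝ E'] {H' : Type*} [TopologicalSpace H']
  (I' : ModelWithCorners ℝ E' H') {M' : Type*} [TopologicalSpace M'] [ChartedSpace H' M']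

variable (M) in
/-- A (not necessarily smooth) field of alternating `n`-linear forms on the tangent spaces. -/
abbrev DForm (n : ℕ) : Type _ := ∀ x : M, TangentSpace I x [⋀^Fin n]→L[ℝ] ℝ

/-- The `1`-form given by a field of covectors. -/
def oneForm (α : ∀ x : M, TangentSpace I x →L[ℝ] ℝ) : DForm I M 1 :=
  fun x ↦ ContinuousAlternatingMap.ofSubsingleton ℝ (TangentSpace I x) ℝ (0 : Fin 1) (α x)

/-- The pullback `f^* Ω`. -/
def pullback {n : ℕ} (f : M → M') (Ω : DForm I' M' n) : DForm I M n :=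
  fun x ↦ (Ω (f x)).compContinuousLinearMap (mfderiv I I' f x)

/-- The expression of `Ω` in the preferred chart at `x₀`, as a form on the model space. -/
def inChart {n : ℕ} (Ω : DForm I M n) (x₀ : M) (y : E) : E [⋀^Fin n]→L[ℝ] ℝ :=
  (Ω ((extChartAt I x₀).symm y)).compContinuousLinearMap
    (mfderiv 𝓘(ℝ, E) I (extChartAt I x₀).symm y)

/-- `Ω` has smooth coefficients in every preferred chart. -/
def IsSmoothForm {n : ℕ} (Ω : DForm I M n) : Prop :=
  ∀ x₀ : M, ContDiffOn ℝ ∞ (inChart I Ω x₀) (extChartAt I x₀).target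

/-- The exterior derivative, computed in a chart around each point. -/
def dExt {n : ℕ} (Ω : DForm I M n) : DForm I M (n + 1) :=
  fun x ↦ (extDeriv (inChart I Ω x) (extChartAt I x x)).compContinuousLinearMap
    (mfderiv I 𝓘(ℝ, E) (extChartAt I x) x)

/-- A `k`-polysymplectic structure: closed smooth two-forms `Ω 0, …, Ω (k-1)` whose kernels
have zero intersection. -/
structure IsPolysymplectic {k : ℕ} (Ω : Fin k → DForm I M 2) : Prop where
  smooth : ∀ a, IsSmoothForm I (Ω a)
  closed : ∀ a, dExt I (Ω a) = 0
  nondegenerate : ∀ (x : M) (v : TangentSpace I x),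
    (∀ (a : Fin k) (w : TangentSpace I x), Ω a x ![v, w] = 0) → v = 0

end Forms

/-! ### Cotangent bundles and bundles of `k`-covelocities -/

section Cotangent

variable {E : Type*} [NormedAddCommGroup E] [NormedSpace ℝ E]
  {M : Type*} [TopologicalSpace M] [ChartedSpace E M]

variable (E M) in
/-- The cotangent bundle `T^*M`. -/
abbrev Cot : Type _ :=
  Bundle.TotalSpace (E →L[ℝ] ℝ)
    (fun x : M ↦ TangentSpace 𝓘(ℝ, E) x →L[ℝ] Bundle.Trivial M ℝ x)

variable (E M) in
/-- The fibre at `x` of the `k`-fold Whitney sum `T^*M ⊕ ⋯ ⊕ T^*M`; a `k`-tuple of covectors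
`(α^1, …, α^k)` at `x` is written as the linear map `v ↦ (α^1 v, …, α^k v)` into `ℝ^k`. -/
abbrev CovFib (k : ℕ) (x : M) : Type _ :=
  TangentSpace 𝓘(ℝ, E) x →L[ℝ] Bundle.Trivial M (Fin k → ℝ) x

variable (E M) in
/-- The bundle of `k`-covelocities `(T^1_k)^*M = T^*M ⊕ ⋯ ⊕ T^*M`. -/
abbrev Cov (k : ℕ) : Type _ := Bundle.TotalSpace (E →L[ℝ] (Fin k → ℝ)) (CovFib E M k)

variable (E) in
/-- The model with corners of `T^*M`. -/
abbrev cotModel : ModelWithCorners ℝ (E × (E →L[ℝ] ℝ)) (ModelProd E (E →L[ℝ] ℝ)) :=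
  𝓘(ℝ, E).prod 𝓘(ℝ, E →L[ℝ] ℝ)

variable (E) in
/-- The model with corners of `(T^1_k)^*M`. -/
abbrev covModel (k : ℕ) : ModelWithCorners ℝ (E × (E →L[ℝ] (Fin k → ℝ)))
    (ModelProd E (E →L[ℝ] (Fin k → ℝ))) :=
  𝓘(ℝ, E).prod 𝓘(ℝ, E →L[ℝ] (Fin k → ℝ))

/-- The `a`-th covector of a `k`-covelocity. -/
def CovFib.covector {k : ℕ} {x : M} (α : CovFib E M k x) (a : Fin k) :
    TangentSpace 𝓘(ℝ, E) x →L[ℝ] ℝ :=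
  (ContinuousLinearMap.proj (R := ℝ) (φ := fun _ : Fin k ↦ ℝ) a).comp α

/-- Each fibre is the direct sum of `k` copies of the cotangent space. -/
theorem CovFib.covector_bijective (k : ℕ) (x : M) :
    Function.Bijective (fun (α : CovFib E M k x) (a : Fin k) ↦ α.covector a) := by
  constructor
  · intro α β h
    refine ContinuousLinearMap.ext fun v ↦ funext fun a ↦ ?_
    exact congrArg (fun l : TangentSpace 𝓘(ℝ, E) x →L[ℝ] ℝ ↦ l v) (congrFun h a)
  · intro β
    exact ⟨ContinuousLinearMap.pi β, rfl⟩

/-- The projection `π^a : (T^1_k)^*M → T^*M`. -/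
def covProj {k : ℕ} (a : Fin k) (x : Cov E M k) : Cot E M := ⟨x.proj, x.2.covector a⟩

variable [IsManifold 𝓘(ℝ, E) ∞ M]

variable (E M) in
/-- The tautological one-form `θ_α(w) = α(Tπ w)` on `T^*M`. -/
def tautForm : DForm (cotModel E) (Cot E M) 1 :=
  oneForm (cotModel E) fun α ↦
    ContinuousLinearMap.comp (α.2 : TangentSpace 𝓘(ℝ, E) α.proj →L[ℝ] ℝ)
      (mfderiv (cotModel E) 𝓘(ℝ, E) (Bundle.TotalSpace.proj : Cot E M → M) α)

variable (E M) in
/-- The canonical symplectic form `ω = -dθ` on `T^*M`. -/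
def canForm : DForm (cotModel E) (Cot E M) 2 := fun α ↦ -(dExt (cotModel E) (tautForm E M) α)

variable (E M) in
/-- The canonical polysymplectic structure `ω^a = (π^a)^* ω` on `(T^1_k)^*M`. -/
def covForm (k : ℕ) (a : Fin k) : DForm (covModel E k) (Cov E M k) 2 :=
  pullback (covModel E k) (cotModel E) (covProj a) (canForm E M)

end Cotangent

/-! ### Lie group actions, momentum map, connections -/

section Action

variable {EG : Type*} [NormedAddCommGroup EG] [NormedSpace ℝ EG]
  {G : Type*} [TopologicalSpace G] [ChartedSpace EG G] [Group G]
  {E : Type*} [NormedAddCommGroup E] [NormedSpace ℝ E]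
  {Q : Type*} [TopologicalSpace Q] [ChartedSpace E Q] [MulAction G Q]

variable (EG G) in
/-- The Lie algebra `𝔤 = T_1 G`. -/
abbrev LieAlg : Type _ := GroupLieAlgebra 𝓘(ℝ, EG) G

variable (EG G) in
/-- The dual `𝔤^*` of the Lie algebra. -/
abbrev LieDual : Type _ := LieAlg EG G →L[ℝ] ℝ

variable (EG) in
/-- `Ad_g`, the derivative at `1` of conjugation by `g`. -/
def Ad (g : G) : LieAlg EG G →L[ℝ] LieAlg EG G :=
  mfderiv 𝓘(ℝ, EG) 𝓘(ℝ, EG) (fun h : G ↦ g * h * g⁻¹) 1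

/-- The coadjoint action `Coad_g ν = Ad_{g⁻¹}^* ν`. -/
def Coad (g : G) (ν : LieDual EG G) : LieDual EG G := ν.comp (Ad EG g⁻¹)

/-- The infinitesimal generator `ξ_Q(q)`, the derivative of `g ↦ g • q` at `1` in direction `ξ`. -/
def infGen (E : Type*) [NormedAddCommGroup E] [NormedSpace ℝ E]
    {Q : Type*} [TopologicalSpace Q] [ChartedSpace E Q] [MulAction G Q]
    (q : Q) (ξ : LieAlg EG G) : TangentSpace 𝓘(ℝ, E) q :=
  mfderiv 𝓘(ℝ, EG) 𝓘(ℝ, E) (fun g : G ↦ g • q) 1 ξ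

variable (EG G) in
/-- The canonical momentum map `J^a(α)(ξ) = α^a(ξ_Q(q))`. -/
def momentum {k : ℕ} (x : Cov E Q k) : Fin k → LieDual EG G := fun a ↦
  (x.2.covector a).comp (mfderiv 𝓘(ℝ, EG) 𝓘(ℝ, E) (fun g : G ↦ g • x.proj) 1)

theorem momentum_apply {k : ℕ} (x : Cov E Q k) (a : Fin k) (ξ : LieAlg EG G) :
    momentum EG G x a ξ = x.2.covector a (infGen E x.proj ξ) := rfl

/-- The level set `J⁻¹(μ)`. -/
def level (E Q : Type*) [NormedAddCommGroup E] [NormedSpace ℝ E] [TopologicalSpace Q]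
    [ChartedSpace E Q] [MulAction G Q] {k : ℕ} (μ : Fin k → LieDual EG G) : Set (Cov E Q k) :=
  {x | momentum EG G x = μ}

/-- `μ` is a regular value of `J`: the derivative `T_x J` is onto at each `x ∈ J⁻¹(μ)`. -/
def IsRegularValue (E Q : Type*) [NormedAddCommGroup E] [NormedSpace ℝ E] [TopologicalSpace Q]
    [ChartedSpace E Q] [IsManifold 𝓘(ℝ, E) ∞ Q] [MulAction G Q] {k : ℕ}
    (μ : Fin k → LieDual EG G) : Prop :=
  ∀ x ∈ level E Q μ, Function.Surjective
    (mfderiv (M' := Fin k → (EG →L[ℝ] ℝ)) (covModel E k) 𝓘(ℝ, Fin k → (EG →L[ℝ] ℝ))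
      (fun y : Cov E Q k ↦ momentum EG G y) x)

/-- A principal connection, given by its connection one-form `𝒜 : TQ → 𝔤`. -/
structure PrincipalConnection (EG G E Q : Type*) [NormedAddCommGroup EG] [NormedSpace ℝ EG]
    [TopologicalSpace G] [ChartedSpace EG G] [Group G] [NormedAddCommGroup E] [NormedSpace ℝ E]
    [TopologicalSpace Q] [ChartedSpace E Q] [IsManifold 𝓘(ℝ, E) ∞ Q] [MulAction G Q] where
  form : ∀ q : Q, TangentSpace 𝓘(ℝ, E) q →L[ℝ] LieAlg EG G
  smooth : ContMDiff (M' := EG) 𝓘(ℝ, E).tangent 𝓘(ℝ, EG) ∞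
    (fun v : TangentBundle 𝓘(ℝ, E) Q ↦ form v.proj v.2)
  apply_infGen : ∀ (q : Q) (ξ : LieAlg EG G), form q (infGen E q ξ) = ξ
  equivariant : ∀ (g : G) (q : Q) (v : TangentSpace 𝓘(ℝ, E) q),
    form (g • q) (mfderiv 𝓘(ℝ, E) 𝓘(ℝ, E) (fun x : Q ↦ g • x) q v) = Ad EG g (form q v)

/-- The one-form `𝒜_ν(v) = ⟨ν, 𝒜(v)⟩`. -/
def PrincipalConnection.component [IsManifold 𝓘(ℝ, E) ∞ Q] (A : PrincipalConnection EG G E Q)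
    (ν : LieDual EG G) : DForm 𝓘(ℝ, E) Q 1 :=
  oneForm 𝓘(ℝ, E) fun q ↦ ν.comp (A.form q)

section Isotropy

variable [LieGroup 𝓘(ℝ, EG) ∞ G]

theorem mdifferentiable_conj (g : G) :
    MDifferentiable 𝓘(ℝ, EG) 𝓘(ℝ, EG) (fun h : G ↦ g * h * g⁻¹) := by
  have h : ContMDiff 𝓘(ℝ, EG) 𝓘(ℝ, EG) ∞ (fun h : G ↦ g * h * g⁻¹) :=
    (contMDiff_const.mul contMDiff_id).mul contMDiff_const
  exact h.mdifferentiable (by simp)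

theorem Ad_one : Ad EG (1 : G) = ContinuousLinearMap.id ℝ _ := by
  have h : (fun h : G ↦ 1 * h * (1 : G)⁻¹) = id := by ext; simp
  unfold Ad
  rw [h]
  exact mfderiv_id

theorem Ad_mul (g h : G) : Ad EG (g * h) = (Ad EG g).comp (Ad EG h) := by
  have e : (fun x : G ↦ g * h * x * (g * h)⁻¹) =
      (fun x : G ↦ g * x * g⁻¹) ∘ (fun x : G ↦ h * x * h⁻¹) := by
    ext x; simp [mul_assoc]
  have h1 : h * 1 * h⁻¹ = (1 : G) := by simp
  have key := mfderiv_comp (I := 𝓘(ℝ, EG)) (I' := 𝓘(ℝ, EG)) (I'' := 𝓘(ℝ, EG)) (1 : G)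
    (mdifferentiable_conj (EG := EG) g (h * 1 * h⁻¹)) (mdifferentiable_conj (EG := EG) h 1)
  have e2 : ∀ y : G, y = 1 →
      (mfderiv 𝓘(ℝ, EG) 𝓘(ℝ, EG) (fun x : G ↦ g * x * g⁻¹) y : EG →L[ℝ] EG) =
        (mfderiv 𝓘(ℝ, EG) 𝓘(ℝ, EG) (fun x : G ↦ g * x * g⁻¹) 1 : EG →L[ℝ] EG) := by
    rintro y rfl; rfl
  unfold Ad
  rw [e]
  refine key.trans ?_
  exact congrArg (fun L : EG →L[ℝ] EG ↦
    L.comp (mfderiv 𝓘(ℝ, EG) 𝓘(ℝ, EG) (fun x : G ↦ h * x * h⁻¹) 1 : EG →L[ℝ] EG)) (e2 _ h1)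

theorem Coad_one (ν : LieDual EG G) : Coad (1 : G) ν = ν := by
  simp only [Coad, inv_one, Ad_one]; rfl

theorem Coad_mul (g h : G) (ν : LieDual EG G) : Coad (g * h) ν = Coad g (Coad h ν) := by
  simp only [Coad, mul_inv_rev, Ad_mul]; rfl

/-- The isotropy group `G_μ` of `μ = (μ_1, …, μ_k)` under the `k`-coadjoint action. -/
def isotropy {k : ℕ} (μ : Fin k → LieDual EG G) : Subgroup G where
  carrier := {g | ∀ a, Coad g (μ a) = μ a}
  one_mem' := fun a ↦ Coad_one (μ a)
  mul_mem' := by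
    intro g h hg hh a
    rw [Coad_mul, hh a, hg a]
  inv_mem' := by
    intro g hg a
    have h := Coad_mul g⁻¹ g (μ a)
    rw [hg a, inv_mul_cancel, Coad_one] at h
    exact h.symm

end Isotropy

/-- The lifted action `g · α_q = T^*_{g q} Φ_{g⁻¹} (α_q)` on `(T^1_k)^*Q`. -/
def covSmul {k : ℕ} (g : G) (x : Cov E Q k) : Cov E Q k :=
  ⟨g • x.proj, ContinuousLinearMap.comp (x.2 : E →L[ℝ] (Fin k → ℝ))
    (mfderiv 𝓘(ℝ, E) 𝓘(ℝ, E) (fun y : Q ↦ g⁻¹ • y) (g • x.proj) : E →L[ℝ] E)⟩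

theorem cov_ext {k : ℕ} {x y : Cov E Q k} (h : x.proj = y.proj)
    (h2 : (x.2 : E →L[ℝ] (Fin k → ℝ)) = y.2) : x = y := by
  obtain ⟨q, α⟩ := x
  obtain ⟨q', α'⟩ := y
  obtain rfl : q = q' := h
  exact congrArg (Bundle.TotalSpace.mk q) h2

theorem covSmul_one {k : ℕ} (x : Cov E Q k) : covSmul (1 : G) x = x := by
  refine cov_ext (one_smul G x.proj) ?_
  have e : (fun y : Q ↦ (1 : G)⁻¹ • y) = id := by ext; simp
  have key : (mfderiv 𝓘(ℝ, E) 𝓘(ℝ, E) (fun y : Q ↦ (1 : G)⁻¹ • y) ((1 : G) • x.proj) :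
      E →L[ℝ] E) = ContinuousLinearMap.id ℝ E := by
    rw [e]; exact mfderiv_id
  change ContinuousLinearMap.comp (x.2 : E →L[ℝ] (Fin k → ℝ)) _ = _
  rw [key]
  rfl

variable (EG) in
theorem covSmul_mul [ContMDiffSMul 𝓘(ℝ, EG) 𝓘(ℝ, E) ∞ G Q] {k : ℕ} (g h : G) (x : Cov E Q k) :
    covSmul (g * h) x = covSmul g (covSmul h x) := by
  refine cov_ext (mul_smul g h x.proj) ?_
  have d : ∀ g : G, MDifferentiable 𝓘(ℝ, E) 𝓘(ℝ, E) (fun y : Q ↦ g • y) := fun g ↦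
    (ContMDiffSMul.contMDiff_const_smul (I := 𝓘(ℝ, EG)) (I' := 𝓘(ℝ, E)) (n := ∞)
      (M := Q) g).mdifferentiable (by simp)
  have e : (fun y : Q ↦ (g * h)⁻¹ • y) = (fun y : Q ↦ h⁻¹ • y) ∘ (fun y : Q ↦ g⁻¹ • y) := by
    ext y; simp [mul_smul]
  have key := mfderiv_comp (I := 𝓘(ℝ, E)) (I' := 𝓘(ℝ, E)) (I'' := 𝓘(ℝ, E))
    ((g * h) • x.proj) (d h⁻¹ (g⁻¹ • ((g * h) • x.proj))) (d g⁻¹ ((g * h) • x.proj))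
  have e1 : g⁻¹ • ((g * h) • x.proj) = h • x.proj := by simp [mul_smul]
  have e2 : (g * h) • x.proj = g • h • x.proj := mul_smul g h x.proj
  have c : ∀ (f : Q → Q) (y z : Q), y = z → (mfderiv 𝓘(ℝ, E) 𝓘(ℝ, E) f y : E →L[ℝ] E) =
      (mfderiv 𝓘(ℝ, E) 𝓘(ℝ, E) f z : E →L[ℝ] E) := by
    rintro f y z rfl; rfl
  have key2 : (mfderiv 𝓘(ℝ, E) 𝓘(ℝ, E) (fun y : Q ↦ (g * h)⁻¹ • y) ((g * h) • x.proj) :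
      E →L[ℝ] E) = ContinuousLinearMap.comp
        (mfderiv 𝓘(ℝ, E) 𝓘(ℝ, E) (fun y : Q ↦ h⁻¹ • y) (h • x.proj) : E →L[ℝ] E)
        (mfderiv 𝓘(ℝ, E) 𝓘(ℝ, E) (fun y : Q ↦ g⁻¹ • y) (g • h • x.proj) : E →L[ℝ] E) := by
    rw [e]
    refine Eq.trans key ?_
    exact congrArg₂ (fun L L' : E →L[ℝ] E ↦ L.comp L') (c _ _ _ e1) (c _ _ _ e2)
  change ContinuousLinearMap.comp (x.2 : E →L[ℝ] (Fin k → ℝ)) _ = _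
  rw [key2]
  rfl

/-- The orbit relation of the lifted `G_μ`-action on `J⁻¹(μ)`. -/
def levelRel [LieGroup 𝓘(ℝ, EG) ∞ G] [ContMDiffSMul 𝓘(ℝ, EG) 𝓘(ℝ, E) ∞ G Q] {k : ℕ}
    (μ : Fin k → LieDual EG G) : Setoid (level E Q μ) where
  r x y := ∃ g ∈ isotropy μ, covSmul g x.1 = y.1
  iseqv :=
    { refl := fun x ↦ ⟨1, one_mem _, covSmul_one x.1⟩
      symm := by
        rintro x y ⟨g, hg, h⟩
        refine ⟨g⁻¹, inv_mem hg, ?_⟩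
        rw [← h, ← covSmul_mul EG, inv_mul_cancel, covSmul_one]
      trans := by
        rintro x y z ⟨g, hg, h⟩ ⟨g', hg', h'⟩
        exact ⟨g' * g, mul_mem hg' hg, by rw [covSmul_mul EG, h, h']⟩ }

variable (G Q) in
/-- The orbit space `Q/G`. -/
abbrev OrbSpace : Type _ := Quotient (MulAction.orbitRel G Q)

variable (Q) in
/-- The orbit space `Q/G_μ`. -/
abbrev OrbSpaceMu [LieGroup 𝓘(ℝ, EG) ∞ G] {k : ℕ} (μ : Fin k → LieDual EG G) : Type _ :=
  Quotient (MulAction.orbitRel (isotropy μ) Q)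

variable (E Q) in
/-- The reduced space `J⁻¹(μ)/G_μ`. -/
abbrev RedSpace [LieGroup 𝓘(ℝ, EG) ∞ G] [ContMDiffSMul 𝓘(ℝ, EG) 𝓘(ℝ, E) ∞ G Q] {k : ℕ}
    (μ : Fin k → LieDual EG G) : Type _ :=
  Quotient (levelRel (E := E) (Q := Q) μ)

end Action

/-! ### Smooth structures on quotients and on level sets -/

section Structures

/-- The given atlas makes the topological space `X` a smooth manifold of dimension `m` (Hausdorff
and second countable). -/
structure IsSmoothManifold (m : ℕ) (X : Type*) [TopologicalSpace X]
    [ChartedSpace (EuclideanSpace ℝ (Fin m)) X] : Prop where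
  isManifold : IsManifold (𝓡 m) ∞ X
  t2 : T2Space X
  secondCountable : SecondCountableTopology X

variable {E : Type*} [NormedAddCommGroup E] [NormedSpace ℝ E] {H : Type*} [TopologicalSpace H]
  (I : ModelWithCorners ℝ E H) {X : Type*} [TopologicalSpace X] [ChartedSpace H X]

/-- The given atlas on the topological quotient `X/s` is the quotient manifold structure: `X/s` is
a smooth manifold and the projection is a submersion (this determines the structure). -/
structure IsQuotientManifold (s : Setoid X) (m : ℕ)
    [ChartedSpace (EuclideanSpace ℝ (Fin m)) (Quotient s)] : Prop where
  isSmoothManifold : IsSmoothManifold m (Quotient s)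
  isSubmersion : Manifold.IsSubmersion I (𝓡 m) ∞ (Quotient.mk s)

/-- The given atlas on the subset `S` (with the subspace topology) makes it an embedded
submanifold of `X` (this determines the structure). -/
structure IsEmbeddedSubmanifold (S : Set X) (m : ℕ)
    [ChartedSpace (EuclideanSpace ℝ (Fin m)) S] : Prop where
  isSmoothManifold : IsSmoothManifold m S
  isSmoothEmbedding : Manifold.IsSmoothEmbedding (𝓡 m) I ∞ (Subtype.val : S → X)

end Structures

/-! ### The pullback bundle and its forms -/

section Target

variable {b c k : ℕ} {B : Type*} [TopologicalSpace B] [ChartedSpace (EuclideanSpace ℝ (Fin b)) B]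
  [IsManifold (𝓡 b) ∞ B] {C : Type*} [TopologicalSpace C]
  [ChartedSpace (EuclideanSpace ℝ (Fin c)) C]

/-- For a smooth map `p : C → B`, the total space of the pullback bundle
`p^*((T^1_k)^*B) = C ×_B (T^*B ⊕ ⋯ ⊕ T^*B)`. -/
abbrev PullCov (k : ℕ) (p : C^∞⟮𝓡 c, C; 𝓡 b, B⟯) : Type _ :=
  Bundle.TotalSpace (EuclideanSpace ℝ (Fin b) →L[ℝ] (Fin k → ℝ))
    (p *ᵖ (CovFib (EuclideanSpace ℝ (Fin b)) B k))

/-- The model with corners of the pullback bundle. -/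
abbrev pullModel (b c k : ℕ) : ModelWithCorners ℝ
    (EuclideanSpace ℝ (Fin c) × (EuclideanSpace ℝ (Fin b) →L[ℝ] (Fin k → ℝ)))
    (ModelProd (EuclideanSpace ℝ (Fin c)) (EuclideanSpace ℝ (Fin b) →L[ℝ] (Fin k → ℝ))) :=
  (𝓡 c).prod 𝓘(ℝ, EuclideanSpace ℝ (Fin b) →L[ℝ] (Fin k → ℝ))

/-- The projection `pr_1` onto the base `C`. -/
def pr₁ (p : C^∞⟮𝓡 c, C; 𝓡 b, B⟯) (x : PullCov k p) : C := x.proj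

/-- The projection onto `(T^1_k)^*B`. -/
def pr₂ (p : C^∞⟮𝓡 c, C; 𝓡 b, B⟯) (x : PullCov k p) : Cov (EuclideanSpace ℝ (Fin b)) B k :=
  Bundle.Pullback.lift p x

/-- The forms `(pr_2^a)^* ω_B - (pr_1)^* β_a` on the pullback bundle. -/
def magneticForm (p : C^∞⟮𝓡 c, C; 𝓡 b, B⟯) (β : Fin k → DForm (𝓡 c) C 2) (a : Fin k) :
    DForm (pullModel b c k) (PullCov k p) 2 := fun x ↦
  pullback (pullModel b c k) (cotModel (EuclideanSpace ℝ (Fin b)))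
      (fun y : PullCov k p ↦ covProj a (pr₂ p y)) (canForm (EuclideanSpace ℝ (Fin b)) B) x
    - pullback (pullModel b c k) (𝓡 c) (pr₁ p) (β a) x

end Target

end PolyRed

end

/-!
The theorem rests on the momentum shift. A point `(q, α)` of the level set `J⁻¹(μ)` and the
covectors `𝒜_μ = (𝒜_{μ_1}, …, 𝒜_{μ_k})` at `q` take the same values `⟨μ_a, ξ⟩` on the infinitesimal
generators `ξ_Q(q)`, so `α - 𝒜_μ` vanishes along the `G`-orbit and factors as `γ ∘ T_q π`. Hence
`T (q, α) = ([q]_μ, γ)` defines a map from `J⁻¹(μ)` to the pullback bundle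
(`exists_isMomentumShift`). It is a smooth surjection with smooth local sections, built from local
sections of `Q → Q/G_μ`, and its fibres are the `G_μ`-orbits (`IsMomentumShift.contMDiff`,
`.surjective`, `.hasLocalSections`, `.apply_eq_iff`). Two such maps with the same fibres have
diffeomorphic targets, which yields the manifold structure of `J⁻¹(μ)/G_μ` and the diffeomorphism
`τ_μ` (`exists_isQuotientManifold_of_hasLocalSections`, `exists_diffeomorph_of_hasLocalSections`).

The forms are matched by the tautological one-forms. The pullback by `T` of the tautological form of
the `a`-th copy of `T^*(Q/G)` is that of `T^*Q` minus the pullback of `𝒜_{μ_a}`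
(`IsMomentumShift.pullback_tautForm`). After exterior differentiation the last term is cancelled by
`ℬ_{μ_a}`, so `T` pulls the magnetic forms back to the canonical forms of the level set
(`IsMomentumShift.pullback_magneticForm`). The reduced forms are therefore the pullbacks of the
magnetic forms by `τ_μ`, and it suffices to treat the latter.

All statements on the curvature follow from the identity
`d𝒜_{μ_a}(ξ_Q, w) = d/dt ⟨μ_a, Ad_{exp tξ} 𝒜(w)⟩` at `t = 0` (`formAt_dExt_component_infGen`).
If `ξ` is in the Lie algebra of `G_μ`, the right-hand side vanishes; together with the invariance
under `G_μ` this makes `d𝒜_{μ_a}` descend to `Q/G_μ` (`IsOrbitDiagram.exists_curvature`).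
Conversely, if the right-hand side vanishes for all `a` and all vertical `w`, then `ξ` is in the Lie
algebra of `G_μ`, so the forms `ℬ_{μ_a}` have no common kernel on the fibres of `Q/G_μ → Q/G`
(`IsOrbitDiagram.curvature_nondegenerate`). In the coordinates of a chart of `Q/G` the canonical
part of the magnetic forms pairs the remaining directions with the fibre directions, and
nondegeneracy follows by linear algebra (`magneticForm_nondegenerate`).

The quotients `Q/G` and `Q/G_μ` are covered by one theorem, `exists_isQuotientManifold_orbits`, for
the subgroup `{h | F h = F 1}`, where `F` is a smooth map from `G` to a vector space that
intertwines right translations with linear automorphisms; `F = 0` gives `G`, and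
`F g = (μ_a ∘ Ad_g)_a` gives `G_μ`. Such an `F` has constant rank, so it can be replaced near `1` by
a submersion with the same fibres (`exists_submersion_of_constant_rank`), and no closed subgroup
theorem is needed. Properness provides slice coordinates (`exists_slice`), in which the classes are
the fibres of a submersion, and charts of the quotient are obtained from them
(`exists_quotient_chart`).
-/

noncomputable section

set_option linter.unusedSectionVars false

namespace PolyRed

open Set Filter Function
open scoped Topology

/-! ### The inverse function theorem on manifolds without boundary -/

section InverseFunction

variable {E : Type*} [NormedAddCommGroup E] [NormedSpace ℝ E] [FiniteDimensional ℝ E]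
  {F : Type*} [NormedAddCommGroup F] [NormedSpace ℝ F] [FiniteDimensional ℝ F]

/-- The inverse function theorem, with an inverse that is smooth on its whole domain. -/
theorem exists_openPartialHomeomorph_of_bijective_fderiv {f : E → F} {U : Set E} (hU : IsOpen U)
    {x : E} (hx : x ∈ U) (hf : ContDiffOn ℝ ∞ f U) (hb : Bijective (fderiv ℝ f x)) :
    ∃ e : OpenPartialHomeomorph E F, x ∈ e.source ∧ e.source ⊆ U ∧ EqOn e f e.source ∧
      ContDiffOn ℝ ∞ e e.source ∧ ContDiffOn ℝ ∞ e.symm e.target := by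
  have : CompleteSpace E := FiniteDimensional.complete ℝ E
  have : CompleteSpace F := FiniteDimensional.complete ℝ F
  let L : E ≃L[ℝ] F :=
    (LinearEquiv.ofBijective (fderiv ℝ f x : E →ₗ[ℝ] F) hb).toContinuousLinearEquiv
  have hL : (L : E →L[ℝ] F) = fderiv ℝ f x := by ext v; rfl
  have hfx : ContDiffAt ℝ ∞ f x := hf.contDiffAt (hU.mem_nhds hx)
  have hs : HasStrictFDerivAt f (L : E →L[ℝ] F) x := by
    rw [hL]; exact hfx.hasStrictFDerivAt (by simp)
  -- on the open set where the derivative is invertible, the inverse is smooth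
  let W : Set E := U ∩ (fderiv ℝ f) ⁻¹' (range ((↑) : (E ≃L[ℝ] F) → E →L[ℝ] F))
  have hW : IsOpen W :=
    (hf.continuousOn_fderiv_of_isOpen hU (by simp)).isOpen_inter_preimage hU
      ContinuousLinearEquiv.isOpen
  let e := (hs.toOpenPartialHomeomorph f).restrOpen W hW
  have hsrc : e.source ⊆ W := fun y hy ↦ hy.2
  have hcd : ContDiffOn ℝ ∞ e e.source := hf.mono (hsrc.trans inter_subset_left)
  refine ⟨e, ⟨hs.mem_toOpenPartialHomeomorph_source, hx, L, hL⟩, hsrc.trans inter_subset_left,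
    fun y _ ↦ rfl, hcd, fun z hz ↦ ContDiffAt.contDiffWithinAt ?_⟩
  have hz' := e.map_target hz
  obtain ⟨A, hA⟩ := (hsrc hz').2
  have hd : ContDiffAt ℝ ∞ e (e.symm z) := hcd.contDiffAt (e.open_source.mem_nhds hz')
  refine e.contDiffAt_symm (f₀' := A) hz ?_ hd
  rw [hA]
  exact (hd.differentiableAt (by simp)).hasFDerivAt

variable {H : Type*} [TopologicalSpace H] (I : ModelWithCorners ℝ E H) [I.Boundaryless]
  {M : Type*} [TopologicalSpace M] [ChartedSpace H M]

variable (M) in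
/-- The extended chart at `x`, as an open partial homeomorphism onto an open subset of the model
vector space. -/
def openChart (x : M) : OpenPartialHomeomorph M E :=
  (chartAt H x) ≫ₕ I.toHomeomorph.toOpenPartialHomeomorph

omit [FiniteDimensional ℝ E] in
theorem openChart_coe (x : M) : (openChart I M x : M → E) = extChartAt I x := rfl

omit [FiniteDimensional ℝ E] in
theorem openChart_symm_coe (x : M) : ((openChart I M x).symm : E → M) = (extChartAt I x).symm := rfl

omit [FiniteDimensional ℝ E] in
theorem openChart_source (x : M) : (openChart I M x).source = (extChartAt I x).source := by
  simp [openChart]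

omit [FiniteDimensional ℝ E] in
theorem openChart_target (x : M) : (openChart I M x).target = (extChartAt I x).target := by
  rw [← (openChart I M x).image_source_eq_target, ← (extChartAt I x).image_source_eq_target,
    openChart_source]
  rfl

theorem mfderiv_eq_fderiv_comp_symm {f : M → F} {x : M} (hf : MDifferentiableAt I 𝓘(ℝ, F) f x) :
    (mfderiv I 𝓘(ℝ, F) f x : E →L[ℝ] F) =
      fderiv ℝ (f ∘ (extChartAt I x).symm) (extChartAt I x x) := by
  have h := hf.hasMFDerivAt.2
  rw [I.range_eq_univ] at h
  let D : E →L[ℝ] F := mfderiv I 𝓘(ℝ, F) f x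
  have h' : HasFDerivAt (𝕜 := ℝ) (E := E) (F := F) (f ∘ (extChartAt I x).symm) D
    (extChartAt I x x) := (hasFDerivWithinAt_univ (𝕜 := ℝ) (E := E) (F := F)).1 h
  exact h'.fderiv.symm

variable [IsManifold I ∞ M]

/-- The inverse function theorem for a map from a manifold to a vector space. -/
theorem exists_openPartialHomeomorph_of_bijective_mfderiv {f : M → F} {U : Set M} (hU : IsOpen U)
    {x : M} (hx : x ∈ U) (hf : ContMDiffOn I 𝓘(ℝ, F) ∞ f U)
    (hb : Bijective (mfderiv I 𝓘(ℝ, F) f x)) :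
    ∃ e : OpenPartialHomeomorph M F, x ∈ e.source ∧ e.source ⊆ U ∧ EqOn e f e.source ∧
      ContMDiffOn I 𝓘(ℝ, F) ∞ e e.source ∧ ContMDiffOn 𝓘(ℝ, F) I ∞ e.symm e.target := by
  let c := openChart I M x
  let V : Set E := c.target ∩ c.symm ⁻¹' U
  have hV : IsOpen V := c.symm.isOpen_inter_preimage hU
  have hcs : ContMDiffOn 𝓘(ℝ, E) I ∞ c.symm c.target := by
    have := contMDiffOn_extChartAt_symm (I := I) (n := ∞) x
    rwa [← openChart_target, ← openChart_symm_coe] at this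
  have hc : ContMDiffOn I 𝓘(ℝ, E) ∞ c c.source := by
    have := contMDiffOn_extChartAt (I := I) (n := ∞) (x := x)
    rwa [← extChartAt_source I x, ← openChart_source, ← openChart_coe] at this
  have hxc : x ∈ c.source := by
    rw [openChart_source]; exact mem_extChartAt_source x
  have hcV : c x ∈ V := ⟨c.map_source hxc, by
    change c.symm (c x) ∈ U
    rw [c.left_inv hxc]; exact hx⟩
  have hfV : ContDiffOn ℝ ∞ (f ∘ c.symm) V :=
    contMDiffOn_iff_contDiffOn.1 (hf.comp (hcs.mono inter_subset_left) fun y hy ↦ hy.2)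
  have hbV : Bijective (fderiv ℝ (f ∘ c.symm) (c x)) := by
    have hd : MDifferentiableAt I 𝓘(ℝ, F) f x :=
      (hf.contMDiffAt (hU.mem_nhds hx)).mdifferentiableAt (by simp)
    rw [mfderiv_eq_fderiv_comp_symm I hd] at hb
    exact hb
  obtain ⟨e, hxe, heV, hef, he1, he2⟩ :=
    exists_openPartialHomeomorph_of_bijective_fderiv hV hcV hfV hbV
  have hsub : (c ≫ₕ e).source ⊆ c.source ∩ U := by
    intro y hy
    have h1 := hy.1
    have h2 := (heV hy.2).2
    refine ⟨h1, ?_⟩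
    change c.symm (c y) ∈ U at h2
    rwa [c.left_inv h1] at h2
  refine ⟨c ≫ₕ e, ⟨hxc, hxe⟩, hsub.trans inter_subset_right, ?_, ?_, ?_⟩
  · intro y hy
    have h3 : e (c y) = f (c.symm (c y)) := hef hy.2
    rw [c.left_inv hy.1] at h3
    exact h3
  · exact he1.contMDiffOn.comp (hc.mono fun y hy ↦ hy.1) fun y hy ↦ hy.2
  · exact hcs.comp (he2.contMDiffOn.mono fun y hy ↦ hy.1) fun y hy ↦ hy.2

/-- A local diffeomorphism to a vector space `F ≃ E` yields a chart of the maximal atlas. -/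
theorem exists_mem_maximalAtlas (e : OpenPartialHomeomorph M F)
    (h1 : ContMDiffOn I 𝓘(ℝ, F) ∞ e e.source) (h2 : ContMDiffOn 𝓘(ℝ, F) I ∞ e.symm e.target)
    (L : F ≃L[ℝ] E) :
    (e ≫ₕ L.toHomeomorph.toOpenPartialHomeomorph ≫ₕ I.toHomeomorph.symm.toOpenPartialHomeomorph) ∈
      IsManifold.maximalAtlas I ∞ M := by
  apply OpenPartialHomeomorph.mem_maximalAtlas_of_contMDiffOn
  · have hI : ContMDiff 𝓘(ℝ, E) I ∞ I.toHomeomorph.symm := by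
      have := I.contMDiffOn_symm (n := ∞)
      rw [I.range_eq_univ] at this
      exact contMDiffOn_univ.1 this
    exact (hI.comp L.contDiff.contMDiff).comp_contMDiffOn (h1.mono fun y hy ↦ hy.1)
  · have hI : ContMDiff I 𝓘(ℝ, E) ∞ I.toHomeomorph := I.contMDiff
    refine h2.comp (((L.symm.contDiff.contMDiff).comp hI).contMDiffOn) ?_
    intro y hy
    simpa using hy

/-- A map to a vector space with surjective derivative at `x` is, in a suitable local
diffeomorphism around `x`, the first projection. -/
theorem exists_openPartialHomeomorph_fst {f : M → F} {U : Set M} (hU : IsOpen U)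
    {x : M} (hx : x ∈ U) (hf : ContMDiffOn I 𝓘(ℝ, F) ∞ f U)
    (hs : Surjective (mfderiv I 𝓘(ℝ, F) f x)) {m : ℕ}
    (hm : Module.finrank ℝ E = Module.finrank ℝ F + m) :
    ∃ e : OpenPartialHomeomorph M (F × EuclideanSpace ℝ (Fin m)), x ∈ e.source ∧ e.source ⊆ U ∧
      (∀ y ∈ e.source, (e y).1 = f y) ∧
      ContMDiffOn I 𝓘(ℝ, F × EuclideanSpace ℝ (Fin m)) ∞ e e.source ∧
      ContMDiffOn 𝓘(ℝ, F × EuclideanSpace ℝ (Fin m)) I ∞ e.symm e.target := by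
  have hfd : MDifferentiableAt I 𝓘(ℝ, F) f x :=
    (hf.contMDiffAt (hU.mem_nhds hx)).mdifferentiableAt (by simp)
  let D : E →L[ℝ] F := fderiv ℝ (f ∘ (extChartAt I x).symm) (extChartAt I x x)
  have hD : (mfderiv I 𝓘(ℝ, F) f x : E →L[ℝ] F) = D := mfderiv_eq_fderiv_comp_symm I hfd
  let K : Submodule ℝ E := LinearMap.ker (D : E →ₗ[ℝ] F)
  have hDs : Surjective (D : E →ₗ[ℝ] F) := by
    intro w
    obtain ⟨v, hv⟩ := hs w
    refine ⟨v, ?_⟩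
    rw [← hD]
    exact hv
  have hK : Module.finrank ℝ K = Module.finrank ℝ (EuclideanSpace ℝ (Fin m)) := by
    have h := LinearMap.finrank_range_add_finrank_ker (D : E →ₗ[ℝ] F)
    rw [LinearMap.range_eq_top.2 hDs, finrank_top] at h
    change Module.finrank ℝ F + Module.finrank ℝ K = Module.finrank ℝ E at h
    rw [finrank_euclideanSpace_fin]
    omega
  -- `R` is injective on the kernel of `D`, so that `(D, R)` is an isomorphism
  obtain ⟨pr, hpr⟩ := LinearMap.exists_leftInverse_of_injective K.subtype
    (LinearMap.ker_eq_bot.2 K.injective_subtype)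
  let R : E →L[ℝ] EuclideanSpace ℝ (Fin m) :=
    LinearMap.toContinuousLinearMap ((LinearEquiv.ofFinrankEq _ _ hK : K →ₗ[ℝ] _) ∘ₗ pr)
  have hR : ∀ v ∈ K, R v = 0 → v = 0 := by
    intro v hv h0
    have h1 : LinearEquiv.ofFinrankEq K _ hK (pr v) = 0 := h0
    have h2 : pr v = ⟨v, hv⟩ := LinearMap.congr_fun hpr ⟨v, hv⟩
    rw [h2, LinearEquiv.map_eq_zero_iff] at h1
    exact congrArg Subtype.val h1
  let c := extChartAt I x
  -- the inverse function theorem is applied to `f`, completed by `R` in a chart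
  let g : M → F × EuclideanSpace ℝ (Fin m) := fun y ↦ (f y, R (c y))
  have hgs : ContMDiffOn I 𝓘(ℝ, F × EuclideanSpace ℝ (Fin m)) ∞ g (U ∩ c.source) := by
    refine (hf.mono inter_subset_left).prodMk_space ?_
    refine R.contMDiff.comp_contMDiffOn ?_
    refine (contMDiffOn_extChartAt (I := I) (n := ∞) (x := x)).mono ?_
    rw [← extChartAt_source I x]; exact inter_subset_right
  have hUo : IsOpen (U ∩ c.source) := hU.inter (isOpen_extChartAt_source x)
  have hxU : x ∈ U ∩ c.source := ⟨hx, mem_extChartAt_source x⟩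
  have hgd : HasFDerivAt (g ∘ c.symm) (D.prod R) (c x) := by
    have h1 : HasFDerivAt (f ∘ c.symm) D (c x) := by
      have h := hfd.hasMFDerivAt.2
      rw [I.range_eq_univ] at h
      exact (hasFDerivWithinAt_univ.1 h).differentiableAt.hasFDerivAt
    have h2 := h1.prodMk (R.hasFDerivAt (x := c x))
    refine h2.congr_of_eventuallyEq ?_
    filter_upwards [extChartAt_target_mem_nhds (I := I) x] with y hy
    change (f (c.symm y), R (c (c.symm y))) = (f (c.symm y), R y)
    rw [c.right_inv hy]
  have hgb : Bijective (mfderiv I 𝓘(ℝ, F × EuclideanSpace ℝ (Fin m)) g x) := by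
    have h := mfderiv_eq_fderiv_comp_symm I
      ((hgs.contMDiffAt (hUo.mem_nhds hxU)).mdifferentiableAt (by simp))
    rw [hgd.fderiv] at h
    change Bijective (mfderiv I 𝓘(ℝ, F × EuclideanSpace ℝ (Fin m)) g x :
      E →L[ℝ] F × EuclideanSpace ℝ (Fin m))
    rw [h]
    have hinj : Injective ((D.prod R : E →L[ℝ] F × EuclideanSpace ℝ (Fin m)) :
        E →ₗ[ℝ] F × EuclideanSpace ℝ (Fin m)) := by
      rw [← LinearMap.ker_eq_bot, LinearMap.ker_eq_bot']
      intro v hv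
      have hv' : (D v, R v) = (0, 0) := hv
      rw [Prod.mk.injEq] at hv'
      exact hR v hv'.1 hv'.2
    have hfr : Module.finrank ℝ E = Module.finrank ℝ (F × EuclideanSpace ℝ (Fin m)) := by
      rw [Module.finrank_prod, finrank_euclideanSpace_fin, hm]
    exact ⟨hinj, (LinearMap.injective_iff_surjective_of_finrank_eq_finrank hfr).1 hinj⟩
  obtain ⟨e, h1, h2, h3, h4, h5⟩ :=
    exists_openPartialHomeomorph_of_bijective_mfderiv I hUo hxU hgs hgb
  exact ⟨e, h1, h2.trans inter_subset_left, fun y hy ↦ by rw [h3 hy], h4, h5⟩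

end InverseFunction

/-! ### Submersions and local sections -/

section Sections

variable {E : Type*} [NormedAddCommGroup E] [NormedSpace ℝ E]
  {H : Type*} [TopologicalSpace H] {I : ModelWithCorners ℝ E H}
  {M : Type*} [TopologicalSpace M] [ChartedSpace H M]
  {E' : Type*} [NormedAddCommGroup E'] [NormedSpace ℝ E']
  {H' : Type*} [TopologicalSpace H'] {I' : ModelWithCorners ℝ E' H'}
  {N : Type*} [TopologicalSpace N] [ChartedSpace H' N]
  {E'' : Type*} [NormedAddCommGroup E''] [NormedSpace ℝ E'']
  {H'' : Type*} [TopologicalSpace H''] {I'' : ModelWithCorners ℝ E'' H''}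
  {P : Type*} [TopologicalSpace P] [ChartedSpace H'' P]

variable (I I') in
/-- Through every point of the source there is a smooth local section of `f`. For smooth maps this
is a form of being a submersion that makes no reference to charts. -/
def HasLocalSections (f : M → N) : Prop :=
  ∀ x, ∃ (V : Set N) (σ : N → M), IsOpen V ∧ f x ∈ V ∧ ContMDiffOn I' I ∞ σ V ∧ σ (f x) = x ∧
    ∀ y ∈ V, f (σ y) = y

theorem HasLocalSections.of_isSubmersion [I.Boundaryless] {f : M → N}
    (hf : Manifold.IsSubmersion I I' ∞ f) : HasLocalSections I I' f := by
  intro x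
  have h := hf.isSubmersionAt x
  let d := h.domChart.extend I
  let c := h.codChart.extend I'
  let L := h.equiv
  have hxd : x ∈ h.domChart.source := h.mem_domChart_source
  have hdc : h.domChart.source ⊆ f ⁻¹' h.codChart.source := h.source_subset_preimage_source
  have hw : ∀ y ∈ d.target, c (f (d.symm y)) = (L y).1 := fun y hy ↦ h.writtenInCharts hy
  -- in the charts `f` is the first projection, and fixing the second coordinate gives the section
  let w₀ := (L (d x)).2
  have hd_src : d.source = h.domChart.source := h.domChart.extend_source
  have hdt : IsOpen d.target := h.domChart.isOpen_extend_target
  have hc : ContMDiffOn I' 𝓘(ℝ, E') ∞ c h.codChart.source :=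
    OpenPartialHomeomorph.contMDiffOn_extend h.codChart_mem_maximalAtlas
  have hg : ContMDiffOn I' 𝓘(ℝ, E) ∞ (fun y ↦ L.symm (c y, w₀)) h.codChart.source :=
    L.symm.contDiff.contMDiff.comp_contMDiffOn (hc.prodMk_space contMDiffOn_const)
  let V : Set N := h.codChart.source ∩ (fun y ↦ L.symm (c y, w₀)) ⁻¹' d.target
  have hx1 : c (f x) = (L (d x)).1 := by
    have := hw (d x) (d.map_source (hd_src ▸ hxd))
    rwa [d.left_inv (hd_src ▸ hxd)] at this
  have hx2 : L.symm (c (f x), w₀) = d x := by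
    rw [hx1]; exact L.symm_apply_apply _
  refine ⟨V, fun y ↦ d.symm (L.symm (c y, w₀)),
    hg.continuousOn.isOpen_inter_preimage h.codChart.open_source hdt, ⟨hdc hxd, ?_⟩, ?_, ?_, ?_⟩
  · change L.symm (c (f x), w₀) ∈ d.target
    rw [hx2]; exact d.map_source (hd_src ▸ hxd)
  · have hds : ContMDiffOn 𝓘(ℝ, E) I ∞ d.symm d.target := by
      have := contMDiffOn_extend_symm h.domChart_mem_maximalAtlas
      rwa [← h.domChart.extend_target'] at this
    exact hds.comp (hg.mono inter_subset_left) fun y hy ↦ hy.2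
  · change d.symm (L.symm (c (f x), w₀)) = x
    rw [hx2]; exact d.left_inv (hd_src ▸ hxd)
  · intro y hy
    have h1 := hw _ hy.2
    rw [L.apply_symm_apply] at h1
    have h2 : d.symm (L.symm (c y, w₀)) ∈ h.domChart.source := by
      rw [← hd_src]; exact d.map_target hy.2
    refine c.injOn ?_ ?_ h1
    · rw [h.codChart.extend_source]; exact hdc h2
    · rw [h.codChart.extend_source]; exact hy.1

theorem HasLocalSections.isOpenMap {f : M → N} (hf : HasLocalSections I I' f) : IsOpenMap f := by
  intro U hU
  rw [isOpen_iff_mem_nhds]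
  rintro _ ⟨x, hx, rfl⟩
  obtain ⟨V, σ, hV, hxV, hσ, hσx, hfσ⟩ := hf x
  refine mem_of_superset ((hσ.continuousOn.isOpen_inter_preimage hV hU).mem_nhds
    ⟨hxV, by rwa [mem_preimage, hσx]⟩) ?_
  rintro y ⟨hy, hy'⟩
  exact ⟨σ y, hy', hfσ y hy⟩

theorem HasLocalSections.surjective_mfderiv {f : M → N} (hf : HasLocalSections I I' f)
    (hs : ContMDiff I I' ∞ f) (x : M) : Surjective (mfderiv I I' f x) := by
  obtain ⟨V, σ, hV, hxV, hσ, hσx, hfσ⟩ := hf x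
  have hσd : HasMFDerivAt I' I σ (f x) (mfderiv I' I σ (f x)) :=
    ((hσ.contMDiffAt (hV.mem_nhds hxV)).mdifferentiableAt (by simp)).hasMFDerivAt
  have hfd : HasMFDerivAt I I' f (σ (f x)) (mfderiv I I' f (σ (f x))) :=
    (hs.mdifferentiable (by simp) _).hasMFDerivAt
  have h1 : HasMFDerivAt I' I' (f ∘ σ) (f x) (ContinuousLinearMap.id ℝ (TangentSpace I' (f x))) := by
    refine (hasMFDerivAt_id (I := I') (f x)).congr_of_eventuallyEq ?_
    filter_upwards [hV.mem_nhds hxV] with y hy using hfσ y hy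
  have h2 := hasMFDerivAt_unique (hfd.comp (f x) hσd) h1
  have h3 : ∀ z, z = x → Surjective (mfderiv I I' f z : E →L[ℝ] E') →
      Surjective (mfderiv I I' f x : E →L[ℝ] E') := by
    rintro z rfl h; exact h
  refine h3 _ hσx fun w ↦ ⟨(mfderiv I' I σ (f x) : E' →L[ℝ] E) w, ?_⟩
  exact congrArg (fun L : E' →L[ℝ] E' ↦ L w) h2

theorem HasLocalSections.contMDiff_of_comp {f : M → N} (hf : HasLocalSections I I' f)
    (hsurj : Surjective f) {g : N → P} (hg : ContMDiff I I'' ∞ (g ∘ f)) :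
    ContMDiff I' I'' ∞ g := by
  intro y
  obtain ⟨x, rfl⟩ := hsurj y
  obtain ⟨V, σ, hV, hxV, hσ, hσx, hfσ⟩ := hf x
  have h := hg.comp_contMDiffOn hσ
  refine ((h.congr fun y hy ↦ ?_).contMDiffAt (hV.mem_nhds hxV))
  exact congrArg g (hfσ y hy).symm

end Sections

/-! ### Quotient manifolds -/

section Quotients

variable {E : Type*} [NormedAddCommGroup E] [NormedSpace ℝ E] [FiniteDimensional ℝ E]
  {H : Type*} [TopologicalSpace H] (I : ModelWithCorners ℝ E H) [I.Boundaryless]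
  {X : Type*} [TopologicalSpace X] [ChartedSpace H X] [IsManifold I ∞ X]

/-- Charts of a quotient: if `f` is a local submersion whose fibres are the traces of the classes
of `s`, then `f` descends to a chart of the quotient space. -/
theorem exists_quotient_chart (s : Setoid X) (hopen : IsOpenMap (Quotient.mk s)) {m n : ℕ}
    {x : X} (hdim : Module.finrank ℝ E = n + m) {U : Set X}
    {f : X → EuclideanSpace ℝ (Fin n)} (hU : IsOpen U) (hx : x ∈ U)
    (hf : ContMDiffOn I (𝓡 n) ∞ f U) (hs : Surjective (mfderiv I (𝓡 n) f x))
    (hker : ∀ y ∈ U, ∀ z ∈ U, s y z ↔ f y = f z) :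
    ∃ (e : OpenPartialHomeomorph (Quotient s) (EuclideanSpace ℝ (Fin n)))
      (σ : EuclideanSpace ℝ (Fin n) → X) (W : Set X)
      (Φ : OpenPartialHomeomorph X (EuclideanSpace ℝ (Fin n) × EuclideanSpace ℝ (Fin m))),
      IsOpen W ∧ x ∈ W ∧ ContMDiffOn I (𝓡 n) ∞ f W ∧ ContMDiffOn (𝓡 n) I ∞ σ e.target ∧
      e.source = Quotient.mk s '' W ∧ (∀ y ∈ W, e (Quotient.mk s y) = f y) ∧
      (∀ v ∈ e.target, e.symm v = Quotient.mk s (σ v)) ∧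
      x ∈ Φ.source ∧ (∀ y ∈ Φ.source, y ∈ W ∧ (Φ y).1 = f y) ∧
      ContMDiffOn I 𝓘(ℝ, EuclideanSpace ℝ (Fin n) × EuclideanSpace ℝ (Fin m)) ∞ Φ Φ.source ∧
      ContMDiffOn 𝓘(ℝ, EuclideanSpace ℝ (Fin n) × EuclideanSpace ℝ (Fin m)) I ∞
        Φ.symm Φ.target := by
  have hdim' : Module.finrank ℝ E = Module.finrank ℝ (EuclideanSpace ℝ (Fin n)) + m := by
    rwa [finrank_euclideanSpace_fin]
  obtain ⟨Φ, hxΦ, hΦU, hΦf, hΦ1, hΦ2⟩ := exists_openPartialHomeomorph_fst I hU hx hf hs hdim'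
  -- slice `w = w₀` of the product chart: it is parametrized by `σ` and meets
  -- every class that meets `W`
  let w₀ := (Φ x).2
  let A : Set (EuclideanSpace ℝ (Fin n)) := {v | (v, w₀) ∈ Φ.target}
  have hA : IsOpen A := Φ.open_target.preimage (by fun_prop)
  let σ : EuclideanSpace ℝ (Fin n) → X := fun v ↦ Φ.symm (v, w₀)
  have hσ : ContMDiffOn (𝓡 n) I ∞ σ A := by
    refine hΦ2.comp (ContDiff.contMDiff ?_).contMDiffOn fun v hv ↦ hv
    fun_prop
  let W : Set X := Φ.source ∩ f ⁻¹' A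
  have hfΦ : ContMDiffOn I (𝓡 n) ∞ f Φ.source := hf.mono hΦU
  have hW : IsOpen W := hfΦ.continuousOn.isOpen_inter_preimage Φ.open_source hA
  have hWU : W ⊆ U := inter_subset_left.trans hΦU
  have hσf : ∀ v ∈ A, f (σ v) = v := by
    intro v hv
    rw [← hΦf _ (Φ.map_target hv)]
    rw [Φ.right_inv hv]
  have hσW : ∀ v ∈ A, σ v ∈ W := fun v hv ↦ ⟨Φ.map_target hv, by
    rw [mem_preimage, hσf v hv]; exact hv⟩
  have hxW : x ∈ W := ⟨hxΦ, by
    change (f x, w₀) ∈ Φ.target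
    rw [← hΦf x hxΦ]; exact Φ.map_source hxΦ⟩
  -- `rep` picks representatives in `W`; elsewhere its value is irrelevant
  have hrep : ∀ q : Quotient s, ∃ y : X, q ∈ Quotient.mk s '' W → y ∈ W ∧ Quotient.mk s y = q := by
    intro q
    by_cases hq : q ∈ Quotient.mk s '' W
    · obtain ⟨y, hy, hyq⟩ := hq
      exact ⟨y, fun _ ↦ ⟨hy, hyq⟩⟩
    · exact ⟨x, fun h ↦ absurd h hq⟩
  choose rep hrep using hrep
  have hfr : ∀ y ∈ W, f (rep (Quotient.mk s y)) = f y := by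
    intro y hy
    obtain ⟨h1, h2⟩ := hrep _ (mem_image_of_mem _ hy)
    exact (hker _ (hWU h1) _ (hWU hy)).1 (Quotient.exact h2)
  let e : OpenPartialHomeomorph (Quotient s) (EuclideanSpace ℝ (Fin n)) :=
    { toFun := fun q ↦ f (rep q)
      invFun := fun v ↦ Quotient.mk s (σ v)
      source := Quotient.mk s '' W
      target := A
      map_source' := by
        rintro _ ⟨y, hy, rfl⟩
        rw [hfr y hy]; exact hy.2
      map_target' := fun v hv ↦ mem_image_of_mem _ (hσW v hv)
      left_inv' := by
        rintro _ ⟨y, hy, rfl⟩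
        rw [hfr y hy]
        exact Quotient.sound ((hker _ (hWU (hσW _ hy.2)) _ (hWU hy)).2 (hσf _ hy.2))
      right_inv' := fun v hv ↦ by rw [hfr _ (hσW v hv), hσf v hv]
      open_source := hopen W hW
      open_target := hA
      continuousOn_toFun := by
        rw [continuousOn_open_iff (hopen W hW)]
        intro t ht
        have : Quotient.mk s '' W ∩ (fun q ↦ f (rep q)) ⁻¹' t = Quotient.mk s '' (W ∩ f ⁻¹' t) := by
          ext q
          constructor
          · rintro ⟨⟨y, hy, rfl⟩, hq⟩
            refine ⟨y, ⟨hy, ?_⟩, rfl⟩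
            rw [mem_preimage, ← hfr y hy]; exact hq
          · rintro ⟨y, ⟨hy, hyt⟩, rfl⟩
            refine ⟨mem_image_of_mem _ hy, ?_⟩
            rw [mem_preimage, hfr y hy]; exact hyt
        rw [this]
        exact hopen _ ((hfΦ.continuousOn.mono inter_subset_left).isOpen_inter_preimage hW ht)
      continuousOn_invFun := continuous_quotient_mk'.comp_continuousOn hσ.continuousOn }
  refine ⟨e, σ, W, Φ.restrOpen W hW, hW, hxW, hf.mono hWU, hσ, rfl, hfr, fun v _ ↦ rfl,
    ⟨hxΦ, hxW⟩, fun y hy ↦ ⟨hy.2, hΦf y hy.1⟩, hΦ1.mono inter_subset_left, hΦ2.mono fun v hv ↦ ?_⟩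
  exact hv.1

/-- The quotient of a manifold by an equivalence relation whose classes are, locally, the fibres of
submersions, and whose equivalent points are related by local smooth maps preserving the classes. -/
theorem exists_isQuotientManifold [SecondCountableTopology X] (s : Setoid X)
    (hT2 : T2Space (Quotient s)) (hopen : IsOpenMap (Quotient.mk s)) {m n : ℕ}
    (hdim : X → Module.finrank ℝ E = n + m)
    (hloc : ∀ x, ∃ (U : Set X) (f : X → EuclideanSpace ℝ (Fin n)), IsOpen U ∧ x ∈ U ∧
      ContMDiffOn I (𝓡 n) ∞ f U ∧ Surjective (mfderiv I (𝓡 n) f x) ∧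
      ∀ y ∈ U, ∀ z ∈ U, s y z ↔ f y = f z)
    (htrans : ∀ x y, s x y → ∃ (U : Set X) (D : X → X), IsOpen U ∧ x ∈ U ∧
      ContMDiffOn I I ∞ D U ∧ D x = y ∧ ∀ z ∈ U, s z (D z)) :
    ∃ _ : ChartedSpace (EuclideanSpace ℝ (Fin n)) (Quotient s), IsQuotientManifold I s n := by
  choose U f hU hxU hf hfs hker using hloc
  choose e σ W Φ hW hxW hfW hσ hesrc he hesymm hxΦ hΦ hΦ1 hΦ2 using fun x ↦
    exists_quotient_chart I s hopen (hdim x) (hU x) (hxU x) (hf x) (hfs x) (hker x)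
  let cs : ChartedSpace (EuclideanSpace ℝ (Fin n)) (Quotient s) :=
    { atlas := range e
      chartAt := fun q ↦ e q.out
      mem_chart_source := fun q ↦ by
        rw [hesrc]
        exact ⟨q.out, hxW _, Quotient.out_eq q⟩
      chart_mem_atlas := fun q ↦ mem_range_self _ }
  have hman : IsManifold (𝓡 n) ∞ (Quotient s) := by
    apply isManifold_of_contDiffOn
    rintro _ _ ⟨x, rfl⟩ ⟨x', rfl⟩
    simp only [modelWithCornersSelf_coe, modelWithCornersSelf_coe_symm, range_id, inter_univ,
      preimage_id, CompTriple.comp_eq]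
    intro v hv
    have hv1 : v ∈ (e x).target := hv.1
    have hv2 : (e x).symm v ∈ (e x').source := hv.2
    rw [hesymm x v hv1, hesrc] at hv2
    obtain ⟨y', hy', hq⟩ := hv2
    -- the coordinate change at `v` is `f x' ∘ D ∘ σ x`, where `D` carries `σ x v` into `W x'`
    obtain ⟨O, D, hO, hxO, hD, hDx, hDs⟩ := htrans (σ x v) y' (Quotient.exact hq.symm)
    have hDσ : ContMDiffOn (𝓡 n) I ∞ (D ∘ σ x) ((e x).target ∩ σ x ⁻¹' O) :=
      hD.comp ((hσ x).mono inter_subset_left) fun v hv ↦ hv.2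
    have ho1 : IsOpen ((e x).target ∩ σ x ⁻¹' O) :=
      (hσ x).continuousOn.isOpen_inter_preimage (e x).open_target hO
    have ho2 : IsOpen (((e x).target ∩ σ x ⁻¹' O) ∩ (D ∘ σ x) ⁻¹' W x') :=
      hDσ.continuousOn.isOpen_inter_preimage ho1 (hW x')
    have hmem : v ∈ ((e x).target ∩ σ x ⁻¹' O) ∩ (D ∘ σ x) ⁻¹' W x' :=
      ⟨⟨hv1, hxO⟩, by rw [mem_preimage, comp_apply, hDx]; exact hy'⟩
    have hcomp : ContDiffOn ℝ ∞ (f x' ∘ (D ∘ σ x))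
        (((e x).target ∩ σ x ⁻¹' O) ∩ (D ∘ σ x) ⁻¹' W x') :=
      contMDiffOn_iff_contDiffOn.1 ((hfW x').comp (hDσ.mono inter_subset_left) fun v hv ↦ hv.2)
    refine ContDiffAt.contDiffWithinAt
      ((hcomp.congr fun v hv ↦ ?_).contDiffAt (ho2.mem_nhds hmem))
    change e x' ((e x).symm v) = _
    rw [hesymm x v hv.1.1, comp_apply, ← he x' _ hv.2]
    exact congrArg _ (Quotient.sound (hDs _ hv.1.2))
  refine ⟨cs, ⟨hman, hT2, TopologicalSpace.Quotient.secondCountableTopology hopen⟩, ?_⟩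
  -- the projection is the first projection in the charts `Φ x` and `e x`
  have hsub : Manifold.IsSubmersionOfComplement (EuclideanSpace ℝ (Fin m)) I (𝓡 n) ∞
      (Quotient.mk s) := by
    intro x
    have hfr : Module.finrank ℝ (EuclideanSpace ℝ (Fin n) × EuclideanSpace ℝ (Fin m)) =
        Module.finrank ℝ E := by
      rw [Module.finrank_prod, finrank_euclideanSpace_fin, finrank_euclideanSpace_fin, hdim x]
    let L : (EuclideanSpace ℝ (Fin n) × EuclideanSpace ℝ (Fin m)) ≃L[ℝ] E :=
      ContinuousLinearEquiv.ofFinrankEq hfr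
    refine Manifold.IsSubmersionAtOfComplement.mk_of_continuousAt
      continuous_quotient_mk'.continuousAt L.symm _ (e x) ?_ ?_
      (exists_mem_maximalAtlas I (Φ x) (hΦ1 x) (hΦ2 x) L)
      (IsManifold.subset_maximalAtlas (mem_range_self x)) ?_
    · simpa using hxΦ x
    · rw [hesrc]; exact mem_image_of_mem _ (hxW x)
    · intro v hv
      have hI : ∀ u : E, I (I.symm u) = u := fun u ↦ I.right_inv (by simp [I.range_eq_univ])
      have hv' : L.symm v ∈ (Φ x).target := by
        have h0 : (∃ y, I y = v) ∧ L.symm v ∈ (Φ x).target := by simpa [hI] using hv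
        exact h0.2
      have h1 := hΦ x _ ((Φ x).map_target hv')
      have h2 : e x (Quotient.mk s ((Φ x).symm (L.symm v))) = (L.symm v).1 := by
        rw [he x _ h1.1, ← h1.2, (Φ x).right_inv hv']
      simpa [hI] using h2
  exact hsub.isSubmersion

end Quotients

/-! ### Regular level sets -/

section LevelSets

variable {E : Type*} [NormedAddCommGroup E] [NormedSpace ℝ E] [FiniteDimensional ℝ E]
  {H : Type*} [TopologicalSpace H] (I : ModelWithCorners ℝ E H) [I.Boundaryless]
  {X : Type*} [TopologicalSpace X] [ChartedSpace H X] [IsManifold I ∞ X]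
  {F : Type*} [NormedAddCommGroup F] [NormedSpace ℝ F] [FiniteDimensional ℝ F]

/-- The regular value theorem. -/
theorem exists_isEmbeddedSubmanifold [T2Space X] [SecondCountableTopology X] {J : X → F} {c : F}
    {S : Set X} (hS : ∀ x, x ∈ S ↔ J x = c) (hJ : ContMDiff I 𝓘(ℝ, F) ∞ J)
    (hreg : ∀ x ∈ S, Surjective (mfderiv I 𝓘(ℝ, F) J x)) {m : ℕ}
    (hdim : S → Module.finrank ℝ E = Module.finrank ℝ F + m) :
    ∃ _ : ChartedSpace (EuclideanSpace ℝ (Fin m)) S, IsEmbeddedSubmanifold I S m := by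
  -- near `x` the chart `Φ x` straightens `J` into the first projection; its second component is a
  -- chart of `S`
  choose Φ hxΦ _ hΦ hΦ1 hΦ2 using fun x : S ↦ exists_openPartialHomeomorph_fst I isOpen_univ
    (mem_univ x.1) hJ.contMDiffOn (hreg x.1 x.2) (hdim x)
  have hJΦ : ∀ (x : S) w, (c, w) ∈ (Φ x).target → (Φ x).symm (c, w) ∈ S := by
    intro x w hw
    rw [hS, ← hΦ x _ ((Φ x).map_target hw), (Φ x).right_inv hw]
  have hΦc : ∀ (x y : S), y.1 ∈ (Φ x).source → (c, (Φ x y).2) = Φ x y := by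
    intro x y hy
    refine Prod.ext ?_ rfl
    rw [hΦ x _ hy]
    exact ((hS y).1 y.2).symm
  classical
  let inv (x : S) (w : EuclideanSpace ℝ (Fin m)) : S :=
    if hw : (c, w) ∈ (Φ x).target then ⟨(Φ x).symm (c, w), hJΦ x w hw⟩ else x
  have hinv : ∀ x w, (c, w) ∈ (Φ x).target → (inv x w : X) = (Φ x).symm (c, w) := by
    intro x w hw
    simp only [inv, dif_pos hw]
  let e (x : S) : OpenPartialHomeomorph S (EuclideanSpace ℝ (Fin m)) :=
    { toFun := fun y ↦ (Φ x y).2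
      invFun := inv x
      source := Subtype.val ⁻¹' (Φ x).source
      target := {w | (c, w) ∈ (Φ x).target}
      map_source' := fun y hy ↦ by
        rw [mem_ofPred_eq, hΦc x y hy]; exact (Φ x).map_source hy
      map_target' := fun w hw ↦ by
        rw [mem_preimage, hinv x w hw]; exact (Φ x).map_target hw
      left_inv' := fun y hy ↦ by
        have h : (c, (Φ x y).2) ∈ (Φ x).target := by
          rw [hΦc x y hy]; exact (Φ x).map_source hy
        refine Subtype.ext ?_
        rw [hinv x _ h, hΦc x y hy, (Φ x).left_inv hy]
      right_inv' := fun w hw ↦ by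
        rw [hinv x w hw, (Φ x).right_inv hw]
      open_source := (Φ x).open_source.preimage continuous_subtype_val
      open_target := (Φ x).open_target.preimage (by fun_prop)
      continuousOn_toFun := continuous_snd.comp_continuousOn
        ((Φ x).continuousOn.comp continuous_subtype_val.continuousOn fun y hy ↦ hy)
      continuousOn_invFun := by
        rw [Topology.IsInducing.subtypeVal.continuousOn_iff]
        refine ContinuousOn.congr (f := fun w ↦ (Φ x).symm (c, w)) ?_ fun w hw ↦ hinv x w hw
        exact (Φ x).symm.continuousOn.comp (by fun_prop) fun w hw ↦ hw }
  let cs : ChartedSpace (EuclideanSpace ℝ (Fin m)) S :=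
    { atlas := range e
      chartAt := e
      mem_chart_source := fun x ↦ hxΦ x
      chart_mem_atlas := fun x ↦ mem_range_self x }
  have hman : IsManifold (𝓡 m) ∞ S := by
    apply isManifold_of_contDiffOn
    rintro _ _ ⟨x, rfl⟩ ⟨x', rfl⟩
    simp only [modelWithCornersSelf_coe, modelWithCornersSelf_coe_symm, range_id, inter_univ,
      preimage_id, CompTriple.comp_eq]
    have hsrc : ∀ w ∈ ((e x).symm ≫ₕ e x').source,
        (c, w) ∈ (Φ x).target ∧ (Φ x).symm (c, w) ∈ (Φ x').source := by
      intro w hw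
      have hw1 : (c, w) ∈ (Φ x).target := hw.1
      have hw2 : (inv x w : X) ∈ (Φ x').source := hw.2
      rw [hinv x w hw1] at hw2
      exact ⟨hw1, hw2⟩
    have hcm : ContMDiffOn 𝓘(ℝ, EuclideanSpace ℝ (Fin m)) 𝓘(ℝ, F × EuclideanSpace ℝ (Fin m)) ∞
        (fun w ↦ Φ x' ((Φ x).symm (c, w))) ((e x).symm ≫ₕ e x').source := by
      refine (hΦ1 x').comp ((hΦ2 x).comp (ContDiff.contMDiff ?_).contMDiffOn
        fun w hw ↦ (hsrc w hw).1) fun w hw ↦ (hsrc w hw).2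
      fun_prop
    refine (contMDiffOn_iff_contDiffOn.1 hcm).snd.congr fun w hw ↦ ?_
    change (Φ x' (inv x w)).2 = _
    rw [hinv x w (hsrc w hw).1]
  refine ⟨cs, ⟨hman, inferInstance, inferInstance⟩, ⟨?_, Topology.IsEmbedding.subtypeVal⟩⟩
  have himm : Manifold.IsImmersionOfComplement F (𝓡 m) I ∞ (Subtype.val : S → X) := by
    intro x
    have hfr : Module.finrank ℝ (EuclideanSpace ℝ (Fin m) × F) = Module.finrank ℝ E := by
      rw [Module.finrank_prod, finrank_euclideanSpace_fin, hdim x, add_comm]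
    let L : (EuclideanSpace ℝ (Fin m) × F) ≃L[ℝ] E := ContinuousLinearEquiv.ofFinrankEq hfr
    -- the translation by `-c` puts `S` at the level `0`, as the normal form of an immersion demands
    let tr : F × EuclideanSpace ℝ (Fin m) ≃ₜ F × EuclideanSpace ℝ (Fin m) :=
      Homeomorph.addRight (-c, 0)
    let Ψ := Φ x ≫ₕ tr.toOpenPartialHomeomorph
    have htr : ContDiff ℝ ∞ tr := contDiff_id.add contDiff_const
    have htr' : ContDiff ℝ ∞ tr.symm := contDiff_id.add contDiff_const
    have hΨ1 : ContMDiffOn I 𝓘(ℝ, F × EuclideanSpace ℝ (Fin m)) ∞ Ψ Ψ.source :=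
      htr.contMDiff.comp_contMDiffOn ((hΦ1 x).mono fun y hy ↦ hy.1)
    have hΨ2 : ContMDiffOn 𝓘(ℝ, F × EuclideanSpace ℝ (Fin m)) I ∞ Ψ.symm Ψ.target :=
      (hΦ2 x).comp htr'.contMDiff.contMDiffOn fun y hy ↦ hy.2
    refine Manifold.IsImmersionAtOfComplement.mk_of_continuousAt
      continuous_subtype_val.continuousAt L (e x) _ (hxΦ x) ?_
      (IsManifold.subset_maximalAtlas (mem_range_self x))
      (exists_mem_maximalAtlas I Ψ hΨ1 hΨ2 ((ContinuousLinearEquiv.prodComm ℝ _ _).trans L)) ?_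
    · simpa [Ψ] using hxΦ x
    · intro w hw
      have hw' : (c, w) ∈ (Φ x).target := by simpa [e] using hw
      have h1 : Φ x (inv x w) + (-c, 0) = (0, w) := by
        rw [hinv x w hw', (Φ x).right_inv hw']
        simp
      have h2 : L (Φ x (inv x w) + (-c, 0)).swap = L (w, 0) := by rw [h1]; rfl
      have hI : ∀ u : E, I (I.symm u) = u := fun u ↦ I.right_inv (by simp [I.range_eq_univ])
      simpa [Ψ, tr, e, hI] using h2
  exact himm.isImmersion

end LevelSets

/-! ### Maps of constant rank -/

/-- The derivative of `f` at `x`, regarded as a linear map between the model spaces. -/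
def tder {E : Type*} [NormedAddCommGroup E] [NormedSpace ℝ E]
    {H : Type*} [TopologicalSpace H] (I : ModelWithCorners ℝ E H)
    {M : Type*} [TopologicalSpace M] [ChartedSpace H M]
    {E' : Type*} [NormedAddCommGroup E'] [NormedSpace ℝ E']
    {H' : Type*} [TopologicalSpace H'] (I' : ModelWithCorners ℝ E' H')
    {M' : Type*} [TopologicalSpace M'] [ChartedSpace H' M'] (f : M → M') (x : M) : E →L[ℝ] E' :=
  mfderiv I I' f x

section ConstantRank

variable {E : Type*} [NormedAddCommGroup E] [NormedSpace ℝ E] [FiniteDimensional ℝ E]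
  {H : Type*} [TopologicalSpace H] (I : ModelWithCorners ℝ E H) [I.Boundaryless]
  {M : Type*} [TopologicalSpace M] [ChartedSpace H M] [IsManifold I ∞ M]
  {W : Type*} [NormedAddCommGroup W] [NormedSpace ℝ W] [FiniteDimensional ℝ W]

/-- The constant rank theorem: near `x`, the map `F` is determined by a submersive linear image
`P ∘ F` of it, and each vector in the kernel of the derivative of `F` at `x` is tangent to a curve
in the fibre of `F`. -/
theorem exists_submersion_of_constant_rank {F : M → W} (hF : ContMDiff I 𝓘(ℝ, W) ∞ F) (x : M)
    {r : ℕ} (hrx : Module.finrank ℝ (LinearMap.range (tder I 𝓘(ℝ, W) F x : E →ₗ[ℝ] W)) = r)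
    (hr : ∀ y, Module.finrank ℝ (LinearMap.range (tder I 𝓘(ℝ, W) F y : E →ₗ[ℝ] W)) ≤ r) :
    ∃ (P : W →L[ℝ] EuclideanSpace ℝ (Fin r)) (N : Set M), IsOpen N ∧ x ∈ N ∧
      Surjective (fun v : E ↦ P (tder I 𝓘(ℝ, W) F x v)) ∧
      (∀ y ∈ N, ∀ z ∈ N, P (F y) = P (F z) → F y = F z) ∧
      ∀ ξ : E, tder I 𝓘(ℝ, W) F x ξ = 0 → ∃ (T : Set ℝ) (c : ℝ → M),
        IsOpen T ∧ 0 ∈ T ∧ ContMDiffOn 𝓘(ℝ) I ∞ c T ∧ c 0 = x ∧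
        tder 𝓘(ℝ) I c 0 1 = ξ ∧ ∀ t ∈ T, F (c t) = F x := by
  let D : E →L[ℝ] W := mfderiv I 𝓘(ℝ, W) F x
  let R : Submodule ℝ W := LinearMap.range (D : E →ₗ[ℝ] W)
  have hR : Module.finrank ℝ R = Module.finrank ℝ (EuclideanSpace ℝ (Fin r)) := by
    rw [finrank_euclideanSpace_fin]; exact hrx
  -- `P` is a projection onto the range of the derivative at `x`, identified with `ℝ^r`
  obtain ⟨pr, hpr⟩ := LinearMap.exists_leftInverse_of_injective R.subtype
    (LinearMap.ker_eq_bot.2 R.injective_subtype)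
  let P : W →L[ℝ] EuclideanSpace ℝ (Fin r) :=
    LinearMap.toContinuousLinearMap ((LinearEquiv.ofFinrankEq _ _ hR : R →ₗ[ℝ] _) ∘ₗ pr)
  have hPs : Surjective (fun v : E ↦ P (D v)) := by
    intro u
    obtain ⟨⟨_, v, rfl⟩, hw⟩ := (LinearEquiv.ofFinrankEq R _ hR).surjective u
    refine ⟨v, ?_⟩
    have h1 : pr (D v) = ⟨D v, v, rfl⟩ := LinearMap.congr_fun hpr ⟨D v, v, rfl⟩
    change LinearEquiv.ofFinrankEq R _ hR (pr (D v)) = u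
    rw [h1]; exact hw
  have hPF : ContMDiff I 𝓘(ℝ, EuclideanSpace ℝ (Fin r)) ∞ (fun y ↦ P (F y)) :=
    P.contMDiff.comp hF
  have hPFd : (mfderiv I 𝓘(ℝ, EuclideanSpace ℝ (Fin r)) (fun y ↦ P (F y)) x :
      E →L[ℝ] EuclideanSpace ℝ (Fin r)) = P.comp D := by
    have h1 : HasMFDerivAt I 𝓘(ℝ, W) F x D := (hF.mdifferentiable (by simp) x).hasMFDerivAt
    exact (P.hasMFDerivAt.comp x h1).mfderiv
  obtain ⟨m, hm⟩ : ∃ m, Module.finrank ℝ E =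
      Module.finrank ℝ (EuclideanSpace ℝ (Fin r)) + m := by
    refine Nat.exists_eq_add_of_le ?_
    exact LinearMap.finrank_le_finrank_of_surjective (f := ((P.comp D : E →L[ℝ] _) : E →ₗ[ℝ] _)) hPs
  have hsur : Surjective (mfderiv I 𝓘(ℝ, EuclideanSpace ℝ (Fin r)) (fun y ↦ P (F y)) x) := by
    intro u
    obtain ⟨v, hv⟩ := hPs u
    refine ⟨v, ?_⟩
    have := congrArg (fun L : E →L[ℝ] EuclideanSpace ℝ (Fin r) ↦ L v) hPFd
    exact this.trans hv
  obtain ⟨Φ, hxΦ, -, hΦ, hΦ1, hΦ2⟩ := exists_openPartialHomeomorph_fst I isOpen_univ (mem_univ x)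
    hPF.contMDiffOn hsur hm
  let V := EuclideanSpace ℝ (Fin r) × EuclideanSpace ℝ (Fin m)
  let Fh : V → W := F ∘ Φ.symm
  have hFh : ContDiffOn ℝ ∞ Fh Φ.target := contMDiffOn_iff_contDiffOn.1 (hF.comp_contMDiffOn hΦ2)
  have hFhd : ∀ z ∈ Φ.target, HasFDerivAt Fh (fderiv ℝ Fh z) z := fun z hz ↦
    ((hFh.contDiffAt (Φ.open_target.mem_nhds hz)).differentiableAt (by simp)).hasFDerivAt
  have hPFh : ∀ z ∈ Φ.target, P (Fh z) = z.1 := by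
    intro z hz
    have := hΦ _ (Φ.map_target hz)
    rw [Φ.right_inv hz] at this
    exact this.symm
  have hPD : ∀ z ∈ Φ.target, ∀ v, P (fderiv ℝ Fh z v) = v.1 := by
    intro z hz v
    have h1 := P.hasFDerivAt.comp z (hFhd z hz)
    have h2 : HasFDerivAt (P ∘ Fh) (ContinuousLinearMap.fst ℝ (EuclideanSpace ℝ (Fin r))
        (EuclideanSpace ℝ (Fin m))) z := by
      refine hasFDerivAt_fst.congr_of_eventuallyEq ?_
      filter_upwards [Φ.open_target.mem_nhds hz] with y hy using hPFh y hy
    exact congrArg (fun L : V →L[ℝ] EuclideanSpace ℝ (Fin r) ↦ L v) (h1.unique h2)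
  -- `P` is injective on the range of the derivative: it maps it onto a space of dimension `r`
  have hker : ∀ z ∈ Φ.target, ∀ w, fderiv ℝ Fh z (0, w) = 0 := by
    intro z hz w
    let R' : Submodule ℝ W := LinearMap.range (fderiv ℝ Fh z : V →ₗ[ℝ] W)
    let DF : E →L[ℝ] W := mfderiv I 𝓘(ℝ, W) F (Φ.symm z)
    let DΦ : V →L[ℝ] E := mfderiv 𝓘(ℝ, V) I Φ.symm z
    have hle : R' ≤ LinearMap.range (DF : E →ₗ[ℝ] W) := by
      have h1 : HasMFDerivAt I 𝓘(ℝ, W) F (Φ.symm z) DF :=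
        (hF.mdifferentiable (by simp) _).hasMFDerivAt
      have h2 : HasMFDerivAt 𝓘(ℝ, V) I Φ.symm z DΦ :=
        ((hΦ2.contMDiffAt (Φ.open_target.mem_nhds hz)).mdifferentiableAt (by simp)).hasMFDerivAt
      have h3 := (h1.comp z h2).mfderiv
      rw [mfderiv_eq_fderiv] at h3
      rintro _ ⟨v, rfl⟩
      exact ⟨DΦ v, (congrArg (fun L : V →L[ℝ] W ↦ L v) h3).symm⟩
    have hfr : Module.finrank ℝ R' ≤ r := (Submodule.finrank_mono hle).trans (hr _)
    let p : R' →ₗ[ℝ] EuclideanSpace ℝ (Fin r) := (P : W →ₗ[ℝ] _) ∘ₗ R'.subtype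
    have hps : Surjective p := fun u ↦ ⟨⟨fderiv ℝ Fh z (u, 0), (u, 0), rfl⟩, hPD z hz (u, 0)⟩
    have hfr' : Module.finrank ℝ R' = Module.finrank ℝ (EuclideanSpace ℝ (Fin r)) := by
      refine le_antisymm ?_ (LinearMap.finrank_le_finrank_of_surjective hps)
      rwa [finrank_euclideanSpace_fin]
    have hpi : Injective p :=
      (LinearMap.injective_iff_surjective_of_finrank_eq_finrank hfr').2 hps
    have h0 : (⟨fderiv ℝ Fh z (0, w), (0, w), rfl⟩ : R') = 0 := by
      apply hpi
      rw [map_zero]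
      exact hPD z hz (0, w)
    exact congrArg Subtype.val h0
  -- on a ball the fibres `{u} × ball` of the first projection are connected, and `Fh` is constant
  -- on them because its derivative in the second direction vanishes
  obtain ⟨ε, hε, hball⟩ := Metric.isOpen_iff.1 Φ.open_target (Φ x) (Φ.map_source hxΦ)
  let N : Set M := Φ.source ∩ Φ ⁻¹' Metric.ball (Φ x) ε
  have hN : IsOpen N := Φ.isOpen_inter_preimage Metric.isOpen_ball
  have hxN : x ∈ N := ⟨hxΦ, Metric.mem_ball_self hε⟩
  have hmem : ∀ (u : EuclideanSpace ℝ (Fin r)) (w : EuclideanSpace ℝ (Fin m)),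
      (u, w) ∈ Metric.ball (Φ x) ε ↔ u ∈ Metric.ball (Φ x).1 ε ∧ w ∈ Metric.ball (Φ x).2 ε := by
    intro u w
    rw [Metric.mem_ball, Metric.mem_ball, Metric.mem_ball, Prod.dist_eq, max_lt_iff]
  have hdet : ∀ y ∈ N, ∀ z ∈ N, P (F y) = P (F z) → F y = F z := by
    intro y hy z hz hyz
    have hy1 := hΦ y hy.1
    have hz1 := hΦ z hz.1
    let u := (Φ y).1
    have hzu : (Φ z).1 = u := by rw [hz1, ← hyz, ← hy1]
    have hyb : u ∈ Metric.ball (Φ x).1 ε ∧ (Φ y).2 ∈ Metric.ball (Φ x).2 ε := (hmem _ _).1 hy.2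
    have hzb : (Φ z).1 ∈ Metric.ball (Φ x).1 ε ∧ (Φ z).2 ∈ Metric.ball (Φ x).2 ε :=
      (hmem _ _).1 hz.2
    have hd : ∀ w ∈ Metric.ball (Φ x).2 ε, HasFDerivAt (fun w ↦ Fh (u, w)) (0 : _ →L[ℝ] W) w := by
      intro w hw
      have hz : (u, w) ∈ Φ.target := hball ((hmem _ _).2 ⟨hyb.1, hw⟩)
      have h1 : HasFDerivAt (fun w : EuclideanSpace ℝ (Fin m) ↦ (u, w))
          (ContinuousLinearMap.inr ℝ (EuclideanSpace ℝ (Fin r)) (EuclideanSpace ℝ (Fin m))) w :=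
        hasFDerivAt_prodMk_right u w
      have h2 := (hFhd _ hz).comp w h1
      have h3 : (fderiv ℝ Fh (u, w)).comp (ContinuousLinearMap.inr ℝ (EuclideanSpace ℝ (Fin r))
          (EuclideanSpace ℝ (Fin m))) = 0 := by
        refine ContinuousLinearMap.ext fun v ↦ ?_
        exact hker _ hz v
      rw [h3] at h2
      exact h2
    have h := Metric.isOpen_ball.is_const_of_fderiv_eq_zero
      (convex_ball (Φ x).2 ε).isPreconnected
      (fun w hw ↦ (hd w hw).differentiableAt.differentiableWithinAt)
      (fun w hw ↦ (hd w hw).fderiv) hyb.2 hzb.2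
    have h1 : Fh (u, (Φ y).2) = F y := congrArg F (Φ.left_inv hy.1)
    have h2 : Fh (u, (Φ z).2) = F z := by
      rw [← hzu]; exact congrArg F (Φ.left_inv hz.1)
    rw [← h1, ← h2]
    exact h
  refine ⟨P, N, hN, hxN, hPs, hdet, fun ξ hξ ↦ ?_⟩
  let DΦ : E →L[ℝ] V := mfderiv I 𝓘(ℝ, V) Φ x
  let DΨ : V →L[ℝ] E := mfderiv 𝓘(ℝ, V) I Φ.symm (Φ x)
  have hΦx : HasMFDerivAt I 𝓘(ℝ, V) Φ x DΦ :=
    ((hΦ1.contMDiffAt (Φ.open_source.mem_nhds hxΦ)).mdifferentiableAt (by simp)).hasMFDerivAt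
  have hΨx : HasMFDerivAt 𝓘(ℝ, V) I Φ.symm (Φ x) DΨ :=
    ((hΦ2.contMDiffAt (Φ.open_target.mem_nhds (Φ.map_source hxΦ))).mdifferentiableAt
      (by simp)).hasMFDerivAt
  have hΨΦ : ∀ v, DΨ (DΦ v) = v := by
    intro v
    have h1 := hΨx.comp x hΦx
    have h2 : HasMFDerivAt I I (Φ.symm ∘ Φ) x (ContinuousLinearMap.id ℝ (TangentSpace I x)) := by
      refine (hasMFDerivAt_id (I := I) x).congr_of_eventuallyEq ?_
      filter_upwards [Φ.open_source.mem_nhds hxΦ] with y hy using Φ.left_inv hy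
    exact congrArg (fun L : E →L[ℝ] E ↦ L v) (hasMFDerivAt_unique h1 h2)
  have hξ1 : (DΦ ξ).1 = 0 := by
    have h1 : HasMFDerivAt 𝓘(ℝ, V) 𝓘(ℝ, EuclideanSpace ℝ (Fin r)) (Prod.fst : V → _) (Φ x)
        (ContinuousLinearMap.fst ℝ (EuclideanSpace ℝ (Fin r)) (EuclideanSpace ℝ (Fin m))) :=
      (hasFDerivAt_fst (𝕜 := ℝ)).hasMFDerivAt
    have h2 := h1.comp x hΦx
    have h3 : HasMFDerivAt I 𝓘(ℝ, EuclideanSpace ℝ (Fin r)) (Prod.fst ∘ Φ) x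
        (mfderiv I 𝓘(ℝ, EuclideanSpace ℝ (Fin r)) (fun y ↦ P (F y)) x) := by
      refine (hPF.mdifferentiable (by simp) x).hasMFDerivAt.congr_of_eventuallyEq ?_
      filter_upwards [Φ.open_source.mem_nhds hxΦ] with y hy using hΦ y hy
    have h4 : (ContinuousLinearMap.fst ℝ (EuclideanSpace ℝ (Fin r))
        (EuclideanSpace ℝ (Fin m))).comp DΦ = P.comp D := (hasMFDerivAt_unique h2 h3).trans hPFd
    have h5 := congrArg (fun L : E →L[ℝ] EuclideanSpace ℝ (Fin r) ↦ L ξ) h4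
    refine h5.trans ?_
    change P (D ξ) = 0
    rw [show D ξ = 0 from hξ, map_zero]
  -- a straight line in the direction of `ξ` in the chart `Φ`
  let l : ℝ → V := fun t ↦ Φ x + t • DΦ ξ
  have hl : ContDiff ℝ ∞ l := by fun_prop
  let T : Set ℝ := l ⁻¹' Metric.ball (Φ x) ε
  have hl0 : l 0 = Φ x := by simp [l]
  have hT : IsOpen T := Metric.isOpen_ball.preimage hl.continuous
  have hcs : ContMDiffOn 𝓘(ℝ) I ∞ (Φ.symm ∘ l) T :=
    hΦ2.comp hl.contMDiff.contMDiffOn fun t ht ↦ hball ht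
  refine ⟨T, Φ.symm ∘ l, hT, ?_, hcs, ?_, ?_, fun t ht ↦ ?_⟩
  · rw [mem_preimage, hl0]; exact Metric.mem_ball_self hε
  · rw [comp_apply, hl0, Φ.left_inv hxΦ]
  · have h1 : HasFDerivAt l (ContinuousLinearMap.toSpanSingleton ℝ (DΦ ξ)) 0 := by
      have h := ((hasDerivAt_id (0 : ℝ)).smul_const (DΦ ξ)).const_add (Φ x)
      rw [one_smul] at h
      exact h.hasFDerivAt
    have h2 : HasMFDerivAt 𝓘(ℝ, V) I Φ.symm (l 0) DΨ := by rw [hl0]; exact hΨx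
    have h3 := (h2.comp 0 h1.hasMFDerivAt).mfderiv
    have h4 := congrArg (fun L : ℝ →L[ℝ] E ↦ L 1) h3
    refine h4.trans ?_
    change DΨ ((1 : ℝ) • DΦ ξ) = ξ
    rw [one_smul, hΨΦ]
  · have htar : l t ∈ Φ.target := hball ht
    refine hdet _ ⟨Φ.map_target htar, ?_⟩ x hxN ?_
    · rw [mem_preimage, Φ.right_inv htar]; exact ht
    · rw [← hΦ _ (Φ.map_target htar), ← hΦ x hxΦ, Φ.right_inv htar]
      change (Φ x).1 + t • (DΦ ξ).1 = _
      rw [hξ1, smul_zero, add_zero]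

end ConstantRank

/-! ### Slices for free proper actions -/

section Slices

variable {EG : Type*} [NormedAddCommGroup EG] [NormedSpace ℝ EG] [FiniteDimensional ℝ EG]
  {G : Type*} [TopologicalSpace G] [ChartedSpace EG G] [Group G] [LieGroup 𝓘(ℝ, EG) ∞ G]
  {E : Type*} [NormedAddCommGroup E] [NormedSpace ℝ E] [FiniteDimensional ℝ E]
  {Q : Type*} [TopologicalSpace Q] [ChartedSpace E Q] [IsManifold 𝓘(ℝ, E) ∞ Q]
  [T2Space Q] [MulAction G Q] [ContMDiffSMul 𝓘(ℝ, EG) 𝓘(ℝ, E) ∞ G Q] [ProperSMul G Q]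

variable (EG G E) in
theorem contMDiff_orbit (q : Q) : ContMDiff 𝓘(ℝ, EG) 𝓘(ℝ, E) ∞ (fun g : G ↦ g • q) :=
  (contMDiff_id (I := 𝓘(ℝ, EG))).smul (contMDiff_const (c := q))

theorem contMDiff_act (EG : Type*) [NormedAddCommGroup EG] [NormedSpace ℝ EG] {G : Type*}
    [TopologicalSpace G] [ChartedSpace EG G] [Group G] {E : Type*} [NormedAddCommGroup E]
    [NormedSpace ℝ E] {Q : Type*} [TopologicalSpace Q] [ChartedSpace E Q] [MulAction G Q]
    [ContMDiffSMul 𝓘(ℝ, EG) 𝓘(ℝ, E) ∞ G Q] (g : G) : ContMDiff 𝓘(ℝ, E) 𝓘(ℝ, E) ∞ (fun q : Q ↦ g • q) :=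
  ContMDiffSMul.contMDiff_const_smul (I := 𝓘(ℝ, EG)) g

variable (EG G E) in
theorem hasMFDerivAt_orbit (q : Q) : HasMFDerivAt 𝓘(ℝ, EG) 𝓘(ℝ, E) (fun g : G ↦ g • q) 1
    (mfderiv 𝓘(ℝ, EG) 𝓘(ℝ, E) (fun g : G ↦ g • q) 1) :=
  ((contMDiff_orbit EG G E q).mdifferentiable (by simp) 1).hasMFDerivAt

theorem isClosedEmbedding_smul_pair (hfree : ∀ (g : G) (q : Q), g • q = q → g = 1) :
    Topology.IsClosedEmbedding (fun p : G × Q ↦ (p.1 • p.2, p.2)) := by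
  have hp : IsProperMap (fun p : G × Q ↦ (p.1 • p.2, p.2)) := ProperSMul.isProperMap_smul_pair
  refine Topology.IsClosedEmbedding.of_continuous_injective_isClosedMap hp.continuous ?_
    hp.isClosedMap
  rintro ⟨g, q⟩ ⟨g', q'⟩ h
  obtain ⟨h1, rfl⟩ := Prod.mk.inj h
  have h2 : (g'⁻¹ * g) • q = q := by
    change g • q = g' • q at h1
    rw [mul_smul, h1, inv_smul_smul]
  rw [← inv_mul_eq_one.1 (hfree _ _ h2)]

variable (EG) in
/-- Slice coordinates for a free proper action: near `q₀` every point is uniquely of the form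
`gf q • σ (sf q)`, where `σ` parametrizes a slice through `q₀`. -/
theorem exists_slice (hfree : ∀ (g : G) (q : Q), g • q = q → g = 1) {m : ℕ}
    (hdim : Module.finrank ℝ E = Module.finrank ℝ EG + m) (q₀ : Q)
    (hinj : Injective (mfderiv 𝓘(ℝ, EG) 𝓘(ℝ, E) (fun g : G ↦ g • q₀) 1)) :
    ∃ (U : Set Q) (gf : Q → G) (sf : Q → EuclideanSpace ℝ (Fin m)), IsOpen U ∧ q₀ ∈ U ∧
      gf q₀ = 1 ∧ ContMDiffOn 𝓘(ℝ, E) 𝓘(ℝ, EG) ∞ gf U ∧ ContMDiffOn 𝓘(ℝ, E) (𝓡 m) ∞ sf U ∧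
      Bijective (fun v : E ↦ (tder 𝓘(ℝ, E) 𝓘(ℝ, EG) gf q₀ v, tder 𝓘(ℝ, E) (𝓡 m) sf q₀ v)) ∧
      (∀ q ∈ U, ∀ h : G, h • q ∈ U → gf (h • q) = h * gf q ∧ sf (h • q) = sf q) ∧
      ∀ q ∈ U, ∀ q' ∈ U, sf q = sf q' → ∃ h : G, h • q = q' := by
  have : ContinuousSMul G Q := inferInstance
  let S := EuclideanSpace ℝ (Fin m)
  let φ := extChartAt 𝓘(ℝ, E) q₀
  have hφs : IsOpen φ.source := isOpen_extChartAt_source q₀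
  have hφt : IsOpen φ.target := isOpen_extChartAt_target q₀
  have hq₀ : q₀ ∈ φ.source := mem_extChartAt_source q₀
  have hφ : ContMDiffOn 𝓘(ℝ, E) 𝓘(ℝ, E) ∞ φ φ.source := by
    have h := contMDiffOn_extChartAt (I := 𝓘(ℝ, E)) (n := ∞) (x := q₀)
    rwa [← extChartAt_source 𝓘(ℝ, E) q₀] at h
  have hφ' : ContMDiffOn 𝓘(ℝ, E) 𝓘(ℝ, E) ∞ φ.symm φ.target := contMDiffOn_extChartAt_symm q₀
  -- the orbit map in the chart
  let o : G → E := fun g ↦ φ (g • q₀)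
  let D : EG →L[ℝ] E := mfderiv 𝓘(ℝ, EG) 𝓘(ℝ, E) o 1
  have ho : ContMDiffOn 𝓘(ℝ, EG) 𝓘(ℝ, E) ∞ o ((fun g : G ↦ g • q₀) ⁻¹' φ.source) :=
    hφ.comp (contMDiff_orbit EG G E q₀).contMDiffOn fun g hg ↦ hg
  have h1q : (1 : G) • q₀ ∈ φ.source := by rw [one_smul]; exact hq₀
  have ho1 : MDifferentiableAt 𝓘(ℝ, EG) 𝓘(ℝ, E) o 1 :=
    (ho.contMDiffAt ((hφs.preimage (contMDiff_orbit EG G E q₀).continuous).mem_nhds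
      h1q)).mdifferentiableAt (by simp)
  have hD : Injective D := by
    have hc : HasMFDerivAt 𝓘(ℝ, E) 𝓘(ℝ, E) φ ((1 : G) • q₀)
        (mfderiv 𝓘(ℝ, E) 𝓘(ℝ, E) φ ((1 : G) • q₀)) :=
      ((hφ.contMDiffAt (hφs.mem_nhds h1q)).mdifferentiableAt (by simp)).hasMFDerivAt
    have h2 := (hc.comp (1 : G) (hasMFDerivAt_orbit EG G E q₀)).mfderiv
    have hci : Injective (mfderiv 𝓘(ℝ, E) 𝓘(ℝ, E) φ ((1 : G) • q₀)) := by
      have h3 := isInvertible_mfderiv_extChartAt (I := 𝓘(ℝ, E)) h1q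
      exact h3.injective
    intro ξ η h
    have h4 := congrArg (fun L : EG →L[ℝ] E ↦ L ξ) h2
    have h5 := congrArg (fun L : EG →L[ℝ] E ↦ L η) h2
    exact hinj (hci ((h4.symm.trans h).trans h5))
  -- the slice is the affine subspace through `φ q₀` along a complement `C` of the orbit directions
  obtain ⟨C, hC⟩ := (LinearMap.range (D : EG →ₗ[ℝ] E)).exists_isCompl
  have hCdim : Module.finrank ℝ S = Module.finrank ℝ C := by
    have h1 := Submodule.finrank_add_eq_of_isCompl hC
    rw [LinearMap.finrank_range_of_inj (f := (D : EG →ₗ[ℝ] E)) hD] at h1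
    rw [finrank_euclideanSpace_fin]
    omega
  let ιl : S ≃ₗ[ℝ] C := LinearEquiv.ofFinrankEq _ _ hCdim
  let ι : S →L[ℝ] E := LinearMap.toContinuousLinearMap (C.subtype ∘ₗ (ιl : S →ₗ[ℝ] C))
  have hιC : ∀ w, ι w ∈ C := fun w ↦ (ιl w).2
  have hι : Injective ι := C.injective_subtype.comp ιl.injective
  let σ : S → Q := fun e ↦ φ.symm (φ q₀ + ι e)
  have hσ0 : σ 0 = q₀ := by
    change φ.symm (φ q₀ + ι 0) = q₀
    rw [map_zero, add_zero]; exact φ.left_inv hq₀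
  let l : S → E := fun e ↦ φ q₀ + ι e
  have hl : ContDiff ℝ ∞ l := contDiff_const.add ι.contDiff
  have hl0 : l 0 = φ q₀ := by simp [l]
  let Tl : Set S := l ⁻¹' φ.target
  have hTl : IsOpen Tl := hφt.preimage hl.continuous
  have h0Tl : (0 : S) ∈ Tl := by
    change l 0 ∈ φ.target
    rw [hl0]; exact φ.map_source hq₀
  have hσ : ContMDiffOn (𝓡 m) 𝓘(ℝ, E) ∞ σ Tl := hφ'.comp hl.contMDiff.contMDiffOn fun e he ↦ he
  have hφσ : ∀ e ∈ Tl, φ (σ e) = l e := fun e he ↦ φ.right_inv he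
  -- the map `(g, e) ↦ g • σ e` is a local diffeomorphism at `(1, 0)`
  let κ : G × S → Q := fun p ↦ p.1 • σ p.2
  let IG := 𝓘(ℝ, EG).prod (𝓡 m)
  have hκ : ContMDiffOn IG 𝓘(ℝ, E) ∞ κ (Prod.snd ⁻¹' Tl) :=
    contMDiff_fst.contMDiffOn.smul (hσ.comp contMDiff_snd.contMDiffOn fun p hp ↦ hp)
  let Ω : Set (G × S) := Prod.snd ⁻¹' Tl ∩ κ ⁻¹' φ.source
  have hΩ : IsOpen Ω := hκ.continuousOn.isOpen_inter_preimage (hTl.preimage continuous_snd) hφs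
  have hκ0 : κ (1, 0) = q₀ := by
    change (1 : G) • σ 0 = q₀
    rw [one_smul, hσ0]
  have h1Ω : ((1 : G), (0 : S)) ∈ Ω := ⟨h0Tl, by rw [mem_preimage, hκ0]; exact hq₀⟩
  let f : G × S → E := fun p ↦ φ (κ p)
  have hf : ContMDiffOn IG 𝓘(ℝ, E) ∞ f Ω := hφ.comp (hκ.mono inter_subset_left) fun p hp ↦ hp.2
  have hfd : ∀ v : EG × S, tder IG 𝓘(ℝ, E) f (1, 0) v = D v.1 + ι v.2 := by
    have hfm : MDifferentiableAt IG 𝓘(ℝ, E) f (1, 0) :=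
      (hf.contMDiffAt (hΩ.mem_nhds h1Ω)).mdifferentiableAt (by simp)
    intro v
    have h1 := mfderiv_prod_eq_add_apply (v := v) hfm
    have h2 : (fun z : G ↦ f (z, (0 : S))) = o := by
      funext g
      change φ (g • σ 0) = φ (g • q₀)
      rw [hσ0]
    have h3 : HasMFDerivAt (𝓡 m) 𝓘(ℝ, E) (fun z : S ↦ f ((1 : G), z)) 0 ι := by
      have h4 : HasFDerivAt l ι 0 := ι.hasFDerivAt.const_add _
      refine h4.hasMFDerivAt.congr_of_eventuallyEq ?_
      filter_upwards [hTl.mem_nhds h0Tl] with e he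
      change φ ((1 : G) • σ e) = l e
      rw [one_smul, hφσ e he]
    refine h1.trans ?_
    have h5 := congrArg (fun L : S →L[ℝ] E ↦ L v.2) h3.mfderiv
    refine congrArg₂ (fun a b : E ↦ a + b) ?_ h5
    have h6 : ∀ u : G → E, u = o → tder 𝓘(ℝ, EG) 𝓘(ℝ, E) u 1 v.1 = D v.1 := by
      rintro _ rfl; rfl
    exact h6 _ h2
  have hfb : Bijective (mfderiv IG 𝓘(ℝ, E) f (1, 0)) := by
    let L : EG × S →L[ℝ] E := mfderiv IG 𝓘(ℝ, E) f (1, 0)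
    have hLi : Injective (L : EG × S →ₗ[ℝ] E) := by
      rw [← LinearMap.ker_eq_bot, LinearMap.ker_eq_bot']
      rintro ⟨ξ, w⟩ hv
      have hv' : D ξ + ι w = 0 := (hfd (ξ, w)).symm.trans hv
      have h1 : ι w ∈ LinearMap.range (D : EG →ₗ[ℝ] E) :=
        ⟨-ξ, by rw [map_neg]; exact neg_eq_of_add_eq_zero_right hv'⟩
      have h2 : ι w = 0 := by
        have := hC.disjoint.le_bot ⟨h1, hιC w⟩
        simpa using this
      rw [h2, add_zero] at hv'
      exact Prod.ext (hD (hv'.trans (map_zero D).symm)) (hι (h2.trans (map_zero ι).symm))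
    have hfr : Module.finrank ℝ (EG × S) = Module.finrank ℝ E := by
      rw [Module.finrank_prod, finrank_euclideanSpace_fin, hdim]
    exact ⟨hLi, (LinearMap.injective_iff_surjective_of_finrank_eq_finrank hfr).1 hLi⟩
  obtain ⟨Ψ, h1Ψ, hΨΩ, hΨf, hΨ1, hΨ2⟩ :=
    exists_openPartialHomeomorph_of_bijective_mfderiv IG hΩ h1Ω hf hfb
  -- properness makes the slice meet nearby orbits only once
  obtain ⟨O₁, O₂, hO₁, hO₂, h1O₁, h0O₂, hO⟩ := isOpen_prod_iff.1 Ψ.open_source 1 0 h1Ψ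
  obtain ⟨O, hOo, hOeq⟩ := (isClosedEmbedding_smul_pair hfree).isInducing.isOpen_iff.1
    (hO₁.prod (isOpen_univ (X := Q)))
  have hqO : (q₀, q₀) ∈ O := by
    have : ((1 : G), q₀) ∈ (fun p : G × Q ↦ (p.1 • p.2, p.2)) ⁻¹' O := by
      rw [hOeq]; exact ⟨h1O₁, mem_univ _⟩
    simpa using this
  obtain ⟨A₁, A₂, hA₁, hA₂, hqA₁, hqA₂, hA⟩ := isOpen_prod_iff.1 hOo q₀ q₀ hqO
  let T : Set S := (Tl ∩ σ ⁻¹' (A₁ ∩ A₂)) ∩ O₂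
  have hT : IsOpen T := (hσ.continuousOn.isOpen_inter_preimage hTl (hA₁.inter hA₂)).inter hO₂
  have h0T : (0 : S) ∈ T := ⟨⟨h0Tl, by rw [mem_preimage, hσ0]; exact ⟨hqA₁, hqA₂⟩⟩, h0O₂⟩
  have hkey : ∀ e ∈ T, ∀ e' ∈ T, ∀ k : G, k • σ e = σ e' → k = 1 ∧ e = e' := by
    intro e he e' he' k hk
    have hkO : (k, σ e) ∈ (fun p : G × Q ↦ (p.1 • p.2, p.2)) ⁻¹' O :=
      hA ⟨by change k • σ e ∈ A₁; rw [hk]; exact he'.1.2.1, he.1.2.2⟩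
    rw [hOeq] at hkO
    have h1 : (k, e) ∈ Ψ.source := hO ⟨hkO.1, he.2⟩
    have h2 : ((1 : G), e') ∈ Ψ.source := hO ⟨h1O₁, he'.2⟩
    have h3 : Ψ (k, e) = Ψ (1, e') := by
      rw [hΨf h1, hΨf h2]
      change φ (k • σ e) = φ ((1 : G) • σ e')
      rw [hk, one_smul]
    exact Prod.mk.inj (Ψ.injOn h1 h2 h3)
  have hΨ10 : Ψ (1, 0) = φ q₀ := by
    rw [hΨf h1Ψ]
    exact congrArg φ hκ0
  -- slice coordinates: the local inverse of `κ`
  let Θ : Q → G × S := fun q ↦ Ψ.symm (φ q)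
  let U₁ : Set Q := φ.source ∩ φ ⁻¹' Ψ.target
  have hU₁ : IsOpen U₁ := hφ.continuousOn.isOpen_inter_preimage hφs Ψ.open_target
  have hΘ : ContMDiffOn 𝓘(ℝ, E) IG ∞ Θ U₁ := hΨ2.comp (hφ.mono inter_subset_left) fun q hq ↦ hq.2
  let U : Set Q := U₁ ∩ Θ ⁻¹' (Prod.snd ⁻¹' T)
  have hU : IsOpen U := hΘ.continuousOn.isOpen_inter_preimage hU₁ (hT.preimage continuous_snd)
  have hΘ0 : Θ q₀ = (1, 0) := by
    change Ψ.symm (φ q₀) = _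
    rw [← hΨ10, Ψ.left_inv h1Ψ]
  have hqU : q₀ ∈ U := by
    refine ⟨⟨hq₀, ?_⟩, ?_⟩
    · rw [mem_preimage, ← hΨ10]; exact Ψ.map_source h1Ψ
    · rw [mem_preimage, hΘ0]; exact h0T
  have hκΘ : ∀ q ∈ U, (Θ q).1 • σ (Θ q).2 = q := by
    intro q hq
    have h1 := Ψ.map_target hq.1.2
    refine φ.injOn (hΨΩ h1).2 hq.1.1 ?_
    have h2 := hΨf h1
    rw [Ψ.right_inv hq.1.2] at h2
    exact h2.symm
  have hgs : ContMDiffOn 𝓘(ℝ, E) IG ∞ Θ U := hΘ.mono inter_subset_left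
  refine ⟨U, fun q ↦ (Θ q).1, fun q ↦ (Θ q).2, hU, hqU, by simp only [hΘ0],
    contMDiff_fst.comp_contMDiffOn hgs, contMDiff_snd.comp_contMDiffOn hgs, ?_, ?_, ?_⟩
  · have hgd : HasMFDerivAt 𝓘(ℝ, E) 𝓘(ℝ, EG) (fun q ↦ (Θ q).1) q₀
        (mfderiv 𝓘(ℝ, E) 𝓘(ℝ, EG) (fun q ↦ (Θ q).1) q₀) :=
      (((contMDiff_fst.comp_contMDiffOn hgs).contMDiffAt (hU.mem_nhds hqU)).mdifferentiableAt
        (by simp)).hasMFDerivAt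
    have hsd : HasMFDerivAt 𝓘(ℝ, E) (𝓡 m) (fun q ↦ (Θ q).2) q₀
        (mfderiv 𝓘(ℝ, E) (𝓡 m) (fun q ↦ (Θ q).2) q₀) :=
      (((contMDiff_snd.comp_contMDiffOn hgs).contMDiffAt (hU.mem_nhds hqU)).mdifferentiableAt
        (by simp)).hasMFDerivAt
    let L : E →ₗ[ℝ] EG × S :=
      ((tder 𝓘(ℝ, E) 𝓘(ℝ, EG) (fun q ↦ (Θ q).1) q₀).prod
        (tder 𝓘(ℝ, E) (𝓡 m) (fun q ↦ (Θ q).2) q₀) : E →ₗ[ℝ] EG × S)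
    have hLs : Surjective L := by
      intro w
      have hκd : HasMFDerivAt IG 𝓘(ℝ, E) κ (1, 0) (mfderiv IG 𝓘(ℝ, E) κ (1, 0)) :=
        ((hκ.contMDiffAt ((hTl.preimage continuous_snd).mem_nhds h0Tl)).mdifferentiableAt
          (by simp)).hasMFDerivAt
      have hΘκ : ∀ᶠ p in 𝓝 ((1 : G), (0 : S)), Θ (κ p) = p := by
        filter_upwards [Ψ.open_source.mem_nhds h1Ψ] with p hp
        change Ψ.symm (φ (κ p)) = p
        have h2 : Ψ p = φ (κ p) := hΨf hp
        rw [← h2, Ψ.left_inv hp]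
      refine ⟨(mfderiv IG 𝓘(ℝ, E) κ (1, 0) : EG × S →L[ℝ] E) w, Prod.ext ?_ ?_⟩
      · have h1 : HasMFDerivAt 𝓘(ℝ, E) 𝓘(ℝ, EG) (fun q ↦ (Θ q).1) (κ (1, 0))
            (mfderiv 𝓘(ℝ, E) 𝓘(ℝ, EG) (fun q ↦ (Θ q).1) q₀ : E →L[ℝ] EG) := by
          rw [hκ0]; exact hgd
        have h2 := h1.comp _ hκd
        have h3 : HasMFDerivAt IG 𝓘(ℝ, EG) ((fun q ↦ (Θ q).1) ∘ κ) (1, 0)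
            (ContinuousLinearMap.fst ℝ (TangentSpace 𝓘(ℝ, EG) (1 : G))
              (TangentSpace (𝓡 m) (0 : S))) := by
          refine (hasMFDerivAt_fst (I := 𝓘(ℝ, EG)) (I' := 𝓡 m) _).congr_of_eventuallyEq ?_
          filter_upwards [hΘκ] with p hp
          exact congrArg Prod.fst hp
        exact congrArg (fun L : EG × S →L[ℝ] EG ↦ L w) (hasMFDerivAt_unique h2 h3)
      · have h1 : HasMFDerivAt 𝓘(ℝ, E) (𝓡 m) (fun q ↦ (Θ q).2) (κ (1, 0))
            (mfderiv 𝓘(ℝ, E) (𝓡 m) (fun q ↦ (Θ q).2) q₀ : E →L[ℝ] S) := by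
          rw [hκ0]; exact hsd
        have h2 := h1.comp _ hκd
        have h3 : HasMFDerivAt IG (𝓡 m) ((fun q ↦ (Θ q).2) ∘ κ) (1, 0)
            (ContinuousLinearMap.snd ℝ (TangentSpace 𝓘(ℝ, EG) (1 : G))
              (TangentSpace (𝓡 m) (0 : S))) := by
          refine (hasMFDerivAt_snd (I := 𝓘(ℝ, EG)) (I' := 𝓡 m) _).congr_of_eventuallyEq ?_
          filter_upwards [hΘκ] with p hp
          exact congrArg Prod.snd hp
        exact congrArg (fun L : EG × S →L[ℝ] S ↦ L w) (hasMFDerivAt_unique h2 h3)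
    have hfr : Module.finrank ℝ E = Module.finrank ℝ (EG × S) := by
      rw [Module.finrank_prod, finrank_euclideanSpace_fin, hdim]
    exact ⟨(LinearMap.injective_iff_surjective_of_finrank_eq_finrank hfr).2 hLs, hLs⟩
  · intro q hq h hhq
    have h1 := hκΘ q hq
    have h2 := hκΘ _ hhq
    have h3 : (((Θ (h • q)).1)⁻¹ * (h * (Θ q).1)) • σ (Θ q).2 = σ (Θ (h • q)).2 := by
      rw [mul_smul, mul_smul, h1, inv_smul_eq_iff, h2]
    obtain ⟨h4, h5⟩ := hkey _ hq.2 _ hhq.2 _ h3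
    exact ⟨inv_mul_eq_one.1 h4, h5.symm⟩
  · intro q hq q' hq' hs
    refine ⟨(Θ q').1 * ((Θ q).1)⁻¹, ?_⟩
    have h1 := hκΘ q hq
    have h2 := hκΘ q' hq'
    change (Θ q).2 = (Θ q').2 at hs
    rw [mul_smul]
    nth_rewrite 2 [← h1]
    rw [inv_smul_smul, hs, h2]

end Slices

/-! ### Calculus of derivatives between model spaces -/

section Tder

variable {E : Type*} [NormedAddCommGroup E] [NormedSpace ℝ E]
  {H : Type*} [TopologicalSpace H] {I : ModelWithCorners ℝ E H}
  {M : Type*} [TopologicalSpace M] [ChartedSpace H M]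
  {E' : Type*} [NormedAddCommGroup E'] [NormedSpace ℝ E']
  {H' : Type*} [TopologicalSpace H'] {I' : ModelWithCorners ℝ E' H'}
  {M' : Type*} [TopologicalSpace M'] [ChartedSpace H' M']
  {E'' : Type*} [NormedAddCommGroup E''] [NormedSpace ℝ E'']
  {H'' : Type*} [TopologicalSpace H''] {I'' : ModelWithCorners ℝ E'' H''}
  {M'' : Type*} [TopologicalSpace M''] [ChartedSpace H'' M'']

theorem tder_eq_of_eq (f : M → M') {x y : M} (h : x = y) : tder I I' f x = tder I I' f y := by
  rw [h]

theorem tder_congr {f g : M → M'} {x : M} (h : f =ᶠ[𝓝 x] g) : tder I I' f x = tder I I' g x :=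
  h.mfderiv_eq

theorem tder_id (x : M) : tder I I (fun y : M ↦ y) x = ContinuousLinearMap.id ℝ E := mfderiv_id

theorem tder_const (c : M') (x : M) : tder I I' (fun _ : M ↦ c) x = 0 := mfderiv_const

theorem tder_comp_of_eq {g : M' → M''} {f : M → M'} {x : M} {y : M'} (hy : f x = y)
    (hg : MDifferentiableAt I' I'' g y) (hf : MDifferentiableAt I I' f x) :
    tder I I'' (fun z ↦ g (f z)) x = (tder I' I'' g y).comp (tder I I' f x) := by
  subst hy
  exact mfderiv_comp x hg hf

theorem tder_comp {g : M' → M''} {f : M → M'} {x : M}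
    (hg : MDifferentiableAt I' I'' g (f x)) (hf : MDifferentiableAt I I' f x) :
    tder I I'' (fun z ↦ g (f z)) x = (tder I' I'' g (f x)).comp (tder I I' f x) :=
  mfderiv_comp x hg hf

theorem tder_comp_apply_of_eq {g : M' → M''} {f : M → M'} {x : M} {y : M'} (hy : f x = y)
    (hg : MDifferentiableAt I' I'' g y) (hf : MDifferentiableAt I I' f x) (v : E) :
    tder I I'' (fun z ↦ g (f z)) x v = tder I' I'' g y (tder I I' f x v) := by
  rw [tder_comp_of_eq hy hg hf]; rfl

theorem tder_prodMk {f : M → M'} {g : M → M''} {x : M} (hf : MDifferentiableAt I I' f x)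
    (hg : MDifferentiableAt I I'' g x) :
    tder I (I'.prod I'') (fun z ↦ (f z, g z)) x = (tder I I' f x).prod (tder I I'' g x) :=
  mfderiv_prodMk hf hg

theorem tder_clm (L : E →L[ℝ] E') (x : E) : tder 𝓘(ℝ, E) 𝓘(ℝ, E') L x = L := by
  rw [tder, mfderiv_eq_fderiv]; exact L.fderiv

end Tder

/-! ### Quotients by closed subgroups of a Lie group acting freely and properly -/

section OrbitQuotients

variable {EG : Type*} [NormedAddCommGroup EG] [NormedSpace ℝ EG] [FiniteDimensional ℝ EG]
  {G : Type*} [TopologicalSpace G] [ChartedSpace EG G] [Group G] [LieGroup 𝓘(ℝ, EG) ∞ G]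
  {E : Type*} [NormedAddCommGroup E] [NormedSpace ℝ E] [FiniteDimensional ℝ E]
  {Q : Type*} [TopologicalSpace Q] [ChartedSpace E Q] [IsManifold 𝓘(ℝ, E) ∞ Q]
  [T2Space Q] [MulAction G Q] [ContMDiffSMul 𝓘(ℝ, EG) 𝓘(ℝ, E) ∞ G Q] [ProperSMul G Q]
  {W : Type*} [NormedAddCommGroup W] [NormedSpace ℝ W] [FiniteDimensional ℝ W]

/-- A map `F` from a Lie group into a vector space which intertwines right translations with linear
automorphisms has constant rank. -/
theorem finrank_range_tder_eq {F : G → W} (hF : ContMDiff 𝓘(ℝ, EG) 𝓘(ℝ, W) ∞ F)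
    (hFC : ∀ h : G, ∃ C : W ≃L[ℝ] W, ∀ g, F (g * h) = C (F g)) (h : G) :
    Module.finrank ℝ (LinearMap.range (tder 𝓘(ℝ, EG) 𝓘(ℝ, W) F h : EG →ₗ[ℝ] W)) =
      Module.finrank ℝ (LinearMap.range (tder 𝓘(ℝ, EG) 𝓘(ℝ, W) F 1 : EG →ₗ[ℝ] W)) := by
  obtain ⟨C, hC⟩ := hFC h
  have hR : ∀ x : G, ContMDiff 𝓘(ℝ, EG) 𝓘(ℝ, EG) ∞ (fun g : G ↦ g * x) := fun x ↦
    contMDiff_id.mul contMDiff_const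
  have hRd : ∀ x y : G, MDifferentiableAt 𝓘(ℝ, EG) 𝓘(ℝ, EG) (fun g : G ↦ g * x) y := fun x y ↦
    (hR x).mdifferentiable (by simp) y
  have hFd : ∀ y : G, MDifferentiableAt 𝓘(ℝ, EG) 𝓘(ℝ, W) F y := fun y ↦
    hF.mdifferentiable (by simp) y
  have h1 := tder_comp_of_eq (x := (1 : G)) (one_mul h) (hFd h) (hRd h 1)
  have h2 : tder 𝓘(ℝ, EG) 𝓘(ℝ, W) (fun g ↦ F (g * h)) 1 =
      (C : W →L[ℝ] W).comp (tder 𝓘(ℝ, EG) 𝓘(ℝ, W) F 1) := by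
    have h3 := tder_comp (x := (1 : G)) (g := (C : W →L[ℝ] W))
      ((C : W →L[ℝ] W).contMDiff.mdifferentiableAt (n := ∞) (by simp)) (hFd 1)
    rw [tder_clm] at h3
    rw [← h3]
    exact tder_congr (Eventually.of_forall hC)
  have hRs : Surjective (tder 𝓘(ℝ, EG) 𝓘(ℝ, EG) (fun g : G ↦ g * h) 1) := by
    intro v
    refine ⟨tder 𝓘(ℝ, EG) 𝓘(ℝ, EG) (fun g : G ↦ g * h⁻¹) h v, ?_⟩
    have h3 := tder_comp_apply_of_eq (x := h) (mul_inv_cancel h) (hRd h 1) (hRd h⁻¹ h) v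
    rw [← h3]
    have h4 : tder 𝓘(ℝ, EG) 𝓘(ℝ, EG) (fun z : G ↦ z * h⁻¹ * h) h =
        tder 𝓘(ℝ, EG) 𝓘(ℝ, EG) (fun z : G ↦ z) h :=
      tder_congr (Eventually.of_forall fun z ↦ by simp)
    rw [h4, tder_id]; rfl
  -- differentiating `F (g * h) = C (F g)` at `g = 1`
  have e := h1.symm.trans h2
  have e1 : LinearMap.range (tder 𝓘(ℝ, EG) 𝓘(ℝ, W) F h : EG →ₗ[ℝ] W) =
      (LinearMap.range (tder 𝓘(ℝ, EG) 𝓘(ℝ, W) F 1 : EG →ₗ[ℝ] W)).map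
        (C.toLinearEquiv : W →ₗ[ℝ] W) := by
    ext w
    constructor
    · rintro ⟨v, rfl⟩
      obtain ⟨u, rfl⟩ := hRs v
      exact ⟨_, ⟨u, rfl⟩, (congrArg (fun L : EG →L[ℝ] W ↦ L u) e).symm⟩
    · rintro ⟨_, ⟨u, rfl⟩, rfl⟩
      exact ⟨_, congrArg (fun L : EG →L[ℝ] W ↦ L u) e⟩
  rw [e1]
  exact LinearEquiv.finrank_map_eq C.toLinearEquiv _

/-- The elements `h` with `F h = F 1` are those that preserve the fibres of `F` by left translation;
in particular they form a subgroup. -/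
theorem apply_mul_eq_iff {F : G → W} (hFC : ∀ h : G, ∃ C : W ≃L[ℝ] W, ∀ g, F (g * h) = C (F g))
    (g h : G) : F (h * g) = F g ↔ F h = F 1 := by
  obtain ⟨C, hC⟩ := hFC g
  have h1 := hC 1
  rw [one_mul] at h1
  rw [hC h, h1]
  exact C.injective.eq_iff

/-- The quotient of a manifold by the subgroup `{h | F h = F 1}` of a Lie group acting freely and
properly, where `F` intertwines right translations with linear automorphisms. -/
theorem exists_isQuotientManifold_orbits [SecondCountableTopology Q]
    (hfree : ∀ (g : G) (q : Q), g • q = q → g = 1)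
    (hinj : ∀ q : Q, Injective (mfderiv 𝓘(ℝ, EG) 𝓘(ℝ, E) (fun g : G ↦ g • q) 1))
    {F : G → W} (hF : ContMDiff 𝓘(ℝ, EG) 𝓘(ℝ, W) ∞ F)
    (hFC : ∀ h : G, ∃ C : W ≃L[ℝ] W, ∀ g, F (g * h) = C (F g)) (s : Setoid Q)
    (hs : ∀ q q', s q q' ↔ ∃ h : G, F h = F 1 ∧ h • q = q') :
    ∃ (n : ℕ) (_ : ChartedSpace (EuclideanSpace ℝ (Fin n)) (Quotient s)),
      IsQuotientManifold 𝓘(ℝ, E) s n := by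
  have : ContinuousSMul G Q := inferInstance
  let m := Module.finrank ℝ E - Module.finrank ℝ EG
  have hm : Q → Module.finrank ℝ E = Module.finrank ℝ EG + m := by
    intro q
    have h1 : Module.finrank ℝ EG ≤ Module.finrank ℝ E :=
      LinearMap.finrank_le_finrank_of_injective
        (f := (tder 𝓘(ℝ, EG) 𝓘(ℝ, E) (fun g : G ↦ g • q) 1 : EG →ₗ[ℝ] E)) (hinj q)
    omega
  let r := Module.finrank ℝ (LinearMap.range (tder 𝓘(ℝ, EG) 𝓘(ℝ, W) F 1 : EG →ₗ[ℝ] W))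
  have hr : r ≤ Module.finrank ℝ EG := LinearMap.finrank_range_le _
  have hopen : IsOpenMap (Quotient.mk s) := by
    intro U hU
    rw [← isQuotientMap_quotient_mk'.isOpen_preimage]
    have : Quotient.mk s ⁻¹' (Quotient.mk s '' U) =
        ⋃ h : {h : G // F h = F 1}, (fun q : Q ↦ h.1 • q) ⁻¹' U := by
      ext q
      simp only [mem_preimage, mem_image, mem_iUnion]
      constructor
      · rintro ⟨y, hy, hyq⟩
        obtain ⟨h, hh, rfl⟩ := (hs _ _).1 (Quotient.exact hyq.symm)
        exact ⟨⟨h, hh⟩, hy⟩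
      · rintro ⟨⟨h, hh⟩, hy⟩
        exact ⟨h • q, hy, (Quotient.sound ((hs _ _).2 ⟨h, hh, rfl⟩)).symm⟩
    change IsOpen (Quotient.mk s ⁻¹' (Quotient.mk s '' U))
    rw [this]
    exact isOpen_iUnion fun h ↦ hU.preimage (continuous_const_smul h.1)
  have hT2 : T2Space (Quotient s) := by
    refine (t2Space_iff_of_isOpenQuotientMap
      ⟨Quotient.mk_surjective, continuous_quotient_mk', hopen⟩).2 ?_
    have h1 : {q : Q × Q | Quotient.mk s q.1 = Quotient.mk s q.2} =
        (fun p : G × Q ↦ (p.1 • p.2, p.2)) '' {p | F p.1 = F 1} := by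
      ext ⟨q, q'⟩
      constructor
      · intro h
        obtain ⟨g, hg, h⟩ := (hs _ _).1 (Quotient.exact (Eq.symm h))
        exact ⟨(g, q'), hg, Prod.ext h rfl⟩
      · rintro ⟨⟨g, y⟩, hg, h⟩
        obtain ⟨rfl, rfl⟩ := Prod.mk.inj h
        exact (Quotient.sound ((hs _ _).2 ⟨g, hg, rfl⟩)).symm
    rw [h1]
    exact (isClosedEmbedding_smul_pair hfree).isClosedMap _
      (isClosed_eq (hF.continuous.comp continuous_fst) continuous_const)
  let L : (EuclideanSpace ℝ (Fin r) × EuclideanSpace ℝ (Fin m)) ≃L[ℝ]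
      EuclideanSpace ℝ (Fin (r + m)) := ContinuousLinearEquiv.ofFinrankEq (by simp)
  refine ⟨r + m, exists_isQuotientManifold 𝓘(ℝ, E) s hT2 hopen (m := Module.finrank ℝ EG - r)
    (fun q ↦ by have := hm q; omega) ?_ ?_⟩
  · intro q₀
    obtain ⟨U, gf, sf, hU, hqU, hg1, hgf, hsf, hbij, hact, horb⟩ :=
      exists_slice EG hfree (hm q₀) q₀ (hinj q₀)
    obtain ⟨P, N, hN, h1N, hPs, hPN, -⟩ := exists_submersion_of_constant_rank 𝓘(ℝ, EG) hF 1 rfl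
      (fun y ↦ (finrank_range_tder_eq hF hFC y).le)
    -- in the slice coordinates `(gf, sf)` the classes are the fibres of `(P ∘ F, id)`
    let f₀ : Q → EuclideanSpace ℝ (Fin r) × EuclideanSpace ℝ (Fin m) :=
      fun q ↦ (P (F (gf q)), sf q)
    have hPF : ContMDiff 𝓘(ℝ, EG) (𝓡 r) ∞ (fun g ↦ P (F g)) := P.contMDiff.comp hF
    have hgfd : MDifferentiableAt 𝓘(ℝ, E) 𝓘(ℝ, EG) gf q₀ :=
      (hgf.contMDiffAt (hU.mem_nhds hqU)).mdifferentiableAt (by simp)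
    have hsfd : MDifferentiableAt 𝓘(ℝ, E) (𝓡 m) sf q₀ :=
      (hsf.contMDiffAt (hU.mem_nhds hqU)).mdifferentiableAt (by simp)
    have hPFd : MDifferentiableAt 𝓘(ℝ, EG) (𝓡 r) (fun g ↦ P (F g)) 1 :=
      hPF.mdifferentiable (by simp) 1
    have hPFgd : MDifferentiableAt 𝓘(ℝ, E) (𝓡 r) (fun q ↦ P (F (gf q))) q₀ :=
      ((hPF.comp_contMDiffOn hgf).contMDiffAt (hU.mem_nhds hqU)).mdifferentiableAt (by simp)
    refine ⟨U ∩ gf ⁻¹' N, fun q ↦ L (f₀ q), hgf.continuousOn.isOpen_inter_preimage hU hN,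
      ⟨hqU, by rw [mem_preimage, hg1]; exact h1N⟩, ?_, ?_, ?_⟩
    · refine L.contDiff.contMDiff.comp_contMDiffOn (ContMDiffOn.mono ?_ inter_subset_left)
      exact (hPF.comp_contMDiffOn hgf).prodMk_space hsf
    · have h1 : tder 𝓘(ℝ, E) 𝓘(ℝ, EuclideanSpace ℝ (Fin r) × EuclideanSpace ℝ (Fin m)) f₀ q₀ =
          (tder 𝓘(ℝ, E) (𝓡 r) (fun q ↦ P (F (gf q))) q₀).prod (tder 𝓘(ℝ, E) (𝓡 m) sf q₀) := by
        rw [modelWithCornersSelf_prod, ← chartedSpaceSelf_prod]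
        exact tder_prodMk hPFgd hsfd
      have hf₀d : MDifferentiableAt 𝓘(ℝ, E)
          𝓘(ℝ, EuclideanSpace ℝ (Fin r) × EuclideanSpace ℝ (Fin m)) f₀ q₀ :=
        hPFgd.prodMk_space hsfd
      have h2 : tder 𝓘(ℝ, EG) (𝓡 r) (fun g ↦ P (F g)) 1 =
          P.comp (tder 𝓘(ℝ, EG) 𝓘(ℝ, W) F 1) := by
        rw [tder_comp (P.contMDiff.mdifferentiableAt (n := ∞) (by simp))
          (hF.mdifferentiable (by simp) 1), tder_clm]
      intro w
      obtain ⟨w, rfl⟩ := L.surjective w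
      obtain ⟨ξ, hξ⟩ := hPs w.1
      obtain ⟨v, hv⟩ := hbij.2 (ξ, w.2)
      obtain ⟨hv1, hv2⟩ := Prod.mk.inj hv
      refine ⟨v, ?_⟩
      have h3 := tder_comp_apply_of_eq (g := (L : _ →L[ℝ] EuclideanSpace ℝ (Fin (r + m)))) rfl
        (L.contDiff.contMDiff.mdifferentiableAt (n := ∞) (by simp)) hf₀d v
      rw [tder_clm] at h3
      refine h3.trans (congrArg L ?_)
      rw [h1]
      refine Prod.ext ?_ hv2
      refine (tder_comp_apply_of_eq hg1 hPFd hgfd v).trans ?_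
      rw [h2, hv1]
      exact hξ
    · intro y hy z hz
      rw [hs]
      constructor
      · rintro ⟨h, hh, rfl⟩
        obtain ⟨h1, h2⟩ := hact y hy.1 h hz.1
        refine congrArg L (Prod.ext ?_ h2.symm)
        change P (F (gf y)) = P (F (gf (h • y)))
        rw [h1, (apply_mul_eq_iff hFC (gf y) h).2 hh]
      · intro h
        obtain ⟨h1, h2⟩ := Prod.mk.inj (L.injective h)
        obtain ⟨g, rfl⟩ := horb y hy.1 z hz.1 h2
        refine ⟨g, ?_, rfl⟩
        have h3 := hPN _ hz.2 _ hy.2 h1.symm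
        rw [(hact y hy.1 g hz.1).1] at h3
        exact (apply_mul_eq_iff hFC (gf y) g).1 h3
  · intro x y hxy
    obtain ⟨h, hh, rfl⟩ := (hs _ _).1 hxy
    exact ⟨univ, fun q ↦ h • q, isOpen_univ, mem_univ _, (contMDiff_act EG h).contMDiffOn, rfl,
      fun z _ ↦ (hs _ _).2 ⟨h, hh, rfl⟩⟩

section Vertical

variable {E' : Type*} [NormedAddCommGroup E'] [NormedSpace ℝ E']
  {H' : Type*} [TopologicalSpace H'] {I' : ModelWithCorners ℝ E' H'}
  {C : Type*} [TopologicalSpace C] [ChartedSpace H' C]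

/-- Vectors tangent to the orbits are generated by the Lie algebra of the subgroup
`{h | F h = F 1}`. -/
theorem exists_infGen_eq_of_tder_eq_zero
    (hfree : ∀ (g : G) (q : Q), g • q = q → g = 1)
    (hinj : ∀ q : Q, Injective (mfderiv 𝓘(ℝ, EG) 𝓘(ℝ, E) (fun g : G ↦ g • q) 1))
    {F : G → W} (hF : ContMDiff 𝓘(ℝ, EG) 𝓘(ℝ, W) ∞ F)
    (hFC : ∀ h : G, ∃ C : W ≃L[ℝ] W, ∀ g, F (g * h) = C (F g))
    {ϖ : Q → C} (hϖ : ContMDiff 𝓘(ℝ, E) I' ∞ ϖ) (hsec : HasLocalSections 𝓘(ℝ, E) I' ϖ)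
    (hker : ∀ q q', ϖ q = ϖ q' → ∃ h : G, F h = F 1 ∧ h • q = q')
    {q : Q} {v : E} (hv : tder 𝓘(ℝ, E) I' ϖ q v = 0) :
    ∃ ξ : EG, tder 𝓘(ℝ, EG) 𝓘(ℝ, W) F 1 ξ = 0 ∧
      tder 𝓘(ℝ, EG) 𝓘(ℝ, E) (fun g : G ↦ g • q) 1 ξ = v := by
  have : ContinuousSMul G Q := inferInstance
  have h1 : Module.finrank ℝ EG ≤ Module.finrank ℝ E :=
    LinearMap.finrank_le_finrank_of_injective
      (f := (tder 𝓘(ℝ, EG) 𝓘(ℝ, E) (fun g : G ↦ g • q) 1 : EG →ₗ[ℝ] E)) (hinj q)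
  obtain ⟨m, hm⟩ := Nat.exists_eq_add_of_le h1
  obtain ⟨U, gf, sf, hU, hqU, hg1, hgf, hsf, hbij, hact, horb⟩ :=
    exists_slice EG hfree hm q (hinj q)
  obtain ⟨V, σ, hV, hqV, hσ, hσq, hϖσ⟩ := hsec q
  have hgfd : MDifferentiableAt 𝓘(ℝ, E) 𝓘(ℝ, EG) gf q :=
    (hgf.contMDiffAt (hU.mem_nhds hqU)).mdifferentiableAt (by simp)
  have hsfd : MDifferentiableAt 𝓘(ℝ, E) (𝓡 m) sf q :=
    (hsf.contMDiffAt (hU.mem_nhds hqU)).mdifferentiableAt (by simp)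
  have hϖd : MDifferentiableAt 𝓘(ℝ, E) I' ϖ q := hϖ.mdifferentiable (by simp) q
  have hσd : MDifferentiableAt I' 𝓘(ℝ, E) σ (ϖ q) :=
    (hσ.contMDiffAt (hV.mem_nhds hqV)).mdifferentiableAt (by simp)
  have hFd : MDifferentiableAt 𝓘(ℝ, EG) 𝓘(ℝ, W) F 1 := hF.mdifferentiable (by simp) 1
  have hFgd : MDifferentiableAt 𝓘(ℝ, E) 𝓘(ℝ, W) (fun y ↦ F (gf y)) q :=
    ((hF.comp_contMDiffOn hgf).contMDiffAt (hU.mem_nhds hqU)).mdifferentiableAt (by simp)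
  have hrd : MDifferentiableAt 𝓘(ℝ, E) 𝓘(ℝ, E) (fun y ↦ σ (ϖ y)) q := hσd.comp q hϖd
  have hr0 : tder 𝓘(ℝ, E) 𝓘(ℝ, E) (fun y ↦ σ (ϖ y)) q v = 0 := by
    rw [tder_comp_apply_of_eq rfl hσd hϖd, hv, map_zero]
  -- both `y` and `σ (ϖ y)` lie in the same class, so `F ∘ gf` and `sf` factor through `ϖ` near `q`
  have hev : ∀ᶠ y in 𝓝 q, F (gf y) = F (gf (σ (ϖ y))) ∧ sf y = sf (σ (ϖ y)) := by
    have hc : ContinuousAt (fun y ↦ σ (ϖ y)) q := hrd.continuousAt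
    have h2 : ∀ᶠ y in 𝓝 q, σ (ϖ y) ∈ U := hc.eventually_mem (by rw [hσq]; exact hU.mem_nhds hqU)
    filter_upwards [hU.mem_nhds hqU, h2, hϖ.continuous.continuousAt.eventually_mem
      (hV.mem_nhds hqV)] with y hy hy2 hyV
    obtain ⟨h, hh, he⟩ := hker _ _ (hϖσ _ hyV)
    have h3 := hact _ hy2 h (by rw [he]; exact hy)
    rw [he] at h3
    exact ⟨by rw [h3.1, (apply_mul_eq_iff hFC _ h).2 hh], h3.2⟩
  have hF0 : tder 𝓘(ℝ, E) 𝓘(ℝ, W) (fun y ↦ F (gf y)) q v = 0 := by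
    rw [tder_congr (hev.mono fun y hy ↦ hy.1),
      tder_comp_apply_of_eq (g := fun y ↦ F (gf y)) (f := fun y ↦ σ (ϖ y)) hσq hFgd hrd, hr0, map_zero]
  have hs0 : tder 𝓘(ℝ, E) (𝓡 m) sf q v = 0 := by
    rw [tder_congr (hev.mono fun y hy ↦ hy.2),
      tder_comp_apply_of_eq (g := sf) (f := fun y ↦ σ (ϖ y)) hσq hsfd hrd, hr0, map_zero]
  -- the required generator is the component of `v` in the direction of the group
  let ξ : EG := tder 𝓘(ℝ, E) 𝓘(ℝ, EG) gf q v
  refine ⟨ξ, ?_, hbij.1 (Prod.ext ?_ ?_)⟩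
  · rw [← hF0, tder_comp_apply_of_eq hg1 hFd hgfd]
  all_goals
    have hod : MDifferentiableAt 𝓘(ℝ, EG) 𝓘(ℝ, E) (fun g : G ↦ g • q) 1 :=
      (contMDiff_orbit EG G E q).mdifferentiable (by simp) 1
    have h2 : ∀ᶠ g in 𝓝 (1 : G), g • q ∈ U :=
      hod.continuousAt.eventually_mem (by rw [one_smul]; exact hU.mem_nhds hqU)
  · change tder 𝓘(ℝ, E) 𝓘(ℝ, EG) gf q (tder 𝓘(ℝ, EG) 𝓘(ℝ, E) (fun g : G ↦ g • q) 1 ξ) = ξ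
    rw [← tder_comp_apply_of_eq (g := gf) (f := fun g : G ↦ g • q) (one_smul G q) hgfd hod ξ]
    have h3 : tder 𝓘(ℝ, EG) 𝓘(ℝ, EG) (fun g : G ↦ gf (g • q)) 1 =
        tder 𝓘(ℝ, EG) 𝓘(ℝ, EG) (fun g : G ↦ g) 1 := by
      refine tder_congr (h2.mono fun g hg ↦ ?_)
      change gf (g • q) = g
      rw [(hact q hqU g hg).1, hg1, mul_one]
    rw [h3, tder_id]; rfl
  · change tder 𝓘(ℝ, E) (𝓡 m) sf q (tder 𝓘(ℝ, EG) 𝓘(ℝ, E) (fun g : G ↦ g • q) 1 ξ) =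
      tder 𝓘(ℝ, E) (𝓡 m) sf q v
    rw [hs0, ← tder_comp_apply_of_eq (g := sf) (f := fun g : G ↦ g • q) (one_smul G q) hsfd hod ξ]
    have h3 : tder 𝓘(ℝ, EG) (𝓡 m) (fun g : G ↦ sf (g • q)) 1 =
        tder 𝓘(ℝ, EG) (𝓡 m) (fun _ : G ↦ sf q) 1 :=
      tder_congr (h2.mono fun g hg ↦ (hact q hqU g hg).2)
    rw [h3, tder_const]; rfl

/-- A vector in the kernel of the derivative of `F` at `1` is tangent to a curve in the subgroup
`{h | F h = F 1}`. -/
theorem exists_curve_of_tder_eq_zero {F : G → W} (hF : ContMDiff 𝓘(ℝ, EG) 𝓘(ℝ, W) ∞ F)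
    (hFC : ∀ h : G, ∃ C : W ≃L[ℝ] W, ∀ g, F (g * h) = C (F g)) {ξ : EG}
    (hξ : tder 𝓘(ℝ, EG) 𝓘(ℝ, W) F 1 ξ = 0) :
    ∃ (T : Set ℝ) (c : ℝ → G), IsOpen T ∧ 0 ∈ T ∧ ContMDiffOn 𝓘(ℝ) 𝓘(ℝ, EG) ∞ c T ∧ c 0 = 1 ∧
      tder 𝓘(ℝ) 𝓘(ℝ, EG) c 0 1 = ξ ∧ ∀ t ∈ T, F (c t) = F 1 := by
  obtain ⟨P, N, -, -, -, -, h⟩ := exists_submersion_of_constant_rank 𝓘(ℝ, EG) hF 1 rfl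
    (fun y ↦ (finrank_range_tder_eq hF hFC y).le)
  exact h ξ hξ

/-- The Lie algebra of the subgroup `{h | F h = F 1}` generates vectors that are vertical for every
map invariant under this subgroup. -/
theorem tder_infGen_eq_zero {F : G → W} (hF : ContMDiff 𝓘(ℝ, EG) 𝓘(ℝ, W) ∞ F)
    (hFC : ∀ h : G, ∃ C : W ≃L[ℝ] W, ∀ g, F (g * h) = C (F g))
    {ϖ : Q → C} (hϖ : ContMDiff 𝓘(ℝ, E) I' ∞ ϖ)
    (hker : ∀ (q : Q) (h : G), F h = F 1 → ϖ (h • q) = ϖ q) (q : Q) {ξ : EG}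
    (hξ : tder 𝓘(ℝ, EG) 𝓘(ℝ, W) F 1 ξ = 0) :
    tder 𝓘(ℝ, E) I' ϖ q (tder 𝓘(ℝ, EG) 𝓘(ℝ, E) (fun g : G ↦ g • q) 1 ξ) = 0 := by
  obtain ⟨T, c, hT, h0T, hc, hc0, rfl, hcF⟩ := exists_curve_of_tder_eq_zero hF hFC hξ
  have hcd : MDifferentiableAt 𝓘(ℝ) 𝓘(ℝ, EG) c 0 :=
    (hc.contMDiffAt (hT.mem_nhds h0T)).mdifferentiableAt (by simp)
  have hod : MDifferentiableAt 𝓘(ℝ, EG) 𝓘(ℝ, E) (fun g : G ↦ g • q) 1 :=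
    (contMDiff_orbit EG G E q).mdifferentiable (by simp) 1
  have hϖd : MDifferentiableAt 𝓘(ℝ, E) I' ϖ q := hϖ.mdifferentiable (by simp) q
  have hcod : MDifferentiableAt 𝓘(ℝ) 𝓘(ℝ, E) (fun t ↦ c t • q) 0 := by
    have h1 : ∀ g : G, g = 1 → MDifferentiableAt 𝓘(ℝ, EG) 𝓘(ℝ, E) (fun g : G ↦ g • q) g := by
      rintro _ rfl; exact hod
    exact (h1 _ hc0).comp (0 : ℝ) hcd
  have e : c 0 • q = q := by rw [hc0, one_smul]
  rw [← tder_comp_apply_of_eq (g := fun g : G ↦ g • q) hc0 hod hcd,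
    ← tder_comp_apply_of_eq (f := fun t : ℝ ↦ c t • q) e hϖd hcod]
  have h3 : tder 𝓘(ℝ) I' (fun t ↦ ϖ (c t • q)) 0 = tder 𝓘(ℝ) I' (fun _ : ℝ ↦ ϖ q) 0 :=
    tder_congr (by filter_upwards [hT.mem_nhds h0T] with t ht using hker q _ (hcF t ht))
  rw [h3, tder_const]; rfl

end Vertical

end OrbitQuotients

/-! ### The coadjoint orbit map -/

section Coadjoint

section PartialDerivative

variable {E : Type*} [NormedAddCommGroup E] [NormedSpace ℝ E]
  {H : Type*} [TopologicalSpace H] {I : ModelWithCorners ℝ E H}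
  {M : Type*} [TopologicalSpace M] [ChartedSpace H M] [IsManifold I ∞ M]
  {E' : Type*} [NormedAddCommGroup E'] [NormedSpace ℝ E']
  {H' : Type*} [TopologicalSpace H'] {I' : ModelWithCorners ℝ E' H'}
  {M' : Type*} [TopologicalSpace M'] [ChartedSpace H' M'] [IsManifold I' ∞ M']
  {E'' : Type*} [NormedAddCommGroup E''] [NormedSpace ℝ E'']
  {H'' : Type*} [TopologicalSpace H''] {I'' : ModelWithCorners ℝ E'' H''}
  {N : Type*} [TopologicalSpace N] [ChartedSpace H'' N] [IsManifold I'' ∞ N]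

/-- All the maps `f x` send `a` to `b`, so that their derivatives at `a` are linear maps between two
fixed tangent spaces; these depend smoothly on `x`. -/
theorem contMDiff_tder_of_fixed {f : N → M → M'} {a : M} {b : M'}
    (hf : ContMDiff (I''.prod I) I' ∞ (uncurry f)) (hab : ∀ x, f x a = b) :
    ContMDiff I'' 𝓘(ℝ, E →L[ℝ] E') ∞ (fun x ↦ tder I I' (f x) a) := by
  intro x₀
  have : IsManifold I 1 M := .of_le (n := ∞) (by simp)
  have : IsManifold I' 1 M' := .of_le (n := ∞) (by simp)
  have h := ContMDiffAt.mfderiv (m := ∞) (n := ∞) f (fun _ ↦ a) (hf (x₀, a)) contMDiffAt_const le_rfl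
  refine h.congr_of_eventuallyEq (Eventually.of_forall fun x ↦ ?_)
  symm
  refine (inTangentCoordinates_eq (I := I) (I' := I') (fun _ : N ↦ a) (fun x ↦ f x a)
    (fun x ↦ tder I I' (f x) a) (x₀ := x₀) (x := x) (mem_chart_source _ _)
    (by simp only [hab]; exact mem_chart_source _ _)).trans ?_
  simp only [hab]
  ext v
  change (tangentBundleCore I' M').coordChange (achart H' b) (achart H' b) b
    (tder I I' (f x) a ((tangentBundleCore I M).coordChange (achart H a) (achart H a) a v)) = _
  rw [(tangentBundleCore I M).coordChange_self _ _ (mem_chart_source _ _),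
    (tangentBundleCore I' M').coordChange_self _ _ (mem_chart_source _ _)]

end PartialDerivative

variable {EG : Type*} [NormedAddCommGroup EG] [NormedSpace ℝ EG]
  {G : Type*} [TopologicalSpace G] [ChartedSpace EG G] [Group G] [LieGroup 𝓘(ℝ, EG) ∞ G] {k : ℕ}

/-- The map `g ↦ (μ_1 ∘ Ad_g, …, μ_k ∘ Ad_g)`, whose fibre over its value at `1` is `G_μ`. -/
def coadMap (μ : Fin k → LieDual EG G) (g : G) : Fin k → (EG →L[ℝ] ℝ) :=
  fun a ↦ (μ a).comp (Ad EG g)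

theorem contMDiff_coadMap (μ : Fin k → LieDual EG G) :
    ContMDiff 𝓘(ℝ, EG) 𝓘(ℝ, Fin k → (EG →L[ℝ] ℝ)) ∞ (coadMap μ) := by
  have h1 : ContMDiff 𝓘(ℝ, EG) 𝓘(ℝ, EG →L[ℝ] EG) ∞
      (fun g : G ↦ tder 𝓘(ℝ, EG) 𝓘(ℝ, EG) (fun h : G ↦ g * h * g⁻¹) 1) := by
    refine contMDiff_tder_of_fixed (f := fun g h : G ↦ g * h * g⁻¹) (b := 1) ?_ (fun g ↦ by simp)
    exact (contMDiff_fst.mul contMDiff_snd).mul contMDiff_fst.inv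
  rw [contMDiff_pi_space]
  intro a
  exact (ContinuousLinearMap.compL ℝ EG EG ℝ (μ a)).contMDiff.comp h1

/-- Right translations act on `coadMap μ` by linear automorphisms. Therefore it has constant rank,
and its fibre over its value at `1` is a subgroup. -/
theorem coadMap_mul (μ : Fin k → LieDual EG G) (h : G) :
    ∃ C : (Fin k → (EG →L[ℝ] ℝ)) ≃L[ℝ] (Fin k → (EG →L[ℝ] ℝ)),
      ∀ g, coadMap μ (g * h) = C (coadMap μ g) := by
  have h1 : ∀ g : G, (Ad EG g⁻¹).comp (Ad EG g) = ContinuousLinearMap.id ℝ _ := fun g ↦ by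
    rw [← Ad_mul, inv_mul_cancel, Ad_one]
  have h2 : ∀ g : G, (Ad EG g).comp (Ad EG g⁻¹) = ContinuousLinearMap.id ℝ _ := fun g ↦ by
    rw [← Ad_mul, mul_inv_cancel, Ad_one]
  let A : EG ≃L[ℝ] EG := ContinuousLinearEquiv.equivOfInverse (M₁ := EG) (M₂ := EG)
    (Ad EG h⁻¹) (Ad EG h) (fun v ↦ congrArg (fun L : EG →L[ℝ] EG ↦ L v) (h2 h))
    (fun v ↦ congrArg (fun L : EG →L[ℝ] EG ↦ L v) (h1 h))
  refine ⟨ContinuousLinearEquiv.piCongrRight fun _ ↦ A.arrowCongr (.refl ℝ ℝ), fun g ↦ ?_⟩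
  funext a
  have h3 : coadMap μ (g * h) a = (coadMap μ g a).comp (Ad EG h : EG →L[ℝ] EG) := by
    unfold coadMap
    rw [Ad_mul]; rfl
  rw [h3]
  ext v
  rfl

theorem mem_isotropy_iff (μ : Fin k → LieDual EG G) (g : G) :
    g ∈ isotropy μ ↔ coadMap μ g = coadMap μ 1 := by
  rw [← inv_mem_iff]
  change (∀ a, Coad g⁻¹ (μ a) = μ a) ↔ _
  rw [funext_iff]
  refine forall_congr' fun a ↦ ?_
  change (μ a).comp (Ad EG g⁻¹⁻¹) = μ a ↔ (μ a).comp (Ad EG g) = (μ a).comp (Ad EG 1)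
  rw [inv_inv, Ad_one, ContinuousLinearMap.comp_id]

end Coadjoint

/-! ### Smooth families of alternating forms on a vector space -/

section AlternatingForms

variable {E : Type*} [NormedAddCommGroup E] [NormedSpace ℝ E] [FiniteDimensional ℝ E]
  {X : Type*} [NormedAddCommGroup X] [NormedSpace ℝ X] {n : ℕ}
  {E' : Type*} [NormedAddCommGroup E'] [NormedSpace ℝ E']

variable (E n) in
theorem finiteDimensional_alternating : FiniteDimensional ℝ (E [⋀^Fin n]→L[ℝ] ℝ) := by
  let b := Module.finBasis ℝ E
  let L : (E [⋀^Fin n]→L[ℝ] ℝ) →ₗ[ℝ] ((Fin n → Fin (Module.finrank ℝ E)) → ℝ) :=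
    { toFun := fun A i ↦ A (fun j ↦ b (i j))
      map_add' := fun A B ↦ rfl
      map_smul' := fun c A ↦ rfl }
  refine FiniteDimensional.of_injective L fun A B h ↦ ?_
  refine ContinuousAlternatingMap.toAlternatingMap_injective (b.ext_alternating fun i _ ↦ ?_)
  exact congrFun h i

theorem contDiffAt_alternating_iff {η : X → E [⋀^Fin n]→L[ℝ] ℝ} {x : X} :
    ContDiffAt ℝ ∞ η x ↔ ∀ v, ContDiffAt ℝ ∞ (fun y ↦ η y v) x := by
  have := finiteDimensional_alternating E n
  constructor
  · intro h v
    let L : (E [⋀^Fin n]→L[ℝ] ℝ) →ₗ[ℝ] ℝ :=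
      { toFun := fun A ↦ A v, map_add' := fun A B ↦ rfl, map_smul' := fun c A ↦ rfl }
    exact (LinearMap.toContinuousLinearMap L).contDiff.contDiffAt.comp x h
  · intro h
    let b := Module.finBasis ℝ E
    let L : (E [⋀^Fin n]→L[ℝ] ℝ) →ₗ[ℝ] ((Fin n → Fin (Module.finrank ℝ E)) → ℝ) :=
      { toFun := fun A i ↦ A (fun j ↦ b (i j))
        map_add' := fun A B ↦ rfl
        map_smul' := fun c A ↦ rfl }
    have hL : Injective L := fun A B h ↦ ContinuousAlternatingMap.toAlternatingMap_injective
      (b.ext_alternating fun i _ ↦ congrFun h i)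
    obtain ⟨g, hg⟩ := LinearMap.exists_leftInverse_of_injective L (LinearMap.ker_eq_bot.2 hL)
    have h1 : ContDiffAt ℝ ∞ (fun y ↦ L (η y)) x := contDiffAt_pi.2 fun i ↦ h _
    have h2 := (LinearMap.toContinuousLinearMap g).contDiff.contDiffAt.comp x h1
    refine h2.congr_of_eventuallyEq (Eventually.of_forall fun y ↦ ?_)
    exact (LinearMap.congr_fun hg (η y)).symm

theorem contDiffAt_alternating_apply {η : X → E [⋀^Fin n]→L[ℝ] ℝ} {v : X → Fin n → E} {x : X}
    (hη : ContDiffAt ℝ ∞ η x) (hv : ContDiffAt ℝ ∞ v x) :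
    ContDiffAt ℝ ∞ (fun y ↦ η y (v y)) x := by
  have := finiteDimensional_alternating E n
  let b := Module.finBasis ℝ (E [⋀^Fin n]→L[ℝ] ℝ)
  have h : (fun y ↦ η y (v y)) = fun y ↦ ∑ i, b.repr (η y) i * b i (v y) := by
    funext y
    have h1 := congrArg (fun A : E [⋀^Fin n]→L[ℝ] ℝ ↦ A (v y)) (b.sum_repr (η y))
    rw [← h1]
    simp only [ContinuousAlternatingMap.sum_apply, ContinuousAlternatingMap.smul_apply, smul_eq_mul]
  rw [h]
  refine ContDiffAt.sum fun i _ ↦ ContDiffAt.mul ?_ ?_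
  · exact (LinearMap.toContinuousLinearMap (b.coord i)).contDiff.contDiffAt.comp x hη
  · exact ((b i).toContinuousMultilinearMap.contDiff.contDiffAt).comp x hv

theorem contDiffAt_compContinuousLinearMap [FiniteDimensional ℝ E']
    {η : X → E [⋀^Fin n]→L[ℝ] ℝ} {L : X → E' →L[ℝ] E}
    {x : X} (hη : ContDiffAt ℝ ∞ η x) (hL : ContDiffAt ℝ ∞ L x) :
    ContDiffAt ℝ ∞ (fun y ↦ (η y).compContinuousLinearMap (L y)) x := by
  refine contDiffAt_alternating_iff.2 fun v ↦ ?_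
  exact contDiffAt_alternating_apply (v := fun y i ↦ L y (v i)) hη
    (contDiffAt_pi.2 fun i ↦ hL.clm_apply contDiffAt_const)

theorem contDiffAt_extDeriv {η : E → E [⋀^Fin n]→L[ℝ] ℝ} {x : E} (hη : ContDiffAt ℝ ∞ η x) :
    ContDiffAt ℝ ∞ (extDeriv η) x :=
  ContDiffAt.comp (g := ContinuousAlternatingMap.alternatizeUncurryFinCLM ℝ E ℝ) x
    (ContinuousLinearMap.contDiff (F := E [⋀^Fin (n + 1)]→L[ℝ] ℝ) _).contDiffAt
    (hη.fderiv_right (m := ∞) (by simp))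

theorem two_le_infty : (2 : ℕ∞ω) ≤ ∞ := by
  have h : ((2 : ℕ∞) : ℕ∞ω) ≤ ((⊤ : ℕ∞) : ℕ∞ω) := WithTop.coe_le_coe.2 le_top
  exact h

theorem vec_removeNth_zero {V : Type*} (v w : V) : Fin.removeNth 0 ![v, w] = ![w] := by
  ext i; fin_cases i; rfl

theorem vec_removeNth_one {V : Type*} (v w : V) : Fin.removeNth 1 ![v, w] = ![v] := by
  ext i; fin_cases i; rfl

theorem extDeriv_apply_two {η : E → E [⋀^Fin 1]→L[ℝ] ℝ} {x : E} (hη : DifferentiableAt ℝ η x)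
    (v w : E) :
    extDeriv η x ![v, w] = fderiv ℝ (fun y ↦ η y ![w]) x v - fderiv ℝ (fun y ↦ η y ![v]) x w := by
  rw [extDeriv_apply hη, Fin.sum_univ_two, vec_removeNth_zero, vec_removeNth_one]
  simp [sub_eq_add_neg]

end AlternatingForms

/-! ### Pullback and exterior derivative of forms on manifolds -/

section Forms

variable {E : Type*} [NormedAddCommGroup E] [NormedSpace ℝ E] [FiniteDimensional ℝ E]
  {H : Type*} [TopologicalSpace H] (I : ModelWithCorners ℝ E H) [I.Boundaryless]
  {M : Type*} [TopologicalSpace M] [ChartedSpace H M] [IsManifold I ∞ M]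
  {E' : Type*} [NormedAddCommGroup E'] [NormedSpace ℝ E'] [FiniteDimensional ℝ E']
  {H' : Type*} [TopologicalSpace H'] (I' : ModelWithCorners ℝ E' H') [I'.Boundaryless]
  {M' : Type*} [TopologicalSpace M'] [ChartedSpace H' M'] [IsManifold I' ∞ M']
  {E'' : Type*} [NormedAddCommGroup E''] [NormedSpace ℝ E''] [FiniteDimensional ℝ E'']
  {H'' : Type*} [TopologicalSpace H''] (I'' : ModelWithCorners ℝ E'' H'') [I''.Boundaryless]
  {M'' : Type*} [TopologicalSpace M''] [ChartedSpace H'' M''] [IsManifold I'' ∞ M''] {n : ℕ}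

/-- The value of a form at a point, regarded as an alternating form on the model space. -/
def formAt (Ω : DForm I M n) (x : M) : E [⋀^Fin n]→L[ℝ] ℝ := Ω x

theorem form_ext {Ω Ω' : DForm I M n} (h : ∀ x, formAt I Ω x = formAt I Ω' x) : Ω = Ω' :=
  funext h

theorem inChart_eq (Ω : DForm I M n) (x₀ : M) (y : E) :
    inChart I Ω x₀ y = (formAt I Ω ((extChartAt I x₀).symm y)).compContinuousLinearMap
      (tder 𝓘(ℝ, E) I (extChartAt I x₀).symm y) := rfl

theorem formAt_pullback (f : M → M') (Ω : DForm I' M' n) (x : M) :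
    formAt I (pullback I I' f Ω) x =
      (formAt I' Ω (f x)).compContinuousLinearMap (tder I I' f x) := rfl

theorem formAt_dExt (Ω : DForm I M n) (x : M) :
    formAt I (dExt I Ω) x = (extDeriv (inChart I Ω x) (extChartAt I x x)).compContinuousLinearMap
      (tder I 𝓘(ℝ, E) (extChartAt I x) x) := rfl

variable {I} in
/-- `Ω` is smooth near `x`. -/
def SmoothFormAt (Ω : DForm I M n) (x : M) : Prop :=
  ContDiffAt ℝ ∞ (inChart I Ω x) (extChartAt I x x)

theorem mdifferentiableAt_extChart {x₀ x : M} (hx : x ∈ (extChartAt I x₀).source) :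
    MDifferentiableAt I 𝓘(ℝ, E) (extChartAt I x₀) x := by
  have : IsManifold I 1 M := .of_le (n := ∞) (by simp)
  exact mdifferentiableAt_extChartAt (by simpa using hx)

theorem mdifferentiableAt_extChart_symm {x₀ : M} {y : E} (hy : y ∈ (extChartAt I x₀).target) :
    MDifferentiableAt 𝓘(ℝ, E) I (extChartAt I x₀).symm y :=
  ((contMDiffOn_extChartAt_symm (n := ∞) x₀).contMDiffAt
    ((isOpen_extChartAt_target x₀).mem_nhds hy)).mdifferentiableAt (by simp)

theorem tder_extChart_comp_symm {x₀ : M} {y : E} (hy : y ∈ (extChartAt I x₀).target) :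
    (tder I 𝓘(ℝ, E) (extChartAt I x₀) ((extChartAt I x₀).symm y)).comp
      (tder 𝓘(ℝ, E) I (extChartAt I x₀).symm y) = ContinuousLinearMap.id ℝ E := by
  rw [← tder_comp (mdifferentiableAt_extChart I ((extChartAt I x₀).map_target hy))
    (mdifferentiableAt_extChart_symm I hy), ← tder_id (I := 𝓘(ℝ, E)) y]
  refine tder_congr ?_
  filter_upwards [(isOpen_extChartAt_target x₀).mem_nhds hy] with z hz
  exact (extChartAt I x₀).right_inv hz

theorem tder_extChart_symm_comp {x₀ x : M} (hx : x ∈ (extChartAt I x₀).source) :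
    (tder 𝓘(ℝ, E) I (extChartAt I x₀).symm (extChartAt I x₀ x)).comp
      (tder I 𝓘(ℝ, E) (extChartAt I x₀) x) = ContinuousLinearMap.id ℝ E := by
  rw [← tder_comp (mdifferentiableAt_extChart_symm I ((extChartAt I x₀).map_source hx))
    (mdifferentiableAt_extChart I hx), ← tder_id (I := I) x]
  refine tder_congr ?_
  filter_upwards [(isOpen_extChartAt_source x₀).mem_nhds hx] with z hz
  exact (extChartAt I x₀).left_inv hz

theorem eventually_mdifferentiableAt {f : M → M'} {x : M} (hf : ContMDiffAt I I' ∞ f x) :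
    ∀ᶠ y in 𝓝 x, MDifferentiableAt I I' f y := by
  have : IsManifold I 1 M := .of_le (n := ∞) (by simp)
  have : IsManifold I' 1 M' := .of_le (n := ∞) (by simp)
  have h1 : ContMDiffAt I I' 1 f x := hf.of_le (by simp)
  exact ((contMDiffAt_iff_contMDiffAt_nhds (by simp)).1 h1).mono fun y hy ↦
    hy.mdifferentiableAt (by simp)

/-- The map `f` in the charts at `x₀` and `y₀` is smooth. -/
theorem contDiffAt_writtenInCharts {f : M → M'} {x x₀ : M} {y₀ : M'}
    (hf : ContMDiffAt I I' ∞ f x) (hx : x ∈ (extChartAt I x₀).source)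
    (hy : f x ∈ (extChartAt I' y₀).source) :
    ContDiffAt ℝ ∞ (fun z ↦ extChartAt I' y₀ (f ((extChartAt I x₀).symm z)))
      (extChartAt I x₀ x) := by
  have h1 : ContMDiffAt 𝓘(ℝ, E) I ∞ (extChartAt I x₀).symm (extChartAt I x₀ x) :=
    (contMDiffOn_extChartAt_symm (n := ∞) x₀).contMDiffAt
      ((isOpen_extChartAt_target x₀).mem_nhds ((extChartAt I x₀).map_source hx))
  have h2 : ContMDiffAt I' 𝓘(ℝ, E') ∞ (extChartAt I' y₀) (f x) :=
    contMDiffAt_extChartAt' (by simpa using hy)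
  have e : (extChartAt I x₀).symm (extChartAt I x₀ x) = x := (extChartAt I x₀).left_inv hx
  have h3 : ContMDiffAt 𝓘(ℝ, E) I' ∞ (fun z ↦ f ((extChartAt I x₀).symm z)) (extChartAt I x₀ x) :=
    ContMDiffAt.comp_of_eq hf h1 e
  exact contMDiffAt_iff_contDiffAt.1 (ContMDiffAt.comp_of_eq h2 h3 (congrArg f e))

theorem fderiv_writtenInCharts {f : M → M'} {x x₀ : M} {y₀ : M'}
    (hf : MDifferentiableAt I I' f x) (hx : x ∈ (extChartAt I x₀).source)
    (hy : f x ∈ (extChartAt I' y₀).source) :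
    fderiv ℝ (fun z ↦ extChartAt I' y₀ (f ((extChartAt I x₀).symm z))) (extChartAt I x₀ x) =
      (tder I' 𝓘(ℝ, E') (extChartAt I' y₀) (f x)).comp
        ((tder I I' f x).comp (tder 𝓘(ℝ, E) I (extChartAt I x₀).symm (extChartAt I x₀ x))) := by
  have hφ := mdifferentiableAt_extChart_symm I ((extChartAt I x₀).map_source hx)
  have h6 : MDifferentiableAt I 𝓘(ℝ, E') (fun y ↦ extChartAt I' y₀ (f y)) x :=
    (mdifferentiableAt_extChart I' hy).comp x hf
  rw [← ContinuousLinearMap.comp_assoc, ← tder_comp (mdifferentiableAt_extChart I' hy) hf,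
    ← tder_comp_of_eq (g := fun y ↦ extChartAt I' y₀ (f y)) (f := (extChartAt I x₀).symm)
      ((extChartAt I x₀).left_inv hx) h6 hφ]
  exact mfderiv_eq_fderiv.symm

/-- In charts, the pullback of forms is the pullback by the map written in charts. -/
theorem inChart_pullback_eventuallyEq {f : M → M'} {x x₀ : M} {y₀ : M'}
    (hf : ContMDiffAt I I' ∞ f x) (hx : x ∈ (extChartAt I x₀).source)
    (hy : f x ∈ (extChartAt I' y₀).source) (Ω : DForm I' M' n) :
    inChart I (pullback I I' f Ω) x₀ =ᶠ[𝓝 (extChartAt I x₀ x)] fun z ↦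
      (inChart I' Ω y₀ (extChartAt I' y₀ (f ((extChartAt I x₀).symm z)))).compContinuousLinearMap
        (fderiv ℝ (fun z ↦ extChartAt I' y₀ (f ((extChartAt I x₀).symm z))) z) := by
  have e : (extChartAt I x₀).symm (extChartAt I x₀ x) = x := (extChartAt I x₀).left_inv hx
  have hc : ContinuousAt (extChartAt I x₀).symm (extChartAt I x₀ x) :=
    (mdifferentiableAt_extChart_symm I ((extChartAt I x₀).map_source hx)).continuousAt
  have h1 : ∀ᶠ w in 𝓝 x, MDifferentiableAt I I' f w ∧ f w ∈ (extChartAt I' y₀).source :=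
    (eventually_mdifferentiableAt I I' hf).and
      (hf.continuousAt.eventually_mem ((isOpen_extChartAt_source y₀).mem_nhds hy))
  rw [← e] at h1
  filter_upwards [(isOpen_extChartAt_target x₀).mem_nhds ((extChartAt I x₀).map_source hx),
    hc.eventually h1] with z hz hfz
  obtain ⟨hfz, hfs⟩ := hfz
  let F : E → E' := fun z ↦ extChartAt I' y₀ (f ((extChartAt I x₀).symm z))
  have hs := mdifferentiableAt_extChart_symm I hz
  have hfsd : MDifferentiableAt 𝓘(ℝ, E) I' (fun z ↦ f ((extChartAt I x₀).symm z)) z :=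
    hfz.comp z hs
  have hFd : MDifferentiableAt 𝓘(ℝ, E) 𝓘(ℝ, E') F z :=
    (mdifferentiableAt_extChart I' hfs).comp z hfsd
  have hFt : F z ∈ (extChartAt I' y₀).target := (extChartAt I' y₀).map_source hfs
  have hFs : (extChartAt I' y₀).symm (F z) = f ((extChartAt I x₀).symm z) :=
    (extChartAt I' y₀).left_inv hfs
  -- both sides are the derivative of `f` composed with the inverse chart
  have h2 : (tder I I' f ((extChartAt I x₀).symm z)).comp (tder 𝓘(ℝ, E) I (extChartAt I x₀).symm z) =
      (tder 𝓘(ℝ, E') I' (extChartAt I' y₀).symm (F z)).comp (fderiv ℝ F z) := by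
    have h3 : fderiv ℝ F z = tder 𝓘(ℝ, E) 𝓘(ℝ, E') F z := mfderiv_eq_fderiv.symm
    rw [h3, ← tder_comp hfz hs, ← tder_comp (mdifferentiableAt_extChart_symm I' hFt) hFd]
    refine tder_congr ?_
    filter_upwards [hfsd.continuousAt.eventually_mem
      ((isOpen_extChartAt_source y₀).mem_nhds hfs)] with w hw
    exact ((extChartAt I' y₀).left_inv hw).symm
  change ((formAt I' Ω (f ((extChartAt I x₀).symm z))).compContinuousLinearMap
      (tder I I' f ((extChartAt I x₀).symm z))).compContinuousLinearMap
      (tder 𝓘(ℝ, E) I (extChartAt I x₀).symm z) =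
    ((formAt I' Ω ((extChartAt I' y₀).symm (F z))).compContinuousLinearMap
      (tder 𝓘(ℝ, E') I' (extChartAt I' y₀).symm (F z))).compContinuousLinearMap (fderiv ℝ F z)
  rw [hFs]
  ext v
  change formAt I' Ω _ _ = formAt I' Ω _ _
  congr 1
  funext i
  exact congrArg (fun L : E →L[ℝ] E' ↦ L (v i)) h2

theorem pullback_id (Ω : DForm I M n) : pullback I I (fun x : M ↦ x) Ω = Ω := by
  refine form_ext I fun x ↦ ?_
  rw [formAt_pullback, tder_id]
  ext v
  rfl

theorem inChart_eventuallyEq {x x₀ x₁ : M} (hx : x ∈ (extChartAt I x₀).source)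
    (hx₁ : x ∈ (extChartAt I x₁).source) (Ω : DForm I M n) :
    inChart I Ω x₀ =ᶠ[𝓝 (extChartAt I x₀ x)] fun z ↦
      (inChart I Ω x₁ (extChartAt I x₁ ((extChartAt I x₀).symm z))).compContinuousLinearMap
        (fderiv ℝ (fun z ↦ extChartAt I x₁ ((extChartAt I x₀).symm z)) z) := by
  have h := inChart_pullback_eventuallyEq I I (f := fun x : M ↦ x) contMDiffAt_id hx hx₁ Ω
  rwa [pullback_id] at h

theorem SmoothFormAt.contDiffAt_inChart {Ω : DForm I M n} {x x₀ : M} (h : SmoothFormAt Ω x)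
    (hx : x ∈ (extChartAt I x₀).source) : ContDiffAt ℝ ∞ (inChart I Ω x₀) (extChartAt I x₀ x) := by
  have e : (extChartAt I x₀).symm (extChartAt I x₀ x) = x := (extChartAt I x₀).left_inv hx
  have hF := contDiffAt_writtenInCharts I I (f := fun x : M ↦ x) contMDiffAt_id hx
    (mem_extChartAt_source x)
  refine ContDiffAt.congr_of_eventuallyEq ?_
    (inChart_eventuallyEq I hx (mem_extChartAt_source x) Ω)
  refine contDiffAt_compContinuousLinearMap (ContDiffAt.comp (g := inChart I Ω x) _ ?_ hF)
    (hF.fderiv_right (m := ∞) (by simp))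
  simp only [e]
  exact h

theorem isSmoothForm_iff {Ω : DForm I M n} : IsSmoothForm I Ω ↔ ∀ x, SmoothFormAt Ω x := by
  constructor
  · intro h x
    exact (h x).contDiffAt ((isOpen_extChartAt_target x).mem_nhds (mem_extChartAt_target x))
  · intro h x₀ y hy
    have h1 := (h ((extChartAt I x₀).symm y)).contDiffAt_inChart I
      ((extChartAt I x₀).map_target hy)
    rw [(extChartAt I x₀).right_inv hy] at h1
    exact h1.contDiffWithinAt

theorem SmoothFormAt.pullback {f : M → M'} {x : M} {Ω : DForm I' M' n}
    (h : SmoothFormAt Ω (f x)) (hf : ContMDiffAt I I' ∞ f x) :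
    SmoothFormAt (pullback I I' f Ω) x := by
  have hF := contDiffAt_writtenInCharts I I' hf (mem_extChartAt_source x)
    (mem_extChartAt_source (f x))
  refine ContDiffAt.congr_of_eventuallyEq ?_
    (inChart_pullback_eventuallyEq I I' hf (mem_extChartAt_source x)
      (mem_extChartAt_source (f x)) Ω)
  refine contDiffAt_compContinuousLinearMap (ContDiffAt.comp (g := inChart I' Ω (f x)) _ ?_ hF)
    (hF.fderiv_right (m := ∞) (by simp))
  rw [(extChartAt I x).left_inv (mem_extChartAt_source x)]
  exact h

theorem IsSmoothForm.pullback {f : M → M'} {Ω : DForm I' M' n} (h : IsSmoothForm I' Ω)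
    (hf : ContMDiff I I' ∞ f) : IsSmoothForm I (pullback I I' f Ω) :=
  (isSmoothForm_iff I).2 fun x ↦ ((isSmoothForm_iff I').1 h (f x)).pullback I I' (hf x)

theorem smoothFormAt_congr {Ω Ω' : DForm I M n} {x : M} (h : ∀ᶠ y in 𝓝 x, formAt I Ω y = formAt I Ω' y)
    (hΩ : SmoothFormAt Ω x) : SmoothFormAt Ω' x := by
  have h1 : Tendsto (extChartAt I x).symm (𝓝 (extChartAt I x x)) (𝓝 x) := by
    have h2 := continuousAt_extChartAt_symm (I := I) x
    rwa [ContinuousAt, (extChartAt I x).left_inv (mem_extChartAt_source x)] at h2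
  refine hΩ.congr_of_eventuallyEq ?_
  filter_upwards [h1.eventually h] with y hy
  rw [inChart_eq, inChart_eq, hy]

theorem SmoothFormAt.differentiableAt {Ω : DForm I M n} {x : M} (h : SmoothFormAt Ω x) :
    DifferentiableAt ℝ (inChart I Ω x) (extChartAt I x x) := ContDiffAt.differentiableAt h (by simp)

/-- The exterior derivative commutes with pullbacks. -/
theorem formAt_dExt_pullback {f : M → M'} {x : M} (hf : ContMDiffAt I I' ∞ f x)
    {Ω : DForm I' M' n} (h : SmoothFormAt Ω (f x)) :
    formAt I (dExt I (PolyRed.pullback I I' f Ω)) x =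
      (formAt I' (dExt I' Ω) (f x)).compContinuousLinearMap (tder I I' f x) := by
  let F : E → E' := fun z ↦ extChartAt I' (f x) (f ((extChartAt I x).symm z))
  have hF : ContDiffAt ℝ ∞ F (extChartAt I x x) :=
    contDiffAt_writtenInCharts I I' hf (mem_extChartAt_source x) (mem_extChartAt_source (f x))
  have e : (extChartAt I x).symm (extChartAt I x x) = x :=
    (extChartAt I x).left_inv (mem_extChartAt_source x)
  have eF : F (extChartAt I x x) = extChartAt I' (f x) (f x) := by
    simp only [F, e]
  rw [formAt_dExt, formAt_dExt, (inChart_pullback_eventuallyEq I I' hf (mem_extChartAt_source x)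
    (mem_extChartAt_source (f x)) Ω).extDeriv_eq]
  have h1 := extDeriv_pullback (r := ∞) (f := F) (x := extChartAt I x x)
    (by rw [eF]; exact h.differentiableAt : DifferentiableAt ℝ (inChart I' Ω (f x)) (F _)) hF
    (by rw [minSmoothness_of_isRCLikeNormedField]; exact two_le_infty)
  have h1' := h1.trans (congrArg (fun z ↦ (extDeriv (inChart I' Ω (f x)) z).compContinuousLinearMap
    (fderiv ℝ F (extChartAt I x x))) eF)
  refine (congrArg (fun A : E [⋀^Fin (n + 1)]→L[ℝ] ℝ ↦ A.compContinuousLinearMap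
    (tder I 𝓘(ℝ, E) (extChartAt I x) x)) h1').trans ?_
  have hfd : MDifferentiableAt I I' f x := hf.mdifferentiableAt (by simp)
  have h2 : (fderiv ℝ F (extChartAt I x x)).comp (tder I 𝓘(ℝ, E) (extChartAt I x) x) =
      (tder I' 𝓘(ℝ, E') (extChartAt I' (f x)) (f x)).comp (tder I I' f x) := by
    have h3 : fderiv ℝ F (extChartAt I x x) = tder 𝓘(ℝ, E) 𝓘(ℝ, E') F (extChartAt I x x) :=
      mfderiv_eq_fderiv.symm
    rw [h3, ← tder_comp (mdifferentiableAt_extChart I' (mem_extChartAt_source (f x))) hfd,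
      ← tder_comp (hF.contMDiffAt.mdifferentiableAt (by simp))
        (mdifferentiableAt_extChart I (mem_extChartAt_source x))]
    refine tder_congr ?_
    filter_upwards [(isOpen_extChartAt_source (I := I) x).mem_nhds (mem_extChartAt_source x)]
      with w hw
    simp only [F, (extChartAt I x).left_inv hw]
  ext v
  change extDeriv (inChart I' Ω (f x)) _ _ = extDeriv (inChart I' Ω (f x)) _ _
  congr 1
  funext i
  exact congrArg (fun L : E →L[ℝ] E' ↦ L (v i)) h2

theorem dExt_pullback {f : M → M'} (hf : ContMDiff I I' ∞ f)
    {Ω : DForm I' M' n} (h : ∀ x, SmoothFormAt Ω x) :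
    dExt I (PolyRed.pullback I I' f Ω) = PolyRed.pullback I I' f (dExt I' Ω) :=
  form_ext I fun x ↦ formAt_dExt_pullback I I' (hf x) (h (f x))

/-- The exterior derivative may be computed in any chart. -/
theorem inChart_dExt {Ω : DForm I M n} (h : IsSmoothForm I Ω) {x₀ : M} {y : E}
    (hy : y ∈ (extChartAt I x₀).target) :
    inChart I (dExt I Ω) x₀ y = extDeriv (inChart I Ω x₀) y := by
  let x := (extChartAt I x₀).symm y
  have hx : x ∈ (extChartAt I x₀).source := (extChartAt I x₀).map_target hy
  let F : E → E := fun z ↦ extChartAt I x ((extChartAt I x₀).symm z)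
  have hxy : extChartAt I x₀ x = y := (extChartAt I x₀).right_inv hy
  have hF : ContDiffAt ℝ ∞ F y := by
    have := contDiffAt_writtenInCharts I I (f := fun x : M ↦ x) contMDiffAt_id hx
      (mem_extChartAt_source x)
    rwa [hxy] at this
  have h1 := inChart_eventuallyEq I hx (mem_extChartAt_source x) Ω
  rw [hxy] at h1
  rw [h1.extDeriv_eq]
  have h2 := extDeriv_pullback (r := ∞) (f := F) (x := y)
    (((isSmoothForm_iff I).1 h x).differentiableAt : DifferentiableAt ℝ (inChart I Ω x) (F y)) hF
    (by rw [minSmoothness_of_isRCLikeNormedField]; exact two_le_infty)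
  refine Eq.trans ?_ h2.symm
  have h3 : (tder I 𝓘(ℝ, E) (extChartAt I x) x).comp (tder 𝓘(ℝ, E) I (extChartAt I x₀).symm y) =
      fderiv ℝ F y := by
    rw [← tder_comp (f := (extChartAt I x₀).symm)
      (mdifferentiableAt_extChart I (mem_extChartAt_source x)) (mdifferentiableAt_extChart_symm I hy)]
    exact mfderiv_eq_fderiv
  rw [← h3]
  rfl

theorem IsSmoothForm.dExt {Ω : DForm I M n} (h : IsSmoothForm I Ω) : IsSmoothForm I (dExt I Ω) := by
  intro x₀
  refine ContDiffOn.congr (f := extDeriv (inChart I Ω x₀)) (fun y hy ↦ ?_)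
    fun y hy ↦ inChart_dExt I h hy
  exact (contDiffAt_extDeriv ((h x₀).contDiffAt
    ((isOpen_extChartAt_target x₀).mem_nhds hy))).contDiffWithinAt

theorem dExt_dExt {Ω : DForm I M n} (h : IsSmoothForm I Ω) :
    PolyRed.dExt I (PolyRed.dExt I Ω) = 0 := by
  refine form_ext I fun x ↦ ?_
  have hx := (isOpen_extChartAt_target (I := I) x).mem_nhds (mem_extChartAt_target x)
  have h1 : inChart I (PolyRed.dExt I Ω) x =ᶠ[𝓝 (extChartAt I x x)] extDeriv (inChart I Ω x) := by
    filter_upwards [hx] with y hy using inChart_dExt I h hy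
  rw [formAt_dExt, h1.extDeriv_eq, extDeriv_extDeriv_apply (r := ∞) ((h x).contDiffAt hx)
    (by rw [minSmoothness_of_isRCLikeNormedField]; exact two_le_infty)]
  rfl

theorem pullback_comp {g : M' → M''} {f : M → M'} (hg : ContMDiff I' I'' ∞ g)
    (hf : ContMDiff I I' ∞ f) (Ω : DForm I'' M'' n) :
    pullback I I'' (fun x ↦ g (f x)) Ω = pullback I I' f (pullback I' I'' g Ω) := by
  refine form_ext I fun x ↦ ?_
  rw [formAt_pullback, formAt_pullback, formAt_pullback,
    tder_comp (hg.mdifferentiable (by simp) _) (hf.mdifferentiable (by simp) x)]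
  rfl

theorem pullback_injective {f : M → M'} (hf : Surjective f) (hd : ∀ x, Surjective (tder I I' f x)) :
    Injective (pullback I I' f : DForm I' M' n → DForm I M n) := by
  intro Ω Ω' h
  refine form_ext I' fun y ↦ ?_
  obtain ⟨x, rfl⟩ := hf y
  ext v
  choose w hw using fun i ↦ hd x (v i)
  obtain rfl : (fun i ↦ tder I I' f x (w i)) = v := funext hw
  exact congrArg (fun A : E [⋀^Fin n]→L[ℝ] ℝ ↦ A w) (congrFun h x)

theorem IsSmoothForm.sub {Ω Ω' : DForm I M n} (h : IsSmoothForm I Ω) (h' : IsSmoothForm I Ω') :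
    IsSmoothForm I (fun x ↦ Ω x - Ω' x) := fun x₀ ↦ (h x₀).sub (h' x₀)

theorem IsSmoothForm.neg {Ω : DForm I M n} (h : IsSmoothForm I Ω) :
    IsSmoothForm I (fun x ↦ -Ω x) := fun x₀ ↦ (h x₀).neg

theorem dExt_add {Ω Ω' : DForm I M n} (h : ∀ x, SmoothFormAt Ω x) (h' : ∀ x, SmoothFormAt Ω' x) :
    PolyRed.dExt I (fun x ↦ Ω x + Ω' x) = fun x ↦ PolyRed.dExt I Ω x + PolyRed.dExt I Ω' x := by
  refine form_ext I fun x ↦ ?_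
  have h1 : extDeriv (inChart I (fun x ↦ Ω x + Ω' x) x) (extChartAt I x x) = _ :=
    extDeriv_add (h x).differentiableAt (h' x).differentiableAt
  rw [formAt_dExt, h1]
  rfl

theorem dExt_neg (Ω : DForm I M n) :
    PolyRed.dExt I (fun x ↦ -Ω x) = fun x ↦ -PolyRed.dExt I Ω x := by
  refine form_ext I fun x ↦ ?_
  have h0 : inChart I (fun x ↦ -Ω x) x = (-1 : ℝ) • inChart I Ω x := by
    funext y
    exact (neg_one_smul ℝ (inChart I Ω x y)).symm
  have h1 : extDeriv (inChart I (fun x ↦ -Ω x) x) (extChartAt I x x) =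
      -extDeriv (inChart I Ω x) (extChartAt I x x) := by
    rw [h0, extDeriv_smul, neg_one_smul]
  rw [formAt_dExt, h1]
  rfl

theorem dExt_sub {Ω Ω' : DForm I M n} (h : ∀ x, SmoothFormAt Ω x) (h' : ∀ x, SmoothFormAt Ω' x) :
    PolyRed.dExt I (fun x ↦ Ω x - Ω' x) = fun x ↦ PolyRed.dExt I Ω x - PolyRed.dExt I Ω' x := by
  have h1 := dExt_add I (Ω := Ω) (Ω' := fun x ↦ -Ω' x) h (fun x ↦ ContDiffAt.neg (h' x))
  rw [dExt_neg] at h1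
  have e : (fun x ↦ Ω x - Ω' x) = fun x ↦ Ω x + -Ω' x := funext fun x ↦ sub_eq_add_neg _ _
  rw [e, h1]
  exact funext fun x ↦ (sub_eq_add_neg _ _).symm

/-- The exterior derivative of a one-form, evaluated along a smooth family of points. -/
theorem dExt_apply_tder {V : Type*} [NormedAddCommGroup V] [NormedSpace ℝ V]
    [FiniteDimensional ℝ V] {f : V → M} {x : V} (hf : ContMDiffAt 𝓘(ℝ, V) I ∞ f x)
    {θ : DForm I M 1} (h : SmoothFormAt θ (f x)) (v w : V) :
    formAt I (PolyRed.dExt I θ) (f x) ![tder 𝓘(ℝ, V) I f x v, tder 𝓘(ℝ, V) I f x w] =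
      fderiv ℝ (fun y ↦ formAt I θ (f y) ![tder 𝓘(ℝ, V) I f y w]) x v -
      fderiv ℝ (fun y ↦ formAt I θ (f y) ![tder 𝓘(ℝ, V) I f y v]) x w := by
  have h1 := formAt_dExt_pullback 𝓘(ℝ, V) I hf h
  have h2 := congrArg (fun A : V [⋀^Fin 2]→L[ℝ] ℝ ↦ A ![v, w]) h1
  have e1 : ∀ L : V →L[ℝ] E, (fun i ↦ L (![v, w] i)) = ![L v, L w] := by
    intro L; ext i; fin_cases i <;> rfl
  have e2 : ∀ (L : V →L[ℝ] E) (u : V), (fun i ↦ L (![u] i)) = ![L u] := by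
    intro L u; ext i; fin_cases i; rfl
  -- pulling back along `f` reduces the claim to the exterior derivative on a vector space
  have h3 : formAt I (PolyRed.dExt I θ) (f x) ![tder 𝓘(ℝ, V) I f x v, tder 𝓘(ℝ, V) I f x w] =
      formAt 𝓘(ℝ, V) (PolyRed.dExt 𝓘(ℝ, V) (PolyRed.pullback 𝓘(ℝ, V) I f θ)) x ![v, w] := by
    rw [← e1]; exact h2.symm
  have h4 : ∀ y, inChart 𝓘(ℝ, V) (PolyRed.pullback 𝓘(ℝ, V) I f θ) x y =
      formAt 𝓘(ℝ, V) (PolyRed.pullback 𝓘(ℝ, V) I f θ) y := by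
    intro y
    have h5 : tder 𝓘(ℝ, V) 𝓘(ℝ, V) (extChartAt 𝓘(ℝ, V) x).symm y = ContinuousLinearMap.id ℝ V :=
      (tder_congr (Eventually.of_forall fun z ↦ by
        simp only [extChartAt_model_space_eq_id]; rfl)).trans (tder_id (I := 𝓘(ℝ, V)) y)
    rw [inChart_eq, h5]
    ext u
    simp only [extChartAt_model_space_eq_id]
    rfl
  have h6 : tder 𝓘(ℝ, V) 𝓘(ℝ, V) (extChartAt 𝓘(ℝ, V) x) x = ContinuousLinearMap.id ℝ V :=
    (tder_congr (Eventually.of_forall fun z ↦ by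
      simp only [extChartAt_model_space_eq_id]; rfl)).trans (tder_id (I := 𝓘(ℝ, V)) x)
  have h7 : extChartAt 𝓘(ℝ, V) x x = x := by simp only [extChartAt_model_space_eq_id]; rfl
  have hd := (h.pullback 𝓘(ℝ, V) I hf).differentiableAt
  rw [h7] at hd
  rw [h3, formAt_dExt, h6, h7]
  refine (extDeriv_apply_two hd v w).trans ?_
  simp only [h4, formAt_pullback]
  rw [← funext fun y ↦ congrArg (formAt I θ (f y)) (e2 (tder 𝓘(ℝ, V) I f y) w),
    ← funext fun y ↦ congrArg (formAt I θ (f y)) (e2 (tder 𝓘(ℝ, V) I f y) v)]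
  rfl

/-- The coefficients in a chart of a smooth field of vector-valued covectors are smooth. -/
theorem contDiffOn_apply_tder_symm {V : Type*} [NormedAddCommGroup V] [NormedSpace ℝ V]
    {α : ∀ x : M, TangentSpace I x →L[ℝ] V}
    (h : ContMDiff I.tangent 𝓘(ℝ, V) ∞ (fun v : TangentBundle I M ↦ α v.proj v.2)) (x₀ : M) (u : E) :
    ContDiffOn ℝ ∞ (fun y ↦ α ((extChartAt I x₀).symm y)
      (tder 𝓘(ℝ, E) I (extChartAt I x₀).symm y u)) (extChartAt I x₀).target := by
  have : IsManifold I 1 M := .of_le (n := ∞) (by simp)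
  have ht := isOpen_extChartAt_target (I := I) x₀
  have h1 : ContMDiffOn 𝓘(ℝ, E).tangent I.tangent ∞
      (tangentMapWithin 𝓘(ℝ, E) I (extChartAt I x₀).symm (extChartAt I x₀).target) _ :=
    (contMDiffOn_extChartAt_symm (n := ∞) x₀).contMDiffOn_tangentMapWithin (m := ∞) (by simp)
      ht.uniqueMDiffOn
  have h2 : ContMDiff 𝓘(ℝ, E) 𝓘(ℝ, E).tangent ∞
      (fun z : E ↦ (⟨z, u⟩ : TangentBundle 𝓘(ℝ, E) E)) := by
    have hp : ContMDiff 𝓘(ℝ, E) (𝓘(ℝ, E).prod 𝓘(ℝ, E)) ∞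
        (fun z : E ↦ ((z, u) : ModelProd E E)) := contMDiff_id.prodMk contMDiff_const
    rw [chartedSpaceSelf_prod] at hp
    exact (contMDiff_tangentBundleModelSpaceHomeomorph_symm (I := 𝓘(ℝ, E)) (n := ∞)).comp hp
  have h3 := h.comp_contMDiffOn (h1.comp (s := (extChartAt I x₀).target) h2.contMDiffOn fun z hz ↦ hz)
  refine (contMDiffOn_iff_contDiffOn.1 h3).congr fun z hz ↦ ?_
  have h4 : mfderivWithin 𝓘(ℝ, E) I (extChartAt I x₀).symm (extChartAt I x₀).target z =
      mfderiv 𝓘(ℝ, E) I (extChartAt I x₀).symm z := mfderivWithin_of_isOpen ht hz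
  simp only [Function.comp, tangentMapWithin, h4]
  rfl

theorem isSmoothForm_oneForm {α : ∀ x : M, TangentSpace I x →L[ℝ] ℝ}
    (h : ContMDiff I.tangent 𝓘(ℝ) ∞ (fun v : TangentBundle I M ↦ α v.proj v.2)) :
    IsSmoothForm I (oneForm I α) := fun x₀ y hy ↦ by
  refine ContDiffAt.contDiffWithinAt (contDiffAt_alternating_iff.2 fun v ↦ ?_)
  exact (contDiffOn_apply_tder_symm I h x₀ (v 0)).contDiffAt
    ((isOpen_extChartAt_target x₀).mem_nhds hy)

end Forms

/-! ### Bundles of vector-valued covectors -/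

section VCovDef

variable {E : Type*} [NormedAddCommGroup E] [NormedSpace ℝ E]
  {M : Type*} [TopologicalSpace M] [ChartedSpace E M]
  {V : Type*} [NormedAddCommGroup V] [NormedSpace ℝ V]

variable (E M V) in
/-- The bundle of covectors on `M` with values in the vector space `V`. The cotangent bundle and the
bundles of covelocities are the cases `V = ℝ` and `V = ℝ^k`. -/
abbrev VCov : Type _ :=
  Bundle.TotalSpace (E →L[ℝ] V)
    (fun x : M ↦ TangentSpace 𝓘(ℝ, E) x →L[ℝ] Bundle.Trivial M V x)

variable (E V) in
/-- The model with corners of `VCov E M V`. -/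
abbrev vcovModel : ModelWithCorners ℝ (E × (E →L[ℝ] V)) (ModelProd E (E →L[ℝ] V)) :=
  𝓘(ℝ, E).prod 𝓘(ℝ, E →L[ℝ] V)

/-- A shortcut instance. -/
@[reducible] def topologicalSpaceVCov [IsManifold 𝓘(ℝ, E) ∞ M] : TopologicalSpace (VCov E M V) :=
  inferInstance

attribute [local instance] topologicalSpaceVCov in
/-- A shortcut instance. -/
@[reducible] def chartedSpaceVCov [IsManifold 𝓘(ℝ, E) ∞ M] :
    ChartedSpace (ModelProd E (E →L[ℝ] V)) (VCov E M V) :=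
  inferInstance

end VCovDef

attribute [local instance] topologicalSpaceVCov chartedSpaceVCov

section VCov

variable {E : Type*} [NormedAddCommGroup E] [NormedSpace ℝ E] [FiniteDimensional ℝ E]
  {M : Type*} [TopologicalSpace M] [ChartedSpace E M] [IsManifold 𝓘(ℝ, E) ∞ M]
  {E' : Type*} [NormedAddCommGroup E'] [NormedSpace ℝ E'] [FiniteDimensional ℝ E']
  {M' : Type*} [TopologicalSpace M'] [ChartedSpace E' M'] [IsManifold 𝓘(ℝ, E') ∞ M']
  {V : Type*} [NormedAddCommGroup V] [NormedSpace ℝ V]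
  {V' : Type*} [NormedAddCommGroup V'] [NormedSpace ℝ V']
  {F : Type*} [NormedAddCommGroup F] [NormedSpace ℝ F] {H : Type*} [TopologicalSpace H]
  {I : ModelWithCorners ℝ F H} {N : Type*} [TopologicalSpace N] [ChartedSpace H N]

/-- The covector of a point of `VCov E M V`, regarded as a linear map on the model space. -/
def cov (z : VCov E M V) : E →L[ℝ] V := z.2

/-- The point of `VCov E M V` over `x` with given covector. -/
def mkCov (x : M) (α : E →L[ℝ] V) : VCov E M V := ⟨x, α⟩

theorem cov_mkCov (x : M) (α : E →L[ℝ] V) : cov (mkCov x α) = α := rfl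

theorem mkCov_cov (z : VCov E M V) : mkCov z.proj (cov z) = z := rfl

theorem vcov_ext {z z' : VCov E M V} (h : z.proj = z'.proj) (h' : cov z = cov z') : z = z' := by
  rw [← mkCov_cov z, ← mkCov_cov z', h, h']

/-- Smoothness of a map into the bundle of covectors, in terms of the coordinates of the covectors
in a chart. -/
theorem contMDiffAt_vcov_iff {h : N → VCov E M V} {x₀ : N} :
    ContMDiffAt I (vcovModel E V) ∞ h x₀ ↔
      ContMDiffAt I 𝓘(ℝ, E) ∞ (fun x ↦ (h x).proj) x₀ ∧
      ContMDiffAt I 𝓘(ℝ, E →L[ℝ] V) ∞ (fun x ↦ (cov (h x)).comp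
        (tder 𝓘(ℝ, E) 𝓘(ℝ, E) (extChartAt 𝓘(ℝ, E) (h x₀).proj).symm
          (extChartAt 𝓘(ℝ, E) (h x₀).proj (h x).proj))) x₀ := by
  have : IsManifold 𝓘(ℝ, E) 1 M := .of_le (n := ∞) (by simp)
  rw [contMDiffAt_hom_bundle]
  refine and_congr_right fun hp ↦ ?_
  have hev : (fun x ↦ ContinuousLinearMap.inCoordinates E (fun x : M ↦ TangentSpace 𝓘(ℝ, E) x) V
      (Bundle.Trivial M V) (h x₀).proj (h x).proj (h x₀).proj (h x).proj (h x).2) =ᶠ[𝓝 x₀]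
      fun x ↦ (cov (h x)).comp (tder 𝓘(ℝ, E) 𝓘(ℝ, E) (extChartAt 𝓘(ℝ, E) (h x₀).proj).symm
          (extChartAt 𝓘(ℝ, E) (h x₀).proj (h x).proj)) := by
    filter_upwards [hp.continuousAt.eventually_mem
      ((chartAt E (h x₀).proj).open_source.mem_nhds (mem_chart_source E _))] with x hx
    have h1 := TangentBundle.symmL_trivializationAt (I := 𝓘(ℝ, E)) hx
    unfold ContinuousLinearMap.inCoordinates
    have h2 : (trivializationAt V (Bundle.Trivial M V) (h x₀).proj).continuousLinearMapAt ℝ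
        (h x).proj = ContinuousLinearMap.id ℝ V :=
      Bundle.Trivial.continuousLinearMapAt_trivialization ℝ M V _
    rw [h2, h1]
    simp only [modelWithCornersSelf_coe, range_id, mfderivWithin_univ]
    rfl
  exact hev.contMDiffAt_iff

theorem contMDiff_vcov_proj :
    ContMDiff (vcovModel E V) 𝓘(ℝ, E) ∞ (fun z : VCov E M V ↦ z.proj) := fun z ↦
  (contMDiffAt_vcov_iff.1 (contMDiffAt_id (x := z))).1

theorem contMDiffAt_mkCov_model_iff {s : N → E} {α : N → (E →L[ℝ] V)} {x₀ : N} :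
    ContMDiffAt I (vcovModel E V) ∞ (fun x ↦ (mkCov (s x) (α x) : VCov E E V)) x₀ ↔
      ContMDiffAt I 𝓘(ℝ, E) ∞ s x₀ ∧ ContMDiffAt I 𝓘(ℝ, E →L[ℝ] V) ∞ α x₀ := by
  rw [contMDiffAt_vcov_iff]
  refine and_congr_right fun hs ↦ ?_
  have h5 : ∀ x y : E, tder 𝓘(ℝ, E) 𝓘(ℝ, E) (extChartAt 𝓘(ℝ, E) x).symm y =
      ContinuousLinearMap.id ℝ E := fun x y ↦
    (tder_congr (Eventually.of_forall fun z ↦ by simp only [extChartAt_model_space_eq_id]; rfl)).trans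
      (tder_id (I := 𝓘(ℝ, E)) y)
  simp only [h5, ContinuousLinearMap.comp_id, cov_mkCov]

/-- Pulling back covectors along a smooth map is smooth. -/
theorem contMDiffAt_mkCov_comp_tder {h : N → VCov E' M' V} {s : N → M} {f : M → M'} {x₀ : N}
    (hh : ContMDiffAt I (vcovModel E' V) ∞ h x₀) (hs : ContMDiffAt I 𝓘(ℝ, E) ∞ s x₀)
    (hf : ContMDiffAt 𝓘(ℝ, E) 𝓘(ℝ, E') ∞ f (s x₀))
    (hproj : ∀ᶠ x in 𝓝 x₀, (h x).proj = f (s x)) :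
    ContMDiffAt I (vcovModel E V) ∞
      (fun x ↦ (mkCov (s x) ((cov (h x)).comp (tder 𝓘(ℝ, E) 𝓘(ℝ, E') f (s x))) : VCov E M V)) x₀ := by
  obtain ⟨h1, h2⟩ := contMDiffAt_vcov_iff.1 hh
  refine contMDiffAt_vcov_iff.2 ⟨hs, ?_⟩
  have e0 : (h x₀).proj = f (s x₀) := hproj.self_of_nhds
  let φ := extChartAt 𝓘(ℝ, E) (s x₀)
  let ψ := extChartAt 𝓘(ℝ, E') (h x₀).proj
  have hsrc : s x₀ ∈ φ.source := mem_extChartAt_source _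
  have hfsrc : f (s x₀) ∈ ψ.source := by rw [← e0]; exact mem_extChartAt_source _
  let Φ : E → E' := fun z ↦ ψ (f (φ.symm z))
  have hΦ : ContDiffAt ℝ ∞ Φ (φ (s x₀)) := contDiffAt_writtenInCharts 𝓘(ℝ, E) 𝓘(ℝ, E') hf hsrc hfsrc
  have h3 : ContMDiffAt I 𝓘(ℝ, E →L[ℝ] E') ∞ (fun x ↦ fderiv ℝ Φ (φ (s x))) x₀ := by
    have h4 : ContMDiffAt I 𝓘(ℝ, E) ∞ (fun x ↦ φ (s x)) x₀ :=
      (contMDiffAt_extChartAt' (I := 𝓘(ℝ, E)) (n := ∞) (mem_chart_source E (s x₀))).comp x₀ hs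
    exact ((hΦ.fderiv_right (m := ∞) (by simp)).contMDiffAt).comp x₀ h4
  refine (h2.clm_comp h3).congr_of_eventuallyEq ?_
  have hfd : ∀ᶠ x in 𝓝 x₀, MDifferentiableAt 𝓘(ℝ, E) 𝓘(ℝ, E') f (s x) :=
    hs.continuousAt.eventually (eventually_mdifferentiableAt _ _ hf)
  have hfs : ContinuousAt (fun x ↦ f (s x)) x₀ := hf.continuousAt.comp hs.continuousAt
  filter_upwards [hproj, hfd, hs.continuousAt.eventually_mem
      ((isOpen_extChartAt_source (I := 𝓘(ℝ, E)) (s x₀)).mem_nhds hsrc), hfs.eventually_mem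
      ((isOpen_extChartAt_source (I := 𝓘(ℝ, E')) (h x₀).proj).mem_nhds hfsrc)] with x hx hfx hxs hxf
  change ((cov (h x)).comp (tder 𝓘(ℝ, E) 𝓘(ℝ, E') f (s x))).comp
    (tder 𝓘(ℝ, E) 𝓘(ℝ, E) φ.symm (φ (s x))) =
    ((cov (h x)).comp (tder 𝓘(ℝ, E') 𝓘(ℝ, E') ψ.symm (ψ (h x).proj))).comp (fderiv ℝ Φ (φ (s x)))
  rw [fderiv_writtenInCharts 𝓘(ℝ, E) 𝓘(ℝ, E') hfx hxs hxf, hx, ← ContinuousLinearMap.comp_assoc,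
    ContinuousLinearMap.comp_assoc (cov (h x)) _ (tder 𝓘(ℝ, E') 𝓘(ℝ, E') _ _),
    tder_extChart_symm_comp 𝓘(ℝ, E') hxf, ContinuousLinearMap.comp_id,
    ContinuousLinearMap.comp_assoc]

theorem contMDiffAt_mkCov_postcomp {h : N → VCov E M V} {x₀ : N} (P : V →L[ℝ] V')
    (hh : ContMDiffAt I (vcovModel E V) ∞ h x₀) :
    ContMDiffAt I (vcovModel E V') ∞
      (fun x ↦ (mkCov (h x).proj (P.comp (cov (h x))) : VCov E M V')) x₀ := by
  obtain ⟨h1, h2⟩ := contMDiffAt_vcov_iff.1 hh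
  refine contMDiffAt_vcov_iff.2 ⟨h1, ?_⟩
  exact (ContinuousLinearMap.compL ℝ E V V' P).contMDiff.contMDiffAt.comp x₀ h2

theorem contMDiffAt_mkCov_add {s : N → M} {α β : N → (E →L[ℝ] V)} {x₀ : N}
    (hα : ContMDiffAt I (vcovModel E V) ∞ (fun x ↦ (mkCov (s x) (α x) : VCov E M V)) x₀)
    (hβ : ContMDiffAt I (vcovModel E V) ∞ (fun x ↦ (mkCov (s x) (β x) : VCov E M V)) x₀) :
    ContMDiffAt I (vcovModel E V) ∞ (fun x ↦ (mkCov (s x) (α x + β x) : VCov E M V)) x₀ := by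
  obtain ⟨h1, h2⟩ := contMDiffAt_vcov_iff.1 hα
  obtain ⟨-, h3⟩ := contMDiffAt_vcov_iff.1 hβ
  refine contMDiffAt_vcov_iff.2 ⟨h1, (h2.add h3).congr_of_eventuallyEq ?_⟩
  exact Eventually.of_forall fun x ↦ ContinuousLinearMap.add_comp _ _ _

theorem contMDiffAt_mkCov_sub {s : N → M} {α β : N → (E →L[ℝ] V)} {x₀ : N}
    (hα : ContMDiffAt I (vcovModel E V) ∞ (fun x ↦ (mkCov (s x) (α x) : VCov E M V)) x₀)
    (hβ : ContMDiffAt I (vcovModel E V) ∞ (fun x ↦ (mkCov (s x) (β x) : VCov E M V)) x₀) :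
    ContMDiffAt I (vcovModel E V) ∞ (fun x ↦ (mkCov (s x) (α x - β x) : VCov E M V)) x₀ := by
  obtain ⟨h1, h2⟩ := contMDiffAt_vcov_iff.1 hα
  obtain ⟨-, h3⟩ := contMDiffAt_vcov_iff.1 hβ
  refine contMDiffAt_vcov_iff.2 ⟨h1, (h2.sub h3).congr_of_eventuallyEq ?_⟩
  exact Eventually.of_forall fun x ↦ ContinuousLinearMap.sub_comp _ _ _

/-- A field of covectors is smooth if it is smooth as a function on the tangent bundle. -/
theorem contMDiff_mkCov {α : M → (E →L[ℝ] V)}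
    (hα : ContMDiff 𝓘(ℝ, E).tangent 𝓘(ℝ, V) ∞
      (fun v : TangentBundle 𝓘(ℝ, E) M ↦ α v.proj v.2)) :
    ContMDiff 𝓘(ℝ, E) (vcovModel E V) ∞ (fun x ↦ (mkCov x (α x) : VCov E M V)) := by
  intro x₀
  refine contMDiffAt_vcov_iff.2 ⟨contMDiffAt_id, ?_⟩
  let φ := extChartAt 𝓘(ℝ, E) x₀
  have h1 : ContDiffOn ℝ ∞ (fun y ↦ (α (φ.symm y)).comp (tder 𝓘(ℝ, E) 𝓘(ℝ, E) φ.symm y)) φ.target :=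
    contDiffOn_clm_apply.2 fun u ↦ contDiffOn_apply_tder_symm 𝓘(ℝ, E) hα x₀ u
  have h2 : ContMDiffAt 𝓘(ℝ, E) 𝓘(ℝ, E) ∞ φ x₀ := contMDiffAt_extChartAt
  have h3 := (h1.contDiffAt ((isOpen_extChartAt_target x₀).mem_nhds
    (mem_extChartAt_target x₀))).contMDiffAt.comp x₀ h2
  refine h3.congr_of_eventuallyEq ?_
  filter_upwards [(isOpen_extChartAt_source (I := 𝓘(ℝ, E)) x₀).mem_nhds (mem_extChartAt_source x₀)]
    with x hx
  have e : φ.symm (φ x) = x := φ.left_inv hx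
  change _ = (α (φ.symm (φ x))).comp _
  rw [e]
  rfl

/-- If the pullbacks of covectors along a submersion depend smoothly on a parameter, so do the
covectors. -/
theorem contMDiffAt_mkCov_of_comp_tder
    {s : N → M} {f : M → M'} {γ : N → (E' →L[ℝ] V)} {x₀ : N}
    (hs : ContMDiffAt I 𝓘(ℝ, E) ∞ s x₀) (hf : ContMDiffAt 𝓘(ℝ, E) 𝓘(ℝ, E') ∞ f (s x₀))
    (hfs : Surjective (tder 𝓘(ℝ, E) 𝓘(ℝ, E') f (s x₀)))
    (hγ : ContMDiffAt I (vcovModel E V) ∞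
      (fun x ↦ (mkCov (s x) ((γ x).comp (tder 𝓘(ℝ, E) 𝓘(ℝ, E') f (s x))) : VCov E M V)) x₀) :
    ContMDiffAt I (vcovModel E' V) ∞ (fun x ↦ (mkCov (f (s x)) (γ x) : VCov E' M' V)) x₀ := by
  refine contMDiffAt_vcov_iff.2 ⟨hf.comp x₀ hs, ?_⟩
  obtain ⟨-, h1⟩ := contMDiffAt_vcov_iff.1 hγ
  let φ := extChartAt 𝓘(ℝ, E) (s x₀)
  let ψ := extChartAt 𝓘(ℝ, E') (f (s x₀))
  have hsrc : s x₀ ∈ φ.source := mem_extChartAt_source _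
  have hfsrc : f (s x₀) ∈ ψ.source := mem_extChartAt_source _
  let Φ : E → E' := fun z ↦ ψ (f (φ.symm z))
  let L : N → E →L[ℝ] E' := fun x ↦ fderiv ℝ Φ (φ (s x))
  have hL : ContMDiffAt I 𝓘(ℝ, E →L[ℝ] E') ∞ L x₀ := by
    have hΦ : ContDiffAt ℝ ∞ Φ (φ (s x₀)) :=
      contDiffAt_writtenInCharts 𝓘(ℝ, E) 𝓘(ℝ, E') hf hsrc hfsrc
    have h4 : ContMDiffAt I 𝓘(ℝ, E) ∞ (fun x ↦ φ (s x)) x₀ :=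
      (contMDiffAt_extChartAt' (I := 𝓘(ℝ, E)) (n := ∞) (mem_chart_source E (s x₀))).comp x₀ hs
    exact ((hΦ.fderiv_right (m := ∞) (by simp)).contMDiffAt).comp x₀ h4
  have hLeq : ∀ᶠ x in 𝓝 x₀, s x ∈ φ.source ∧ f (s x) ∈ ψ.source ∧
      L x = (tder 𝓘(ℝ, E') 𝓘(ℝ, E') ψ (f (s x))).comp ((tder 𝓘(ℝ, E) 𝓘(ℝ, E') f (s x)).comp
        (tder 𝓘(ℝ, E) 𝓘(ℝ, E) φ.symm (φ (s x)))) := by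
    have hfs : ContinuousAt (fun x ↦ f (s x)) x₀ := hf.continuousAt.comp hs.continuousAt
    filter_upwards [hs.continuousAt.eventually (eventually_mdifferentiableAt _ _ hf),
      hs.continuousAt.eventually_mem
        ((isOpen_extChartAt_source (I := 𝓘(ℝ, E)) (s x₀)).mem_nhds hsrc),
      hfs.eventually_mem
        ((isOpen_extChartAt_source (I := 𝓘(ℝ, E')) (f (s x₀))).mem_nhds hfsrc)] with x hfx hxs hxf
    exact ⟨hxs, hxf, fderiv_writtenInCharts 𝓘(ℝ, E) 𝓘(ℝ, E') hfx hxs hxf⟩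
  have hLs : Surjective (L x₀) := by
    rw [hLeq.self_of_nhds.2.2]
    have hψs : Surjective (tder 𝓘(ℝ, E') 𝓘(ℝ, E') ψ (f (s x₀))) := fun w ↦ by
      have h := tder_extChart_comp_symm 𝓘(ℝ, E') (ψ.map_source hfsrc)
      rw [show ψ.symm (ψ (f (s x₀))) = f (s x₀) from ψ.left_inv hfsrc] at h
      exact ⟨_, congrArg (fun A : E' →L[ℝ] E' ↦ A w) h⟩
    have hφs : Surjective (tder 𝓘(ℝ, E) 𝓘(ℝ, E) φ.symm (φ (s x₀))) := fun w ↦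
      ⟨_, congrArg (fun A : E →L[ℝ] E ↦ A w) (tder_extChart_symm_comp 𝓘(ℝ, E) hsrc)⟩
    exact hψs.comp (hfs.comp hφs)
  obtain ⟨R, hR⟩ := ContinuousLinearMap.exists_rightInverse_of_surjective (L x₀)
    (LinearMap.range_eq_top.2 hLs)
  -- near `x₀` the map `L x` has the smooth right inverse `R (L x R)⁻¹`
  let K : N → E' →L[ℝ] E' := fun x ↦ (L x).comp R
  have hK : ContMDiffAt I 𝓘(ℝ, E' →L[ℝ] E') ∞ K x₀ := hL.clm_comp contMDiffAt_const
  have hK0 : K x₀ = (ContinuousLinearEquiv.refl ℝ E' : E' →L[ℝ] E') := hR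
  have hKinv : ContMDiffAt I 𝓘(ℝ, E' →L[ℝ] E') ∞ (fun x ↦ ContinuousLinearMap.inverse (K x)) x₀ := by
    have h := contDiffAt_map_inverse (𝕜 := ℝ) (n := ∞) (ContinuousLinearEquiv.refl ℝ E')
    rw [← hK0] at h
    exact h.contMDiffAt.comp x₀ hK
  have hKu : ∀ᶠ x in 𝓝 x₀, K x ∈ range ((↑) : (E' ≃L[ℝ] E') → E' →L[ℝ] E') := by
    refine hK.continuousAt.eventually_mem ?_
    rw [hK0]
    exact ContinuousLinearEquiv.nhds _
  refine ((h1.clm_comp contMDiffAt_const).clm_comp hKinv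
    (g := fun x ↦ (_ : E →L[ℝ] V).comp R)).congr_of_eventuallyEq ?_
  filter_upwards [hLeq, hKu] with x hx hxu
  obtain ⟨e, he⟩ := hxu
  obtain ⟨hxs, hxf, hLx⟩ := hx
  have h2 : ((γ x).comp (tder 𝓘(ℝ, E) 𝓘(ℝ, E') f (s x))).comp
      (tder 𝓘(ℝ, E) 𝓘(ℝ, E) φ.symm (φ (s x))) =
      ((γ x).comp (tder 𝓘(ℝ, E') 𝓘(ℝ, E') ψ.symm (ψ (f (s x))))).comp (L x) := by
    rw [hLx, ← ContinuousLinearMap.comp_assoc _ _ ((tder 𝓘(ℝ, E) 𝓘(ℝ, E') f (s x)).comp _),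
      ContinuousLinearMap.comp_assoc (γ x) _ (tder 𝓘(ℝ, E') 𝓘(ℝ, E') ψ _),
      tder_extChart_symm_comp 𝓘(ℝ, E') hxf, ContinuousLinearMap.comp_id,
      ContinuousLinearMap.comp_assoc]
  have h3 : (K x).comp (ContinuousLinearMap.inverse (K x)) = ContinuousLinearMap.id ℝ E' := by
    rw [← he, ContinuousLinearMap.inverse_equiv]
    ext v
    simp
  change (γ x).comp (tder 𝓘(ℝ, E') 𝓘(ℝ, E') ψ.symm (ψ (f (s x)))) =
    ((((γ x).comp (tder 𝓘(ℝ, E) 𝓘(ℝ, E') f (s x))).comp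
      (tder 𝓘(ℝ, E) 𝓘(ℝ, E) φ.symm (φ (s x)))).comp R).comp (ContinuousLinearMap.inverse (K x))
  rw [h2, ContinuousLinearMap.comp_assoc _ (L x) R, ContinuousLinearMap.comp_assoc _ (K x), h3,
    ContinuousLinearMap.comp_id]

end VCov

/-! ### Charts of covector bundles -/

section CovCharts

variable {E : Type*} [NormedAddCommGroup E] [NormedSpace ℝ E] [FiniteDimensional ℝ E]
  {M : Type*} [TopologicalSpace M] [ChartedSpace E M] [IsManifold 𝓘(ℝ, E) ∞ M]
  {V : Type*} [NormedAddCommGroup V] [NormedSpace ℝ V]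

/-- The coordinates of a covector in the chart at `x₀`. -/
def covCoord (x₀ : M) (z : VCov E M V) : E →L[ℝ] V :=
  (cov z).comp (tder 𝓘(ℝ, E) 𝓘(ℝ, E) (extChartAt 𝓘(ℝ, E) x₀).symm (extChartAt 𝓘(ℝ, E) x₀ z.proj))

variable (V) in
/-- The covector with given coordinates in the chart at `x₀`. -/
def covParam (x₀ : M) (y : E × (E →L[ℝ] V)) : VCov E M V :=
  mkCov ((extChartAt 𝓘(ℝ, E) x₀).symm y.1)
    (y.2.comp (tder 𝓘(ℝ, E) 𝓘(ℝ, E) (extChartAt 𝓘(ℝ, E) x₀) ((extChartAt 𝓘(ℝ, E) x₀).symm y.1)))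

theorem contMDiffAt_extChart {x₀ x : M} (hx : x ∈ (extChartAt 𝓘(ℝ, E) x₀).source) :
    ContMDiffAt 𝓘(ℝ, E) 𝓘(ℝ, E) ∞ (extChartAt 𝓘(ℝ, E) x₀) x :=
  contMDiffAt_extChartAt' (by simpa using hx)

theorem contMDiffAt_extChart_symm {x₀ : M} {y : E} (hy : y ∈ (extChartAt 𝓘(ℝ, E) x₀).target) :
    ContMDiffAt 𝓘(ℝ, E) 𝓘(ℝ, E) ∞ (extChartAt 𝓘(ℝ, E) x₀).symm y :=
  (contMDiffOn_extChartAt_symm (n := ∞) x₀).contMDiffAt ((isOpen_extChartAt_target x₀).mem_nhds hy)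

theorem isOpen_proj_preimage (x₀ : M) :
    IsOpen {z : VCov E M V | z.proj ∈ (extChartAt 𝓘(ℝ, E) x₀).source} :=
  (isOpen_extChartAt_source x₀).preimage contMDiff_vcov_proj.continuous

theorem contMDiffAt_covCoord {x₀ : M} {z : VCov E M V}
    (hz : z.proj ∈ (extChartAt 𝓘(ℝ, E) x₀).source) :
    ContMDiffAt (vcovModel E V) 𝓘(ℝ, E →L[ℝ] V) ∞ (covCoord x₀) z := by
  let φ := extChartAt 𝓘(ℝ, E) x₀
  have h := contMDiffAt_mkCov_comp_tder (I := vcovModel E V) (h := fun z : VCov E M V ↦ z)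
    (s := fun z ↦ φ z.proj) (f := φ.symm) (x₀ := z) contMDiffAt_id
    ((contMDiffAt_extChart hz).comp z (contMDiff_vcov_proj z))
    (contMDiffAt_extChart_symm (φ.map_source hz)) (by
      filter_upwards [(isOpen_proj_preimage x₀).mem_nhds hz] with y hy
      exact (φ.left_inv hy).symm)
  exact (contMDiffAt_mkCov_model_iff.1 h).2

theorem contMDiffAt_covParam {x₀ : M} {y : E × (E →L[ℝ] V)}
    (hy : y.1 ∈ (extChartAt 𝓘(ℝ, E) x₀).target) :
    ContMDiffAt 𝓘(ℝ, E × (E →L[ℝ] V)) (vcovModel E V) ∞ (covParam V x₀) y := by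
  let φ := extChartAt 𝓘(ℝ, E) x₀
  have h1 : ContMDiffAt 𝓘(ℝ, E × (E →L[ℝ] V)) 𝓘(ℝ, E) ∞ (Prod.fst : E × (E →L[ℝ] V) → E) y :=
    contDiff_fst.contMDiff y
  have h2 : ContMDiffAt 𝓘(ℝ, E × (E →L[ℝ] V)) 𝓘(ℝ, E →L[ℝ] V) ∞
      (Prod.snd : E × (E →L[ℝ] V) → E →L[ℝ] V) y := contDiff_snd.contMDiff y
  exact contMDiffAt_mkCov_comp_tder (I := 𝓘(ℝ, E × (E →L[ℝ] V)))
    (h := fun y ↦ (mkCov y.1 y.2 : VCov E E V)) (s := fun y ↦ φ.symm y.1) (f := φ) (x₀ := y)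
    ((contMDiffAt_mkCov_model_iff (s := Prod.fst) (α := Prod.snd)).2 ⟨h1, h2⟩)
    ((contMDiffAt_extChart_symm hy).comp y h1)
    (contMDiffAt_extChart (φ.map_target hy)) (by
      filter_upwards [((isOpen_extChartAt_target (I := 𝓘(ℝ, E)) x₀).preimage
        continuous_fst).mem_nhds hy] with w hw
      exact (φ.right_inv hw).symm)

theorem covParam_covCoord {x₀ : M} {z : VCov E M V}
    (hz : z.proj ∈ (extChartAt 𝓘(ℝ, E) x₀).source) :
    covParam V x₀ (extChartAt 𝓘(ℝ, E) x₀ z.proj, covCoord x₀ z) = z := by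
  refine vcov_ext ((extChartAt 𝓘(ℝ, E) x₀).left_inv hz) ?_
  change (covCoord x₀ z).comp (tder 𝓘(ℝ, E) 𝓘(ℝ, E) (extChartAt 𝓘(ℝ, E) x₀)
    ((extChartAt 𝓘(ℝ, E) x₀).symm (extChartAt 𝓘(ℝ, E) x₀ z.proj))) = cov z
  rw [(extChartAt 𝓘(ℝ, E) x₀).left_inv hz, covCoord, ContinuousLinearMap.comp_assoc,
    tder_extChart_symm_comp 𝓘(ℝ, E) hz, ContinuousLinearMap.comp_id]

theorem covCoord_covParam {x₀ : M} {y : E × (E →L[ℝ] V)}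
    (hy : y.1 ∈ (extChartAt 𝓘(ℝ, E) x₀).target) : covCoord x₀ (covParam V x₀ y) = y.2 := by
  change (y.2.comp (tder 𝓘(ℝ, E) 𝓘(ℝ, E) (extChartAt 𝓘(ℝ, E) x₀)
    ((extChartAt 𝓘(ℝ, E) x₀).symm y.1))).comp (tder 𝓘(ℝ, E) 𝓘(ℝ, E) (extChartAt 𝓘(ℝ, E) x₀).symm
    (extChartAt 𝓘(ℝ, E) x₀ ((extChartAt 𝓘(ℝ, E) x₀).symm y.1))) = y.2
  rw [(extChartAt 𝓘(ℝ, E) x₀).right_inv hy, ContinuousLinearMap.comp_assoc,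
    tder_extChart_comp_symm 𝓘(ℝ, E) hy, ContinuousLinearMap.comp_id]

variable (V) in
/-- The chart of the covector bundle induced by the chart of the base at `x₀`. -/
def covChart (x₀ : M) : OpenPartialHomeomorph (VCov E M V) (E × (E →L[ℝ] V)) where
  toFun z := (extChartAt 𝓘(ℝ, E) x₀ z.proj, covCoord x₀ z)
  invFun := covParam V x₀
  source := {z | z.proj ∈ (extChartAt 𝓘(ℝ, E) x₀).source}
  target := {y | y.1 ∈ (extChartAt 𝓘(ℝ, E) x₀).target}
  map_source' _ hz := (extChartAt 𝓘(ℝ, E) x₀).map_source hz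
  map_target' _ hy := (extChartAt 𝓘(ℝ, E) x₀).map_target hy
  left_inv' _ hz := covParam_covCoord hz
  right_inv' _ hy := Prod.ext ((extChartAt 𝓘(ℝ, E) x₀).right_inv hy) (covCoord_covParam hy)
  open_source := isOpen_proj_preimage x₀
  open_target := (isOpen_extChartAt_target x₀).preimage continuous_fst
  continuousOn_toFun _ hz := ContinuousAt.continuousWithinAt
    (((contMDiffAt_extChart hz).continuousAt.comp contMDiff_vcov_proj.continuous.continuousAt).prodMk
      (contMDiffAt_covCoord hz).continuousAt)
  continuousOn_invFun _ hy := (contMDiffAt_covParam hy).continuousAt.continuousWithinAt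

theorem contMDiffAt_covChart {x₀ : M} {z : VCov E M V}
    (hz : z.proj ∈ (extChartAt 𝓘(ℝ, E) x₀).source) :
    ContMDiffAt (vcovModel E V) 𝓘(ℝ, E × (E →L[ℝ] V)) ∞ (covChart V x₀) z :=
  ((contMDiffAt_extChart hz).comp z (contMDiff_vcov_proj z)).prodMk_space (contMDiffAt_covCoord hz)

theorem t2Space_vcov [T2Space M] : T2Space (VCov E M V) := by
  refine ⟨fun z z' hne ↦ ?_⟩
  by_cases h : z.proj = z'.proj
  · have hz : z ∈ (covChart V z.proj).source := mem_extChartAt_source (I := 𝓘(ℝ, E)) z.proj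
    have hz' : z' ∈ (covChart V z.proj).source := by
      change z'.proj ∈ (extChartAt 𝓘(ℝ, E) z.proj).source
      rw [← h]; exact mem_extChartAt_source z.proj
    obtain ⟨u, v, hu, hv, hzu, hzv, huv⟩ := t2_separation
      (fun e ↦ hne ((covChart V z.proj).injOn hz hz' e))
    refine ⟨_, _, (covChart V z.proj).isOpen_inter_preimage hu,
      (covChart V z.proj).isOpen_inter_preimage hv, ⟨hz, hzu⟩, ⟨hz', hzv⟩, ?_⟩
    exact (huv.preimage _).mono inter_subset_right inter_subset_right
  · obtain ⟨u, v, hu, hv, hzu, hzv, huv⟩ := t2_separation h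
    have hc : Continuous (fun z : VCov E M V ↦ z.proj) := contMDiff_vcov_proj.continuous
    exact ⟨_, _, hu.preimage hc, hv.preimage hc, hzu, hzv, huv.preimage _⟩

theorem secondCountableTopology_vcov [FiniteDimensional ℝ V] [SecondCountableTopology M] :
    SecondCountableTopology (VCov E M V) := by
  obtain ⟨t, htc, ht⟩ := TopologicalSpace.countable_cover_nhds
    (fun x : M ↦ extChartAt_source_mem_nhds (I := 𝓘(ℝ, E)) x)
  have := htc.to_subtype
  have hs : ∀ x : t, SecondCountableTopology (covChart (E := E) (M := M) V x.1).source := fun x ↦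
    (covChart V x.1).secondCountableTopology_source
  refine TopologicalSpace.secondCountableTopology_of_countable_cover
    (U := fun x : t ↦ (covChart V x.1).source) (fun x ↦ (covChart V x.1).open_source) ?_
  refine eq_univ_of_forall fun z ↦ ?_
  have hz : z.proj ∈ ⋃ x ∈ t, (extChartAt 𝓘(ℝ, E) x).source := by rw [ht]; exact mem_univ _
  obtain ⟨x, hx, hzx⟩ := mem_iUnion₂.1 hz
  exact mem_iUnion.2 ⟨⟨x, hx⟩, hzx⟩

end CovCharts

/-! ### The canonical symplectic form in coordinates -/

section CanonicalForm

variable {E : Type*} [NormedAddCommGroup E] [NormedSpace ℝ E] [FiniteDimensional ℝ E]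
  {M : Type*} [TopologicalSpace M] [ChartedSpace E M] [IsManifold 𝓘(ℝ, E) ∞ M]

theorem inChart_model {n : ℕ} (Ω : DForm 𝓘(ℝ, E) E n) (x y : E) :
    inChart 𝓘(ℝ, E) Ω x y = formAt 𝓘(ℝ, E) Ω y := by
  have h5 : tder 𝓘(ℝ, E) 𝓘(ℝ, E) (extChartAt 𝓘(ℝ, E) x).symm y = ContinuousLinearMap.id ℝ E :=
    (tder_congr (Eventually.of_forall fun z ↦ by
      simp only [extChartAt_model_space_eq_id]; rfl)).trans (tder_id (I := 𝓘(ℝ, E)) y)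
  rw [inChart_eq, h5]
  ext u
  simp only [extChartAt_model_space_eq_id]
  rfl

theorem formAt_tautForm (z : Cot E M) (w : Fin 1 → E × (E →L[ℝ] ℝ)) :
    formAt (cotModel E) (tautForm E M) z w =
      cov z (tder (cotModel E) 𝓘(ℝ, E) (fun z : Cot E M ↦ z.proj) z (w 0)) := rfl

theorem tder_covChart_apply {x₀ : M} {z : Cot E M} (hz : z.proj ∈ (extChartAt 𝓘(ℝ, E) x₀).source)
    (w : E × (E →L[ℝ] ℝ)) :
    tder (cotModel E) 𝓘(ℝ, E × (E →L[ℝ] ℝ)) (covChart ℝ x₀) z w =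
      (tder (cotModel E) 𝓘(ℝ, E) (fun z : Cot E M ↦ extChartAt 𝓘(ℝ, E) x₀ z.proj) z w,
        tder (cotModel E) 𝓘(ℝ, E →L[ℝ] ℝ) (covCoord x₀) z w) := by
  have h1 : MDifferentiableAt (cotModel E) 𝓘(ℝ, E)
      (fun z : Cot E M ↦ extChartAt 𝓘(ℝ, E) x₀ z.proj) z :=
    ((contMDiffAt_extChart hz).comp z (contMDiff_vcov_proj z)).mdifferentiableAt (by simp)
  have h2 : MDifferentiableAt (cotModel E) 𝓘(ℝ, E →L[ℝ] ℝ) (covCoord (V := ℝ) x₀) z :=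
    (contMDiffAt_covCoord hz).mdifferentiableAt (by simp)
  have h3 : tder (cotModel E) 𝓘(ℝ, E × (E →L[ℝ] ℝ))
      (fun z : Cot E M ↦ (extChartAt 𝓘(ℝ, E) x₀ z.proj, covCoord x₀ z)) z =
      (tder (cotModel E) 𝓘(ℝ, E) (fun z : Cot E M ↦ extChartAt 𝓘(ℝ, E) x₀ z.proj) z).prod
        (tder (cotModel E) 𝓘(ℝ, E →L[ℝ] ℝ) (covCoord x₀) z) := by
    rw [modelWithCornersSelf_prod, ← chartedSpaceSelf_prod]
    exact tder_prodMk h1 h2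
  exact congrArg (fun L : E × (E →L[ℝ] ℝ) →L[ℝ] E × (E →L[ℝ] ℝ) ↦ L w) h3

theorem isSmoothForm_tautForm : IsSmoothForm (cotModel E) (tautForm E M) := by
  refine (isSmoothForm_iff (cotModel E)).2 fun z₀ ↦ ?_
  let Z := E × (E →L[ℝ] ℝ)
  let lam : DForm 𝓘(ℝ, Z) Z 1 := oneForm 𝓘(ℝ, Z) fun y ↦
    (y.2.comp (ContinuousLinearMap.fst ℝ E (E →L[ℝ] ℝ)) : Z →L[ℝ] ℝ)
  have hlam : ∀ y, SmoothFormAt lam y := by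
    intro y
    refine contDiffAt_alternating_iff.2 fun v ↦ ?_
    simp only [inChart_model]
    have h : ContDiff ℝ ∞ (fun y : Z ↦ y.2 (v 0).1) := contDiff_snd.clm_apply contDiff_const
    exact h.contDiffAt
  have hz₀ : z₀.proj ∈ (extChartAt 𝓘(ℝ, E) z₀.proj).source := mem_extChartAt_source _
  refine smoothFormAt_congr (cotModel E) ?_ ((hlam (covChart ℝ z₀.proj z₀)).pullback (cotModel E)
    𝓘(ℝ, Z) (contMDiffAt_covChart hz₀))
  filter_upwards [(isOpen_proj_preimage (V := ℝ) z₀.proj).mem_nhds hz₀] with z hz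
  ext w
  rw [formAt_tautForm]
  change covCoord z₀.proj z (tder (cotModel E) 𝓘(ℝ, Z) (covChart ℝ z₀.proj) z (w 0)).1 = _
  rw [tder_covChart_apply hz, tder_comp_apply_of_eq rfl
    (mdifferentiableAt_extChart 𝓘(ℝ, E) hz) (contMDiff_vcov_proj.mdifferentiable (by simp) z)]
  have h1 : (covCoord z₀.proj z).comp (tder 𝓘(ℝ, E) 𝓘(ℝ, E) (extChartAt 𝓘(ℝ, E) z₀.proj) z.proj) =
      cov z := by
    rw [covCoord, ContinuousLinearMap.comp_assoc, tder_extChart_symm_comp 𝓘(ℝ, E) hz,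
      ContinuousLinearMap.comp_id]
  exact congrArg (fun L : E →L[ℝ] ℝ ↦ L _) h1

theorem isSmoothForm_canForm : IsSmoothForm (cotModel E) (canForm E M) :=
  (isSmoothForm_tautForm.dExt (cotModel E)).neg (cotModel E)

theorem dExt_canForm : dExt (cotModel E) (canForm E M) = 0 := by
  have h1 : dExt (cotModel E) (canForm E M) =
      fun x ↦ -dExt (cotModel E) (dExt (cotModel E) (tautForm E M)) x := dExt_neg (cotModel E) _
  rw [h1, dExt_dExt (cotModel E) isSmoothForm_tautForm]
  exact funext fun x ↦ neg_zero

/-- In the coordinates `(u, δ)` on the tangent spaces induced by a chart, the canonical symplectic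
form is the standard one. -/
theorem formAt_canForm {x₀ : M} {z : Cot E M} (hz : z.proj ∈ (extChartAt 𝓘(ℝ, E) x₀).source)
    (v w : E × (E →L[ℝ] ℝ)) :
    formAt (cotModel E) (canForm E M) z ![v, w] =
      tder (cotModel E) 𝓘(ℝ, E →L[ℝ] ℝ) (covCoord x₀) z w
        (tder (cotModel E) 𝓘(ℝ, E) (fun z : Cot E M ↦ extChartAt 𝓘(ℝ, E) x₀ z.proj) z v) -
      tder (cotModel E) 𝓘(ℝ, E →L[ℝ] ℝ) (covCoord x₀) z v
        (tder (cotModel E) 𝓘(ℝ, E) (fun z : Cot E M ↦ extChartAt 𝓘(ℝ, E) x₀ z.proj) z w) := by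
  let Z := E × (E →L[ℝ] ℝ)
  let f : Z → Cot E M := covParam ℝ x₀
  let y₀ : Z := covChart ℝ x₀ z
  have hy₀ : y₀.1 ∈ (extChartAt 𝓘(ℝ, E) x₀).target := (extChartAt 𝓘(ℝ, E) x₀).map_source hz
  have hfy : f y₀ = z := covParam_covCoord hz
  have hfd : MDifferentiableAt 𝓘(ℝ, Z) (cotModel E) f y₀ :=
    (contMDiffAt_covParam hy₀).mdifferentiableAt (by simp)
  have hcd : MDifferentiableAt (cotModel E) 𝓘(ℝ, Z) (covChart ℝ x₀) z :=
    (contMDiffAt_covChart hz).mdifferentiableAt (by simp)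
  have hid : ∀ v : Z, tder 𝓘(ℝ, Z) (cotModel E) f y₀
      (tder (cotModel E) 𝓘(ℝ, Z) (covChart ℝ x₀) z v) = v := by
    intro v
    rw [← tder_comp_apply_of_eq (f := covChart ℝ x₀) rfl hfd hcd]
    have h : tder (cotModel E) (cotModel E) (fun z : Cot E M ↦ f (covChart ℝ x₀ z)) z =
        tder (cotModel E) (cotModel E) (fun z : Cot E M ↦ z) z := by
      refine tder_congr ?_
      filter_upwards [(isOpen_proj_preimage x₀).mem_nhds hz] with y hy using covParam_covCoord hy
    rw [h, tder_id]; rfl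
  -- in coordinates `(u, δ)` the tautological form is `δ du`
  have hθ : ∀ w : Z, (fun y ↦ formAt (cotModel E) (tautForm E M) (f y)
      ![tder 𝓘(ℝ, Z) (cotModel E) f y w]) =ᶠ[𝓝 y₀] fun y ↦ y.2 w.1 := by
    intro w
    filter_upwards [((isOpen_extChartAt_target (I := 𝓘(ℝ, E)) x₀).preimage
      continuous_fst).mem_nhds hy₀] with y hy
    have hy' : y.1 ∈ (extChartAt 𝓘(ℝ, E) x₀).target := hy
    have h1 : MDifferentiableAt 𝓘(ℝ, Z) 𝓘(ℝ, E) (Prod.fst : Z → E) y :=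
      (contDiff_fst (n := ∞)).contMDiff.mdifferentiable (by simp) y
    have h2 : tder 𝓘(ℝ, Z) 𝓘(ℝ, E) (Prod.fst : Z → E) y = ContinuousLinearMap.fst ℝ E (E →L[ℝ] ℝ) :=
      tder_clm (ContinuousLinearMap.fst ℝ E (E →L[ℝ] ℝ)) y
    rw [formAt_tautForm]
    change cov (f y) (tder (cotModel E) 𝓘(ℝ, E) (fun z : Cot E M ↦ z.proj) (f y)
      (tder 𝓘(ℝ, Z) (cotModel E) f y w)) = y.2 w.1
    rw [← tder_comp_apply_of_eq (f := f) rfl (contMDiff_vcov_proj.mdifferentiable (by simp) (f y))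
      ((contMDiffAt_covParam hy).mdifferentiableAt (by simp))]
    have h3 := tder_comp_apply_of_eq (f := (Prod.fst : Z → E))
      (g := (extChartAt 𝓘(ℝ, E) x₀).symm) rfl (mdifferentiableAt_extChart_symm 𝓘(ℝ, E) hy') h1 w
    refine (congrArg (cov (f y)) h3).trans ?_
    rw [h2]
    have h4 := congrArg (fun L : E →L[ℝ] E ↦ y.2 (L w.1)) (tder_extChart_comp_symm 𝓘(ℝ, E) hy')
    exact h4
  have hfd2 : ∀ v w : Z, fderiv ℝ (fun y : Z ↦ y.2 w.1) y₀ v = v.2 w.1 := by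
    intro v w
    let L : Z →L[ℝ] ℝ := (ContinuousLinearMap.apply ℝ ℝ w.1).comp
      (ContinuousLinearMap.snd ℝ E (E →L[ℝ] ℝ))
    have h : fderiv ℝ (fun y : Z ↦ y.2 w.1) y₀ = L := L.fderiv
    rw [h]; rfl
  have key : ∀ v w : Z, formAt (cotModel E) (dExt (cotModel E) (tautForm E M)) (f y₀)
      ![tder 𝓘(ℝ, Z) (cotModel E) f y₀ v, tder 𝓘(ℝ, Z) (cotModel E) f y₀ w] =
      v.2 w.1 - w.2 v.1 := by
    intro v w
    rw [dExt_apply_tder (cotModel E) (contMDiffAt_covParam hy₀)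
      ((isSmoothForm_iff (cotModel E)).1 isSmoothForm_tautForm _) v w, (hθ w).fderiv_eq,
      (hθ v).fderiv_eq, hfd2, hfd2]
  have k2 := key (tder (cotModel E) 𝓘(ℝ, Z) (covChart ℝ x₀) z v)
    (tder (cotModel E) 𝓘(ℝ, Z) (covChart ℝ x₀) z w)
  rw [hid, hid, hfy, tder_covChart_apply hz, tder_covChart_apply hz] at k2
  have k3 : formAt (cotModel E) (canForm E M) z ![v, w] =
      -formAt (cotModel E) (dExt (cotModel E) (tautForm E M)) z ![v, w] := rfl
  rw [k3, k2, neg_sub]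

end CanonicalForm

/-! ### Pullbacks of forms of low degree -/

section LowDegree

variable {E : Type*} [NormedAddCommGroup E] [NormedSpace ℝ E] {H : Type*} [TopologicalSpace H]
  (I : ModelWithCorners ℝ E H) {M : Type*} [TopologicalSpace M] [ChartedSpace H M]
  {E' : Type*} [NormedAddCommGroup E'] [NormedSpace ℝ E'] {H' : Type*} [TopologicalSpace H']
  (I' : ModelWithCorners ℝ E' H') {M' : Type*} [TopologicalSpace M'] [ChartedSpace H' M']

theorem formAt_pullback_one (f : M → M') (θ : DForm I' M' 1) (x : M) (v : E) :
    formAt I (pullback I I' f θ) x ![v] = formAt I' θ (f x) ![tder I I' f x v] := by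
  refine congrArg (formAt I' θ (f x)) ?_
  ext i; fin_cases i; rfl

theorem formAt_pullback_two (f : M → M') (Ω : DForm I' M' 2) (x : M) (v w : E) :
    formAt I (pullback I I' f Ω) x ![v, w] =
      formAt I' Ω (f x) ![tder I I' f x v, tder I I' f x w] := by
  refine congrArg (formAt I' Ω (f x)) ?_
  ext i; fin_cases i <;> rfl

end LowDegree

/-! ### The pullback bundle -/

section PullBundle

variable {b c k : ℕ} {B : Type*} [TopologicalSpace B] [ChartedSpace (EuclideanSpace ℝ (Fin b)) B]
  [IsManifold (𝓡 b) ∞ B] {C : Type*} [TopologicalSpace C]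
  [ChartedSpace (EuclideanSpace ℝ (Fin c)) C] {p : C^∞⟮𝓡 c, C; 𝓡 b, B⟯}
  {F : Type*} [NormedAddCommGroup F] [NormedSpace ℝ F] {H : Type*} [TopologicalSpace H]
  {I : ModelWithCorners ℝ F H} {N : Type*} [TopologicalSpace N] [ChartedSpace H N]

/-- A shortcut instance. -/
@[reducible] def topologicalSpacePullCov : TopologicalSpace (PullCov k p) := inferInstance

attribute [local instance] topologicalSpacePullCov

/-- A shortcut instance. -/
@[reducible] def chartedSpacePullCov :
    ChartedSpace (ModelProd (EuclideanSpace ℝ (Fin c))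
      (EuclideanSpace ℝ (Fin b) →L[ℝ] (Fin k → ℝ))) (PullCov k p) := inferInstance

attribute [local instance] chartedSpacePullCov

variable (p) in
/-- The point of the pullback bundle over `y` with given `k`-covelocity at `p y`. -/
def mkPull (y : C) (γ : EuclideanSpace ℝ (Fin b) →L[ℝ] (Fin k → ℝ)) : PullCov k p := ⟨y, γ⟩

theorem pullCov_ext {x x' : PullCov k p} (h₁ : pr₁ p x = pr₁ p x') (h₂ : pr₂ p x = pr₂ p x') :
    x = x' := by
  obtain ⟨y, γ⟩ := x
  obtain ⟨y', γ'⟩ := x'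
  obtain rfl : y = y' := h₁
  have h : cov (pr₂ p ⟨y, γ⟩) = cov (pr₂ p ⟨y, γ'⟩) := by rw [h₂]
  exact congrArg (mkPull p y) h

/-- A map into the pullback bundle is smooth if and only if its two projections are. -/
theorem contMDiffAt_pullCov_iff {h : N → PullCov k p} {x₀ : N} :
    ContMDiffAt I (pullModel b c k) ∞ h x₀ ↔
      ContMDiffAt I (𝓡 c) ∞ (fun x ↦ pr₁ p (h x)) x₀ ∧
      ContMDiffAt I (covModel (EuclideanSpace ℝ (Fin b)) k) ∞ (fun x ↦ pr₂ p (h x)) x₀ := by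
  rw [Bundle.contMDiffAt_totalSpace, Bundle.contMDiffAt_totalSpace]
  constructor
  · rintro ⟨h1, h2⟩
    exact ⟨h1, (p.contMDiff _).comp x₀ h1, h2⟩
  · rintro ⟨h1, -, h2⟩
    exact ⟨h1, h2⟩

theorem contMDiff_pr₁ : ContMDiff (pullModel b c k) (𝓡 c) ∞ (pr₁ (k := k) p) := fun x ↦
  (contMDiffAt_pullCov_iff.1 (contMDiffAt_id (x := x))).1

theorem contMDiff_pr₂ :
    ContMDiff (pullModel b c k) (covModel (EuclideanSpace ℝ (Fin b)) k) ∞ (pr₂ (k := k) p) :=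
  fun x ↦ (contMDiffAt_pullCov_iff.1 (contMDiffAt_id (x := x))).2

theorem t2Space_pullCov [T2Space B] [T2Space C] : T2Space (PullCov k p) := by
  have : T2Space (Cov (EuclideanSpace ℝ (Fin b)) B k) := t2Space_vcov
  refine T2Space.of_injective_continuous (f := fun x : PullCov k p ↦ (pr₁ p x, pr₂ p x)) ?_
    (contMDiff_pr₁.continuous.prodMk contMDiff_pr₂.continuous)
  intro x x' h
  exact pullCov_ext (congrArg Prod.fst h) (congrArg Prod.snd h)

theorem contMDiff_covProj {E : Type*} [NormedAddCommGroup E] [NormedSpace ℝ E]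
    [FiniteDimensional ℝ E] {M : Type*} [TopologicalSpace M] [ChartedSpace E M]
    [IsManifold 𝓘(ℝ, E) ∞ M] (a : Fin k) :
    ContMDiff (covModel E k) (cotModel E) ∞ (covProj (E := E) (M := M) a) := fun x ↦
  contMDiffAt_mkCov_postcomp (ContinuousLinearMap.proj (R := ℝ) (φ := fun _ : Fin k ↦ ℝ) a)
    (contMDiffAt_id (x := x))

end PullBundle

/-! ### The magnetic forms in coordinates -/

section Magnetic

variable {b c k : ℕ} {B : Type*} [TopologicalSpace B] [ChartedSpace (EuclideanSpace ℝ (Fin b)) B]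
  [IsManifold (𝓡 b) ∞ B] {C : Type*} [TopologicalSpace C]
  [ChartedSpace (EuclideanSpace ℝ (Fin c)) C] [IsManifold (𝓡 c) ∞ C]
  {p : C^∞⟮𝓡 c, C; 𝓡 b, B⟯}

attribute [local instance] topologicalSpacePullCov chartedSpacePullCov

theorem isManifold_pullCov : IsManifold (pullModel b c k) ∞ (PullCov k p) := inferInstance

attribute [local instance] isManifold_pullCov

theorem isSmoothForm_magneticForm {β : Fin k → DForm (𝓡 c) C 2}
    (hβ : ∀ a, IsSmoothForm (𝓡 c) (β a)) (a : Fin k) :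
    IsSmoothForm (pullModel b c k) (magneticForm p β a) :=
  (isSmoothForm_canForm.pullback (pullModel b c k) _
    ((contMDiff_covProj a).comp contMDiff_pr₂)).sub (pullModel b c k)
    ((hβ a).pullback (pullModel b c k) _ contMDiff_pr₁)

theorem dExt_magneticForm {β : Fin k → DForm (𝓡 c) C 2}
    (hβ : ∀ a, IsSmoothForm (𝓡 c) (β a)) (hβd : ∀ a, dExt (𝓡 c) (β a) = 0) (a : Fin k) :
    dExt (pullModel b c k) (magneticForm p β a) = 0 := by
  have hc : ContMDiff (pullModel b c k) (cotModel (EuclideanSpace ℝ (Fin b))) ∞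
      (fun y : PullCov k p ↦ covProj a (pr₂ p y)) := (contMDiff_covProj a).comp contMDiff_pr₂
  have h1 := (isSmoothForm_iff _).1 ((isSmoothForm_canForm (M := B)).pullback (pullModel b c k) _ hc)
  have h2 := (isSmoothForm_iff _).1
    ((hβ a).pullback (pullModel b c k) _ (contMDiff_pr₁ (k := k) (p := p)))
  refine (dExt_sub (pullModel b c k) h1 h2).trans ?_
  funext x
  rw [dExt_pullback (pullModel b c k) _ hc ((isSmoothForm_iff _).1 isSmoothForm_canForm),
    dExt_pullback (pullModel b c k) _ contMDiff_pr₁ ((isSmoothForm_iff _).1 (hβ a)), dExt_canForm,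
    hβd a]
  exact sub_self _

/-- The fibre coordinates on the pullback bundle given by the chart of the base at `b₀`. -/
def pullCoord (b₀ : B) (x : PullCov k p) : EuclideanSpace ℝ (Fin b) →L[ℝ] (Fin k → ℝ) :=
  covCoord b₀ (pr₂ p x)

theorem contMDiffAt_pullCoord (x : PullCov k p) :
    ContMDiffAt (pullModel b c k) 𝓘(ℝ, EuclideanSpace ℝ (Fin b) →L[ℝ] (Fin k → ℝ)) ∞
      (pullCoord (p x.proj)) x :=
  (contMDiffAt_covCoord (z := pr₂ p x) (mem_extChartAt_source (p x.proj))).comp x (contMDiff_pr₂ x)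

variable (b c k) in
/-- The model space of the pullback bundle. -/
abbrev PullSpace : Type :=
  EuclideanSpace ℝ (Fin c) × (EuclideanSpace ℝ (Fin b) →L[ℝ] (Fin k → ℝ))

/-- The derivatives of `pr₁` and of the fibre coordinates are linear coordinates on the tangent
spaces of the pullback bundle. -/
theorem bijective_tder_pullCov (x : PullCov k p) :
    Bijective ((tder (pullModel b c k) (𝓡 c) (pr₁ p) x).prod
      (tder (pullModel b c k) 𝓘(ℝ, EuclideanSpace ℝ (Fin b) →L[ℝ] (Fin k → ℝ))
        (pullCoord (p x.proj)) x)) := by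
  set U := tder (pullModel b c k) (𝓡 c) (pr₁ (k := k) p) x with hU
  set Δ := tder (pullModel b c k) 𝓘(ℝ, EuclideanSpace ℝ (Fin b) →L[ℝ] (Fin k → ℝ))
        (pullCoord (p x.proj)) x with hΔ
  suffices hinj : Injective (U.prod Δ) from
    ⟨hinj, LinearMap.injective_iff_surjective (f := (U.prod Δ).toLinearMap).1 hinj⟩
  let φ := extChartAt (𝓡 c) x.proj
  let ψ := extChartAt (𝓡 b) (p x.proj)
  -- `g` is a local left inverse of the coordinates `Φ`
  let Φ : PullCov k p → PullSpace b c k := fun y ↦ (φ (pr₁ p y), pullCoord (p x.proj) y)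
  let g : PullSpace b c k → PullCov k p := fun y ↦ mkPull p (φ.symm y.1)
    (y.2.comp (tder (𝓡 b) (𝓡 b) ψ (p (φ.symm y.1))))
  have hφx : x.proj ∈ φ.source := mem_extChartAt_source x.proj
  have hψx : p x.proj ∈ ψ.source := mem_extChartAt_source (p x.proj)
  have hφd : MDifferentiableAt (pullModel b c k) (𝓡 c) (fun y ↦ φ (pr₁ p y)) x :=
    ((contMDiffAt_extChart hφx).comp x (contMDiff_pr₁ x)).mdifferentiableAt (by simp)
  have hΔd := (contMDiffAt_pullCoord x).mdifferentiableAt (by simp)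
  have hg : ContMDiffAt 𝓘(ℝ, PullSpace b c k) (pullModel b c k) ∞ g (Φ x) := by
    have h1 : ContMDiffAt 𝓘(ℝ, PullSpace b c k) (𝓡 c) ∞
        (fun y : PullSpace b c k ↦ φ.symm y.1) (Φ x) :=
      (contMDiffAt_extChart_symm (φ.map_source hφx)).comp (Φ x)
        (f := (Prod.fst : PullSpace b c k → _)) (contDiff_fst.contMDiff _)
    refine contMDiffAt_pullCov_iff.2 ⟨h1, ?_⟩
    have e : φ.symm (Φ x).1 = x.proj := φ.left_inv hφx
    have h2 : ContMDiffAt 𝓘(ℝ, PullSpace b c k) (𝓡 b) ∞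
        (fun y : PullSpace b c k ↦ p (φ.symm y.1)) (Φ x) := (p.contMDiff _).comp _ h1
    have hmem : p (φ.symm (Φ x).1) ∈ ψ.source := by rw [e]; exact hψx
    have h3 : ContMDiffAt 𝓘(ℝ, PullSpace b c k) (𝓡 b) ∞
        (fun y : PullSpace b c k ↦ ψ (p (φ.symm y.1))) (Φ x) :=
      (contMDiffAt_extChart hmem).comp (Φ x) (f := fun y : PullSpace b c k ↦ p (φ.symm y.1)) h2
    have h4 : ContMDiffAt 𝓘(ℝ, PullSpace b c k)
        𝓘(ℝ, EuclideanSpace ℝ (Fin b) × (EuclideanSpace ℝ (Fin b) →L[ℝ] (Fin k → ℝ))) ∞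
        (fun y : PullSpace b c k ↦ (ψ (p (φ.symm y.1)), y.2)) (Φ x) :=
      h3.prodMk_space (contDiff_snd.contMDiff _)
    refine ((contMDiffAt_covParam (ψ.map_source hmem)).comp (Φ x) h4).congr_of_eventuallyEq ?_
    filter_upwards [h2.continuousAt.eventually_mem
      ((isOpen_extChartAt_source (I := 𝓡 b) (p x.proj)).mem_nhds hmem)] with y hy
    have e2 : ψ.symm (ψ (p (φ.symm y.1))) = p (φ.symm y.1) := ψ.left_inv hy
    refine vcov_ext e2.symm ?_
    change y.2.comp (tder (𝓡 b) (𝓡 b) ψ (p (φ.symm y.1))) =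
      y.2.comp (tder (𝓡 b) (𝓡 b) ψ (ψ.symm (ψ (p (φ.symm y.1)))))
    rw [e2]
  have hΦd : MDifferentiableAt (pullModel b c k) 𝓘(ℝ, PullSpace b c k) Φ x := by
    exact (((contMDiffAt_extChart hφx).comp x (contMDiff_pr₁ x)).prodMk_space
      (contMDiffAt_pullCoord x)).mdifferentiableAt (by simp)
  have hid : ∀ᶠ y in 𝓝 x, g (Φ y) = y := by
    have h2 : ContinuousAt (fun y : PullCov k p ↦ p (pr₁ p y)) x :=
      (p.contMDiff.continuous.comp contMDiff_pr₁.continuous).continuousAt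
    filter_upwards [contMDiff_pr₁.continuous.continuousAt.eventually_mem
      ((isOpen_extChartAt_source (I := 𝓡 c) x.proj).mem_nhds hφx), h2.eventually_mem
      ((isOpen_extChartAt_source (I := 𝓡 b) (p x.proj)).mem_nhds hψx)] with y hy hy'
    have e1 : φ.symm (φ (pr₁ p y)) = pr₁ p y := φ.left_inv hy
    refine pullCov_ext e1 (vcov_ext (congrArg p e1) ?_)
    change (covCoord (p x.proj) (pr₂ p y)).comp (tder (𝓡 b) (𝓡 b) ψ
      (p (φ.symm (φ (pr₁ p y))))) = cov (pr₂ p y)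
    rw [e1, covCoord, ContinuousLinearMap.comp_assoc]
    refine (congrArg _ (tder_extChart_symm_comp (𝓡 b) hy')).trans ?_
    rw [ContinuousLinearMap.comp_id]
  have hcomp : ∀ X : PullSpace b c k,
      tder 𝓘(ℝ, PullSpace b c k) (pullModel b c k) g (Φ x)
        (tder (𝓡 c) (𝓡 c) φ x.proj (U X), Δ X) = X := by
    intro X
    have h1 : tder (pullModel b c k) 𝓘(ℝ, PullSpace b c k) Φ x =
        (tder (pullModel b c k) (𝓡 c) (fun y ↦ φ (pr₁ p y)) x).prod Δ := by
      rw [modelWithCornersSelf_prod, ← chartedSpaceSelf_prod]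
      exact tder_prodMk hφd hΔd
    have h2 : tder (pullModel b c k) (𝓡 c) (fun y ↦ φ (pr₁ p y)) x X =
        tder (𝓡 c) (𝓡 c) φ x.proj (U X) :=
      tder_comp_apply_of_eq rfl (mdifferentiableAt_extChart (𝓡 c) hφx)
        (contMDiff_pr₁.mdifferentiable (by simp) x) X
    have h3 : (tder (𝓡 c) (𝓡 c) φ x.proj (U X), Δ X) =
        tder (pullModel b c k) 𝓘(ℝ, PullSpace b c k) Φ x X := by
      rw [h1, ← h2]; rfl
    rw [h3, ← tder_comp_apply_of_eq (f := Φ) rfl (hg.mdifferentiableAt (by simp)) hΦd]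
    have h4 : tder (pullModel b c k) (pullModel b c k) (fun y ↦ g (Φ y)) x =
        tder (pullModel b c k) (pullModel b c k) (fun y ↦ y) x := tder_congr hid
    rw [h4, tder_id]; rfl
  intro X Y hXY
  have h1 : U X = U Y := congrArg Prod.fst hXY
  have h2 : Δ X = Δ Y := congrArg Prod.snd hXY
  rw [← hcomp X, ← hcomp Y, h1, h2]

/-- The magnetic forms in the coordinates of `bijective_tder_pullCov`. -/
theorem formAt_magneticForm (β : Fin k → DForm (𝓡 c) C 2) (a : Fin k) (x : PullCov k p)
    (X Y : PullSpace b c k) :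
    formAt (pullModel b c k) (magneticForm p β a) x ![X, Y] =
      tder (pullModel b c k) 𝓘(ℝ, EuclideanSpace ℝ (Fin b) →L[ℝ] (Fin k → ℝ))
        (pullCoord (p x.proj)) x Y (tder (𝓡 b) (𝓡 b) (extChartAt (𝓡 b) (p x.proj)) (p x.proj)
          (tder (𝓡 c) (𝓡 b) p x.proj (tder (pullModel b c k) (𝓡 c) (pr₁ p) x X))) a -
      tder (pullModel b c k) 𝓘(ℝ, EuclideanSpace ℝ (Fin b) →L[ℝ] (Fin k → ℝ))
        (pullCoord (p x.proj)) x X (tder (𝓡 b) (𝓡 b) (extChartAt (𝓡 b) (p x.proj)) (p x.proj)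
          (tder (𝓡 c) (𝓡 b) p x.proj (tder (pullModel b c k) (𝓡 c) (pr₁ p) x Y))) a -
      formAt (𝓡 c) (β a) x.proj ![tder (pullModel b c k) (𝓡 c) (pr₁ p) x X,
        tder (pullModel b c k) (𝓡 c) (pr₁ p) x Y] := by
  -- `P` selects the `a`-th component of the fibre coordinate
  let P : (EuclideanSpace ℝ (Fin b) →L[ℝ] (Fin k → ℝ)) →L[ℝ]
      (EuclideanSpace ℝ (Fin b) →L[ℝ] ℝ) :=
    ContinuousLinearMap.compL ℝ (EuclideanSpace ℝ (Fin b)) (Fin k → ℝ) ℝ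
      (ContinuousLinearMap.proj (R := ℝ) (φ := fun _ : Fin k ↦ ℝ) a)
  let ψ := extChartAt (𝓡 b) (p x.proj)
  have hψx : p x.proj ∈ ψ.source := mem_extChartAt_source (p x.proj)
  let f : PullCov k p → Cot (EuclideanSpace ℝ (Fin b)) B := fun y ↦ covProj a (pr₂ p y)
  have hf : ContMDiff (pullModel b c k) (cotModel (EuclideanSpace ℝ (Fin b))) ∞ f :=
    (contMDiff_covProj a).comp contMDiff_pr₂
  have hfd := hf.mdifferentiable (by simp) x
  have hz : (f x).proj ∈ ψ.source := hψx
  have h1 : ∀ X : PullSpace b c k, tder (cotModel (EuclideanSpace ℝ (Fin b)))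
      𝓘(ℝ, EuclideanSpace ℝ (Fin b) →L[ℝ] ℝ) (covCoord (V := ℝ) (p x.proj)) (f x)
      (tder (pullModel b c k) (cotModel (EuclideanSpace ℝ (Fin b))) f x X) =
      P (tder (pullModel b c k) 𝓘(ℝ, EuclideanSpace ℝ (Fin b) →L[ℝ] (Fin k → ℝ))
        (pullCoord (p x.proj)) x X) := by
    intro X
    rw [← tder_comp_apply_of_eq (f := f) rfl
      ((contMDiffAt_covCoord hz).mdifferentiableAt (by simp)) hfd,
      ← tder_clm P (pullCoord (p x.proj) x)]
    exact tder_comp_apply_of_eq (g := P) (f := pullCoord (p x.proj)) rfl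
      (P.contMDiff.mdifferentiable (n := ∞) (by simp) _)
      ((contMDiffAt_pullCoord x).mdifferentiableAt (by simp)) X
  have h2 : ∀ X : PullSpace b c k, tder (cotModel (EuclideanSpace ℝ (Fin b))) (𝓡 b)
      (fun z : Cot (EuclideanSpace ℝ (Fin b)) B ↦ ψ z.proj) (f x)
        (tder (pullModel b c k) (cotModel (EuclideanSpace ℝ (Fin b))) f x X) =
      tder (𝓡 b) (𝓡 b) ψ (p x.proj)
          (tder (𝓡 c) (𝓡 b) p x.proj (tder (pullModel b c k) (𝓡 c) (pr₁ p) x X)) := by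
    intro X
    rw [← tder_comp_apply_of_eq (f := f)
      (g := fun z : Cot (EuclideanSpace ℝ (Fin b)) B ↦ ψ z.proj) rfl
      (((contMDiffAt_extChart hz).comp (f x)
      (contMDiff_vcov_proj (f x))).mdifferentiableAt (by simp)) hfd]
    have h3 := tder_comp_apply_of_eq (g := p) (f := pr₁ (k := k) p) rfl
      (p.contMDiff.mdifferentiable (by simp) x.proj) (contMDiff_pr₁.mdifferentiable (by simp) x) X
    refine Eq.trans ?_ (congrArg (tder (𝓡 b) (𝓡 b) ψ (p x.proj)) h3)
    exact tder_comp_apply_of_eq (g := ψ) (f := fun y : PullCov k p ↦ p (pr₁ p y)) rfl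
      (mdifferentiableAt_extChart (𝓡 b) hψx)
      ((p.contMDiff.comp contMDiff_pr₁).mdifferentiable (by simp) x) X
  have h4 := formAt_canForm hz (tder (pullModel b c k) (cotModel (EuclideanSpace ℝ (Fin b))) f x X)
    (tder (pullModel b c k) (cotModel (EuclideanSpace ℝ (Fin b))) f x Y)
  rw [h1, h1] at h4
  have h5 : formAt (pullModel b c k) (magneticForm p β a) x ![X, Y] =
      formAt (pullModel b c k) (pullback (pullModel b c k)
        (cotModel (EuclideanSpace ℝ (Fin b))) f (canForm _ B)) x ![X, Y] -
      formAt (pullModel b c k) (pullback (pullModel b c k) (𝓡 c) (pr₁ p) (β a)) x ![X, Y] := rfl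
  rw [h5, formAt_pullback_two, formAt_pullback_two, h4, h2, h2]
  rfl

end Magnetic

/-! ### Nondegeneracy of the magnetic forms -/

section Nondegenerate

variable {b c k : ℕ} {B : Type*} [TopologicalSpace B] [ChartedSpace (EuclideanSpace ℝ (Fin b)) B]
  [IsManifold (𝓡 b) ∞ B] {C : Type*} [TopologicalSpace C]
  [ChartedSpace (EuclideanSpace ℝ (Fin c)) C] [IsManifold (𝓡 c) ∞ C]
  {p : C^∞⟮𝓡 c, C; 𝓡 b, B⟯}

attribute [local instance] topologicalSpacePullCov chartedSpacePullCov isManifold_pullCov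

/-- The magnetic forms have no common kernel as soon as the forms `β a` have no common kernel on
the vertical spaces of `p`. -/
theorem magneticForm_nondegenerate (hk : 1 ≤ k) {β : Fin k → DForm (𝓡 c) C 2}
    (hp : ∀ y, Surjective (tder (𝓡 c) (𝓡 b) p y))
    (hβ : ∀ (y : C) (u : EuclideanSpace ℝ (Fin c)), tder (𝓡 c) (𝓡 b) p y u = 0 →
      (∀ (a : Fin k) (u' : EuclideanSpace ℝ (Fin c)), tder (𝓡 c) (𝓡 b) p y u' = 0 →
        formAt (𝓡 c) (β a) y ![u, u'] = 0) → u = 0)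
    (x : PullCov k p) (X : PullSpace b c k)
    (hX : ∀ (a : Fin k) (Y : PullSpace b c k),
      formAt (pullModel b c k) (magneticForm p β a) x ![X, Y] = 0) : X = 0 := by
  let U := tder (pullModel b c k) (𝓡 c) (pr₁ (k := k) p) x
  let Δ := tder (pullModel b c k) 𝓘(ℝ, EuclideanSpace ℝ (Fin b) →L[ℝ] (Fin k → ℝ))
    (pullCoord (p x.proj)) x
  let D : EuclideanSpace ℝ (Fin c) →L[ℝ] EuclideanSpace ℝ (Fin b) :=
    (tder (𝓡 b) (𝓡 b) (extChartAt (𝓡 b) (p x.proj)) (p x.proj)).comp (tder (𝓡 c) (𝓡 b) p x.proj)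
  have hbij : Bijective (U.prod Δ) := bijective_tder_pullCov x
  have hchart := tder_extChart_symm_comp (𝓡 b) (mem_extChartAt_source (I := 𝓡 b) (p x.proj))
  have hDinj : ∀ u, D u = 0 → tder (𝓡 c) (𝓡 b) p x.proj u = 0 := by
    intro u hu
    have h1 := congrArg (fun L : EuclideanSpace ℝ (Fin b) →L[ℝ] EuclideanSpace ℝ (Fin b) ↦
      L (tder (𝓡 c) (𝓡 b) p x.proj u)) hchart
    refine h1.symm.trans ?_
    exact (congrArg (tder (𝓡 b) (𝓡 b) (extChartAt (𝓡 b) (p x.proj)).symm _) hu).trans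
      (map_zero (tder (𝓡 b) (𝓡 b) (extChartAt (𝓡 b) (p x.proj)).symm _))
  have hDsurj : Surjective D := by
    have hchart' := tder_extChart_comp_symm (𝓡 b) (mem_extChartAt_target (I := 𝓡 b) (p x.proj))
    intro w
    obtain ⟨u, hu⟩ := hp x.proj (tder (𝓡 b) (𝓡 b) (extChartAt (𝓡 b) (p x.proj)).symm
      (extChartAt (𝓡 b) (p x.proj) (p x.proj)) w)
    refine ⟨u, ?_⟩
    have h1 := congrArg (fun L : EuclideanSpace ℝ (Fin b) →L[ℝ] EuclideanSpace ℝ (Fin b) ↦ L w)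
      hchart'
    refine (congrArg _ hu).trans ?_
    refine Eq.trans ?_ h1
    exact congrArg (fun L : EuclideanSpace ℝ (Fin b) →L[ℝ] EuclideanSpace ℝ (Fin b) ↦ L _)
      (tder_eq_of_eq _ ((extChartAt (𝓡 b) (p x.proj)).left_inv (mem_extChartAt_source _)).symm)
  -- the hypothesis in coordinates, for an arbitrary second vector `(u, δ)`
  have key : ∀ (a : Fin k) (u : EuclideanSpace ℝ (Fin c))
      (δ : EuclideanSpace ℝ (Fin b) →L[ℝ] (Fin k → ℝ)),
      δ (D (U X)) a - Δ X (D u) a - formAt (𝓡 c) (β a) x.proj ![U X, u] = 0 := by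
    intro a u δ
    obtain ⟨Y, hY⟩ := hbij.2 (u, δ)
    have h1 : U Y = u := congrArg Prod.fst hY
    have h2 : Δ Y = δ := congrArg Prod.snd hY
    rw [← h1, ← h2]
    exact (formAt_magneticForm β a x X Y).symm.trans (hX a Y)
  have hz : ∀ (a : Fin k) (v : EuclideanSpace ℝ (Fin c)), v = 0 → ∀ w,
      formAt (𝓡 c) (β a) x.proj ![w, v] = 0 ∧ formAt (𝓡 c) (β a) x.proj ![v, w] = 0 := by
    rintro a _ rfl w
    exact ⟨(formAt (𝓡 c) (β a) x.proj).map_coord_zero 1 rfl,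
      (formAt (𝓡 c) (β a) x.proj).map_coord_zero 0 rfl⟩
  -- testing with fibre directions `(0, δ)`; there is one as `1 ≤ k`
  have h1 : D (U X) = 0 := by
    by_contra hne
    obtain ⟨l, hl⟩ := SeparatingDual.exists_ne_zero (R := ℝ) hne
    have h2 := key ⟨0, hk⟩ 0 (ContinuousLinearMap.pi fun _ ↦ l)
    rw [(hz _ _ rfl _).1, map_zero, map_zero] at h2
    refine hl ?_
    simpa using h2
  -- testing with directions vertical for `p`
  have h2 : U X = 0 := by
    refine hβ x.proj (U X) (hDinj _ h1) fun a u' hu' ↦ ?_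
    have h3 := key a u' 0
    have h4 : D u' = 0 :=
      (congrArg (tder (𝓡 b) (𝓡 b) (extChartAt (𝓡 b) (p x.proj)) (p x.proj)) hu').trans
        (map_zero (tder (𝓡 b) (𝓡 b) (extChartAt (𝓡 b) (p x.proj)) (p x.proj)))
    rw [h4, map_zero] at h3
    simpa using h3
  -- testing with all remaining directions
  have h3 : Δ X = 0 := by
    refine ContinuousLinearMap.ext fun w ↦ funext fun a ↦ ?_
    obtain ⟨u, rfl⟩ := hDsurj w
    have h4 := key a u 0
    rw [(hz a _ h2 _).2] at h4
    simpa using h4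
  exact hbij.1 (Prod.ext (h2.trans (map_zero U).symm) (h3.trans (map_zero Δ).symm))

end Nondegenerate

/-! ### The momentum map -/

section Momentum

variable {EG : Type*} [NormedAddCommGroup EG] [NormedSpace ℝ EG]
  {G : Type*} [TopologicalSpace G] [ChartedSpace EG G] [Group G]
  [LieGroup 𝓘(ℝ, EG) ∞ G]
  {E : Type*} [NormedAddCommGroup E] [NormedSpace ℝ E] [FiniteDimensional ℝ E]
  {Q : Type*} [TopologicalSpace Q] [ChartedSpace E Q] [IsManifold 𝓘(ℝ, E) ∞ Q]
  [MulAction G Q] [ContMDiffSMul 𝓘(ℝ, EG) 𝓘(ℝ, E) ∞ G Q] {k : ℕ}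

variable (EG G E Q k) in
theorem contMDiff_momentum :
    ContMDiff (M' := Fin k → (EG →L[ℝ] ℝ)) (covModel E k) 𝓘(ℝ, Fin k → (EG →L[ℝ] ℝ)) ∞
    (fun x : Cov E Q k ↦ momentum EG G x) := by
  have : IsManifold 𝓘(ℝ, EG) 1 G := .of_le (n := ∞) (by simp)
  have : IsManifold 𝓘(ℝ, E) 1 Q := .of_le (n := ∞) (by simp)
  intro z₀
  let q₀ := z₀.proj
  let ψ := extChartAt 𝓘(ℝ, E) q₀
  have hq₀ : z₀.proj ∈ ψ.source := mem_extChartAt_source q₀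
  have hact : ContMDiff ((covModel E k).prod 𝓘(ℝ, EG)) 𝓘(ℝ, E) ∞
      (uncurry fun (z : Cov E Q k) (g : G) ↦ g • z.proj) :=
    contMDiff_snd.smul (contMDiff_vcov_proj.comp contMDiff_fst)
  have h := ContMDiffAt.mfderiv (m := ∞) (n := ∞) (fun (z : Cov E Q k) (g : G) ↦ g • z.proj)
    (fun _ ↦ (1 : G)) (hact (z₀, 1)) contMDiffAt_const le_rfl
  -- the infinitesimal action is smooth in the chart `ψ`, which cancels in the pairing with covectors
  have h1 : ContMDiffAt (covModel E k) 𝓘(ℝ, EG →L[ℝ] E) ∞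
      (fun z : Cov E Q k ↦ (tder 𝓘(ℝ, E) 𝓘(ℝ, E) ψ z.proj).comp
        (tder 𝓘(ℝ, EG) 𝓘(ℝ, E) (fun g : G ↦ g • z.proj) 1)) z₀ := by
    refine h.congr_of_eventuallyEq ?_
    filter_upwards [(isOpen_proj_preimage q₀).mem_nhds hq₀] with z hz
    symm
    refine (inTangentCoordinates_eq (I := 𝓘(ℝ, EG)) (I' := 𝓘(ℝ, E)) (fun _ : Cov E Q k ↦ (1 : G))
      (fun z ↦ (1 : G) • z.proj)
      (fun z ↦ tder 𝓘(ℝ, EG) 𝓘(ℝ, E) (fun g : G ↦ g • z.proj) 1) (x₀ := z₀) (x := z)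
      (mem_chart_source _ _) ?_).trans ?_
    · simpa only [one_smul, ψ, extChartAt_source] using hz
    simp only [one_smul]
    have h3 : (tangentBundleCore 𝓘(ℝ, E) Q).coordChange (achart E z.proj) (achart E z₀.proj) z.proj =
        tder 𝓘(ℝ, E) 𝓘(ℝ, E) ψ z.proj := by
      have hz' : z.proj ∈ (chartAt E q₀).source := by
        simpa only [ψ, extChartAt_source] using hz
      exact (TangentBundle.continuousLinearMapAt_trivializationAt_eq_core
        (I := 𝓘(ℝ, E)) hz').symm.trans
        (TangentBundle.continuousLinearMapAt_trivializationAt (I := 𝓘(ℝ, E)) hz')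
    ext v
    change (tangentBundleCore 𝓘(ℝ, E) Q).coordChange _ _ _
      (tder 𝓘(ℝ, EG) 𝓘(ℝ, E) (fun g : G ↦ g • z.proj) 1
        ((tangentBundleCore 𝓘(ℝ, EG) G).coordChange (achart EG 1) (achart EG 1) 1 v)) = _
    rw [(tangentBundleCore 𝓘(ℝ, EG) G).coordChange_self _ _ (mem_chart_source _ _), h3]
    rfl
  have h2 : ContMDiffAt (covModel E k) 𝓘(ℝ, EG →L[ℝ] (Fin k → ℝ)) ∞
      (fun z : Cov E Q k ↦ (cov z).comp (tder 𝓘(ℝ, EG) 𝓘(ℝ, E) (fun g : G ↦ g • z.proj) 1)) z₀ := by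
    refine ((contMDiffAt_covCoord hq₀).clm_comp h1).congr_of_eventuallyEq ?_
    filter_upwards [(isOpen_proj_preimage q₀).mem_nhds hq₀] with z hz
    rw [covCoord, ContinuousLinearMap.comp_assoc, ← ContinuousLinearMap.comp_assoc _ _
      (tder 𝓘(ℝ, EG) 𝓘(ℝ, E) _ 1), tder_extChart_symm_comp 𝓘(ℝ, E) hz,
      ContinuousLinearMap.id_comp]
  refine contMDiffAt_pi_space.2 fun a ↦ ?_
  exact (ContinuousLinearMap.compL ℝ EG (Fin k → ℝ) ℝ
    (ContinuousLinearMap.proj (R := ℝ) (φ := fun _ : Fin k ↦ ℝ) a)).contMDiff.contMDiffAt.comp z₀ h2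

end Momentum

/-! ### The connection form paired with the momentum -/

section Connection

variable {EG : Type*} [NormedAddCommGroup EG] [NormedSpace ℝ EG]
  {G : Type*} [TopologicalSpace G] [ChartedSpace EG G] [Group G] [LieGroup 𝓘(ℝ, EG) ∞ G]
  {E : Type*} [NormedAddCommGroup E] [NormedSpace ℝ E]
  {Q : Type*} [TopologicalSpace Q] [ChartedSpace E Q] [IsManifold 𝓘(ℝ, E) ∞ Q]
  [MulAction G Q] [ContMDiffSMul 𝓘(ℝ, EG) 𝓘(ℝ, E) ∞ G Q] {k : ℕ}

/-- The `k`-tuple `μ` of covectors, as a linear map into `ℝ^k`. -/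
def momentumPairing (μ : Fin k → LieDual EG G) : EG →L[ℝ] (Fin k → ℝ) :=
  ContinuousLinearMap.pi fun a ↦ (μ a : EG →L[ℝ] ℝ)

/-- The `k`-tuple of covectors `(𝒜_{μ_1}, …, 𝒜_{μ_k})` at `q`, as a linear map into `ℝ^k`. -/
def connCov (μ : Fin k → LieDual EG G) (A : PrincipalConnection EG G E Q) (q : Q) :
    E →L[ℝ] (Fin k → ℝ) :=
  (momentumPairing μ).comp (A.form q : E →L[ℝ] EG)

theorem contMDiff_connCov [FiniteDimensional ℝ E] (μ : Fin k → LieDual EG G)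
    (A : PrincipalConnection EG G E Q) :
    ContMDiff 𝓘(ℝ, E) (covModel E k) ∞ (fun q ↦ (mkCov q (connCov μ A q) : Cov E Q k)) :=
  contMDiff_mkCov ((momentumPairing μ).contMDiff.comp A.smooth)

theorem mem_level_iff (μ : Fin k → LieDual EG G) (x : Cov E Q k) :
    x ∈ level E Q μ ↔
      (cov x).comp (tder 𝓘(ℝ, EG) 𝓘(ℝ, E) (fun g : G ↦ g • x.proj) 1) = momentumPairing μ := by
  constructor
  · intro h
    have h' : momentum EG G x = μ := h
    refine ContinuousLinearMap.ext fun ξ ↦ funext fun a ↦ ?_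
    exact congrArg (fun L : EG →L[ℝ] ℝ ↦ L ξ) (congrFun h' a)
  · intro h
    refine funext fun a ↦ ContinuousLinearMap.ext fun ξ ↦ ?_
    exact congrFun (congrArg (fun L : EG →L[ℝ] (Fin k → ℝ) ↦ L ξ) h) a

theorem connCov_comp_infGen (μ : Fin k → LieDual EG G) (A : PrincipalConnection EG G E Q) (q : Q) :
    (connCov μ A q).comp (tder 𝓘(ℝ, EG) 𝓘(ℝ, E) (fun g : G ↦ g • q) 1) = momentumPairing μ :=
  ContinuousLinearMap.ext fun ξ ↦ congrArg (momentumPairing μ) (A.apply_infGen q ξ)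

/-- The infinitesimal action is injective, because it has the connection form as a left inverse. -/
theorem PrincipalConnection.injective_infGen (A : PrincipalConnection EG G E Q) (q : Q) :
    Injective (mfderiv 𝓘(ℝ, EG) 𝓘(ℝ, E) (fun g : G ↦ g • q) 1) := fun ξ η h ↦
  (A.apply_infGen q ξ).symm.trans ((congrArg (A.form q) h).trans (A.apply_infGen q η))

/-- The covectors `𝒜_μ` are equivariant under `G_μ`. -/
theorem connCov_smul (μ : Fin k → LieDual EG G) (A : PrincipalConnection EG G E Q) {g : G}
    (hg : g ∈ isotropy μ) (q : Q) :
    connCov μ A (g • q) =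
      (connCov μ A q).comp (tder 𝓘(ℝ, E) 𝓘(ℝ, E) (fun y : Q ↦ g⁻¹ • y) (g • q)) := by
  have hA : ∀ q', q' = q → (A.form q' : E →L[ℝ] EG) = A.form q := by rintro _ rfl; rfl
  refine ContinuousLinearMap.ext fun v ↦ funext fun a ↦ ?_
  have h1 := A.equivariant g⁻¹ (g • q) v
  have h2 : A.form q (tder 𝓘(ℝ, E) 𝓘(ℝ, E) (fun y : Q ↦ g⁻¹ • y) (g • q) v) =
      Ad EG g⁻¹ (A.form (g • q) v) :=
    (congrArg (fun L : E →L[ℝ] EG ↦ L (tder 𝓘(ℝ, E) 𝓘(ℝ, E) (fun y : Q ↦ g⁻¹ • y) (g • q) v))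
      (hA _ (inv_smul_smul g q))).symm.trans h1
  have h3 : (μ a).comp (Ad EG g⁻¹) = μ a := hg a
  have h4 : μ a (Ad EG g⁻¹ (A.form (g • q) v)) = μ a (A.form (g • q) v) :=
    congrArg (fun L : EG →L[ℝ] ℝ ↦ L (A.form (g • q) v)) h3
  exact h4.symm.trans (congrArg (μ a) h2.symm)

end Connection

/-! ### The momentum shift -/

section Shift

variable {EG : Type*} [NormedAddCommGroup EG] [NormedSpace ℝ EG] [FiniteDimensional ℝ EG]
  {G : Type*} [TopologicalSpace G] [ChartedSpace EG G] [Group G] [LieGroup 𝓘(ℝ, EG) ∞ G]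
  {E : Type*} [NormedAddCommGroup E] [NormedSpace ℝ E] [FiniteDimensional ℝ E]
  {Q : Type*} [TopologicalSpace Q] [ChartedSpace E Q] [IsManifold 𝓘(ℝ, E) ∞ Q]
  [MulAction G Q] [ContMDiffSMul 𝓘(ℝ, EG) 𝓘(ℝ, E) ∞ G Q] {k : ℕ}
  {b c : ℕ} {B : Type*} [TopologicalSpace B] [ChartedSpace (EuclideanSpace ℝ (Fin b)) B]
  [IsManifold (𝓡 b) ∞ B] {C : Type*} [TopologicalSpace C]
  [ChartedSpace (EuclideanSpace ℝ (Fin c)) C] [IsManifold (𝓡 c) ∞ C]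

attribute [local instance] topologicalSpacePullCov chartedSpacePullCov isManifold_pullCov

/-- The maps `ρ : Q → B` and `ϖ : Q → C` are submersions whose fibres are the orbits of `G` and of
`G_μ`, the map `ϖ` is surjective, and `p : C → B` is the induced map. Being a submersion is
expressed by local sections. -/
structure IsOrbitDiagram (μ : Fin k → LieDual EG G) (ρ : Q → B) (ϖ : Q → C)
    (p : C^∞⟮𝓡 c, C; 𝓡 b, B⟯) : Prop where
  contMDiff_left : ContMDiff 𝓘(ℝ, E) (𝓡 b) ∞ ρ
  sections_left : HasLocalSections 𝓘(ℝ, E) (𝓡 b) ρ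
  left_eq_iff : ∀ q q', ρ q = ρ q' ↔ ∃ g : G, g • q = q'
  contMDiff_right : ContMDiff 𝓘(ℝ, E) (𝓡 c) ∞ ϖ
  sections_right : HasLocalSections 𝓘(ℝ, E) (𝓡 c) ϖ
  surjective_right : Surjective ϖ
  right_eq_iff : ∀ q q', ϖ q = ϖ q' ↔ ∃ g ∈ isotropy μ, g • q = q'
  map_right : ∀ q, p (ϖ q) = ρ q

variable {μ : Fin k → LieDual EG G} {ρ : Q → B} {ϖ : Q → C} {p : C^∞⟮𝓡 c, C; 𝓡 b, B⟯}

theorem IsOrbitDiagram.surjective_tder_left (h : IsOrbitDiagram (E := E) μ ρ ϖ p) (q : Q) :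
    Surjective (tder 𝓘(ℝ, E) (𝓡 b) ρ q) := h.sections_left.surjective_mfderiv h.contMDiff_left q

theorem IsOrbitDiagram.surjective_tder_right (h : IsOrbitDiagram (E := E) μ ρ ϖ p) (q : Q) :
    Surjective (tder 𝓘(ℝ, E) (𝓡 c) ϖ q) := h.sections_right.surjective_mfderiv h.contMDiff_right q

theorem IsOrbitDiagram.tder_left_comp_infGen (h : IsOrbitDiagram (E := E) μ ρ ϖ p) (q : Q) :
    (tder 𝓘(ℝ, E) (𝓡 b) ρ q).comp (tder 𝓘(ℝ, EG) 𝓘(ℝ, E) (fun g : G ↦ g • q) 1) = 0 := by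
  rw [← tder_comp_of_eq (g := ρ) (f := fun g : G ↦ g • q) (one_smul G q)
    (h.contMDiff_left.mdifferentiable (by simp) q)
    (((contMDiff_id (I := 𝓘(ℝ, EG))).smul (contMDiff_const (c := q))).mdifferentiable
      (n := ∞) (by simp) 1)]
  have h1 : (fun g : G ↦ ρ (g • q)) = fun _ ↦ ρ q :=
    funext fun g ↦ ((h.left_eq_iff q (g • q)).2 ⟨g, rfl⟩).symm
  rw [h1, tder_const]

theorem IsOrbitDiagram.tder_left_smul (h : IsOrbitDiagram (E := E) μ ρ ϖ p) (g : G) (q : Q) :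
    tder 𝓘(ℝ, E) (𝓡 b) ρ (g • q) = (tder 𝓘(ℝ, E) (𝓡 b) ρ q).comp
      (tder 𝓘(ℝ, E) 𝓘(ℝ, E) (fun y : Q ↦ g⁻¹ • y) (g • q)) := by
  rw [← tder_comp_of_eq (g := ρ) (f := fun y : Q ↦ g⁻¹ • y) (inv_smul_smul g q)
    (h.contMDiff_left.mdifferentiable (by simp) q)
    ((contMDiff_act EG g⁻¹).mdifferentiable (by simp) _)]
  exact congrArg (fun f : Q → B ↦ tder 𝓘(ℝ, E) (𝓡 b) f (g • q))
    (funext fun y ↦ (h.left_eq_iff y (g⁻¹ • y)).2 ⟨g⁻¹, rfl⟩)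

theorem IsOrbitDiagram.tder_left_eq_comp (h : IsOrbitDiagram (E := E) μ ρ ϖ p) (q : Q) (v : E) :
    tder 𝓘(ℝ, E) (𝓡 b) ρ q v = tder (𝓡 c) (𝓡 b) p (ϖ q) (tder 𝓘(ℝ, E) (𝓡 c) ϖ q v) := by
  rw [← tder_comp_apply_of_eq (g := p) (f := ϖ) rfl (p.contMDiff.mdifferentiable (by simp) _)
    (h.contMDiff_right.mdifferentiable (by simp) _)]
  exact congrArg (fun f : Q → B ↦ tder 𝓘(ℝ, E) (𝓡 b) f q v) (funext fun y ↦ (h.map_right y).symm)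

/-- Vectors that are vertical for `ρ` are values of infinitesimal generators. -/
theorem IsOrbitDiagram.exists_infGen [T2Space Q] [ProperSMul G Q]
    (h : IsOrbitDiagram (E := E) μ ρ ϖ p) (hfree : ∀ (g : G) (q : Q), g • q = q → g = 1)
    (A : PrincipalConnection EG G E Q) {q : Q} {v : E} (hv : tder 𝓘(ℝ, E) (𝓡 b) ρ q v = 0) :
    ∃ ξ : EG, tder 𝓘(ℝ, EG) 𝓘(ℝ, E) (fun g : G ↦ g • q) 1 ξ = v := by
  obtain ⟨ξ, -, hξ⟩ := exists_infGen_eq_of_tder_eq_zero hfree A.injective_infGen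
    (F := fun _ : G ↦ (0 : ℝ)) contMDiff_const (fun _ ↦ ⟨.refl ℝ ℝ, fun _ ↦ rfl⟩)
    h.contMDiff_left h.sections_left (fun q q' hq ↦ by
      obtain ⟨g, hg⟩ := (h.left_eq_iff q q').1 hq
      exact ⟨g, rfl, hg⟩) hv
  exact ⟨ξ, hξ⟩

/-- `T` is the momentum shift: it sends `(q, α)` to `(ϖ q, γ)` with `γ ∘ dρ = α - 𝒜_μ`. -/
structure IsMomentumShift (A : PrincipalConnection EG G E Q) (ρ : Q → B) (ϖ : Q → C)
    (p : C^∞⟮𝓡 c, C; 𝓡 b, B⟯) (T : level E Q μ → PullCov k p) : Prop where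
  pr₁_eq : ∀ x, pr₁ p (T x) = ϖ x.1.proj
  pr₂_comp : ∀ x : level E Q μ, (cov (pr₂ p (T x))).comp (tder 𝓘(ℝ, E) (𝓡 b) ρ x.1.proj) =
    cov x.1 - connCov μ A x.1.proj

/-- The covectors `α` and `𝒜_μ` agree on the tangent space of the `G`-orbit, so that `α - 𝒜_μ`
factors through `dρ`. -/
theorem exists_isMomentumShift [T2Space Q] [ProperSMul G Q]
    (h : IsOrbitDiagram (E := E) μ ρ ϖ p) (hfree : ∀ (g : G) (q : Q), g • q = q → g = 1)
    (A : PrincipalConnection EG G E Q) :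
    ∃ T : level E Q μ → PullCov k p, IsMomentumShift A ρ ϖ p T := by
  have key : ∀ x : level E Q μ, ∃ γ : EuclideanSpace ℝ (Fin b) →L[ℝ] (Fin k → ℝ),
      γ.comp (tder 𝓘(ℝ, E) (𝓡 b) ρ x.1.proj) = cov x.1 - connCov μ A x.1.proj := by
    intro x
    obtain ⟨R, hR⟩ := ContinuousLinearMap.exists_rightInverse_of_surjective
      (tder 𝓘(ℝ, E) (𝓡 b) ρ x.1.proj) (LinearMap.range_eq_top.2 (h.surjective_tder_left x.1.proj))
    refine ⟨(cov x.1 - connCov μ A x.1.proj).comp R, ContinuousLinearMap.ext fun v ↦ ?_⟩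
    -- `R` picks a lift of each vector; two lifts differ by a vector tangent to the orbit
    have h1 : tder 𝓘(ℝ, E) (𝓡 b) ρ x.1.proj (R (tder 𝓘(ℝ, E) (𝓡 b) ρ x.1.proj v) - v) = 0 := by
      rw [map_sub, sub_eq_zero]
      exact congrArg (fun L : EuclideanSpace ℝ (Fin b) →L[ℝ] EuclideanSpace ℝ (Fin b) ↦
        L (tder 𝓘(ℝ, E) (𝓡 b) ρ x.1.proj v)) hR
    obtain ⟨ξ, hξ⟩ := h.exists_infGen hfree A h1
    have h2 := congrArg (fun L : EG →L[ℝ] (Fin k → ℝ) ↦ L ξ) (((mem_level_iff μ x.1).1 x.2).trans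
      (connCov_comp_infGen μ A x.1.proj).symm)
    have h3 : cov x.1 (R (tder 𝓘(ℝ, E) (𝓡 b) ρ x.1.proj v) - v) =
        connCov μ A x.1.proj (R (tder 𝓘(ℝ, E) (𝓡 b) ρ x.1.proj v) - v) := by
      rw [← hξ]; exact h2
    rw [map_sub, map_sub] at h3
    change cov x.1 (R (tder 𝓘(ℝ, E) (𝓡 b) ρ x.1.proj v)) -
      connCov μ A x.1.proj (R (tder 𝓘(ℝ, E) (𝓡 b) ρ x.1.proj v)) =
      cov x.1 v - connCov μ A x.1.proj v
    rw [sub_eq_sub_iff_sub_eq_sub, h3]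
  choose γ hγ using key
  exact ⟨fun x ↦ mkPull p (ϖ x.1.proj) (γ x), fun _ ↦ rfl, hγ⟩

/-- The covector `γ ∘ dρ + 𝒜_μ` at `q`. If `ϖ q` is the base point of `y = (ϖ q, γ)`, this is the
point over `q` that the momentum shift sends to `y`. -/
def unshift (A : PrincipalConnection EG G E Q) (μ : Fin k → LieDual EG G) (ρ : Q → B)
    (p : C^∞⟮𝓡 c, C; 𝓡 b, B⟯) (q : Q) (y : PullCov k p) : Cov E Q k :=
  mkCov q ((cov (pr₂ p y)).comp (tder 𝓘(ℝ, E) (𝓡 b) ρ q) + connCov μ A q)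

theorem unshift_mem_level (h : IsOrbitDiagram (E := E) μ ρ ϖ p) (A : PrincipalConnection EG G E Q)
    (q : Q) (y : PullCov k p) : unshift A μ ρ p q y ∈ level E Q μ := by
  rw [mem_level_iff]
  change ((cov (pr₂ p y)).comp (tder 𝓘(ℝ, E) (𝓡 b) ρ q) + connCov μ A q).comp
    (tder 𝓘(ℝ, EG) 𝓘(ℝ, E) (fun g : G ↦ g • q) 1) = _
  rw [ContinuousLinearMap.add_comp, ContinuousLinearMap.comp_assoc, h.tder_left_comp_infGen,
    ContinuousLinearMap.comp_zero, zero_add, connCov_comp_infGen]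

section Properties

variable {A : PrincipalConnection EG G E Q} {T : level E Q μ → PullCov k p}

theorem IsMomentumShift.eq_iff (hT : IsMomentumShift A ρ ϖ p T)
    (h : IsOrbitDiagram (E := E) μ ρ ϖ p) (x : level E Q μ) (y : PullCov k p) :
    T x = y ↔ ϖ x.1.proj = pr₁ p y ∧ x.1 = unshift A μ ρ p x.1.proj y := by
  rw [← hT.pr₁_eq]
  constructor
  · rintro rfl
    refine ⟨rfl, vcov_ext rfl ?_⟩
    change cov x.1 = (cov (pr₂ p (T x))).comp _ + _
    rw [hT.pr₂_comp, sub_add_cancel]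
  · rintro ⟨h1, h2⟩
    refine pullCov_ext h1 (vcov_ext (congrArg p h1) ?_)
    have h3 : cov x.1 = (cov (pr₂ p y)).comp (tder 𝓘(ℝ, E) (𝓡 b) ρ x.1.proj) +
        connCov μ A x.1.proj := congrArg cov h2
    have h4 := hT.pr₂_comp x
    rw [h3, add_sub_cancel_right] at h4
    refine ContinuousLinearMap.ext fun w ↦ ?_
    obtain ⟨v, rfl⟩ := h.surjective_tder_left x.1.proj w
    exact congrArg (fun L : E →L[ℝ] (Fin k → ℝ) ↦ L v) h4

/-- The action of `G_μ` only moves the point `q` of `unshift`, not `γ`. -/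
theorem covSmul_unshift (h : IsOrbitDiagram (E := E) μ ρ ϖ p) {g : G} (hg : g ∈ isotropy μ) (q : Q)
    (y : PullCov k p) : covSmul g (unshift A μ ρ p q y) = unshift A μ ρ p (g • q) y := by
  refine vcov_ext rfl ?_
  change ((cov (pr₂ p y)).comp (tder 𝓘(ℝ, E) (𝓡 b) ρ q) + connCov μ A q).comp
    (tder 𝓘(ℝ, E) 𝓘(ℝ, E) (fun y : Q ↦ g⁻¹ • y) (g • q)) =
    (cov (pr₂ p y)).comp (tder 𝓘(ℝ, E) (𝓡 b) ρ (g • q)) + connCov μ A (g • q)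
  rw [h.tder_left_smul, connCov_smul μ A hg, ContinuousLinearMap.add_comp,
    ContinuousLinearMap.comp_assoc]

/-- The fibres of the momentum shift are the `G_μ`-orbits. -/
theorem IsMomentumShift.apply_eq_iff (hT : IsMomentumShift A ρ ϖ p T)
    (h : IsOrbitDiagram (E := E) μ ρ ϖ p) (x x' : level E Q μ) :
    T x = T x' ↔ levelRel μ x x' := by
  have hx' := (hT.eq_iff h x' (T x')).1 rfl
  constructor
  · intro e
    obtain ⟨h1, h2⟩ := (hT.eq_iff h x (T x')).1 e
    rw [← hx'.1] at h1
    obtain ⟨g, hg, hgx⟩ := (h.right_eq_iff _ _).1 h1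
    refine ⟨g, hg, ?_⟩
    rw [h2, covSmul_unshift h hg, hgx]
    exact hx'.2.symm
  · rintro ⟨g, hg, e⟩
    obtain ⟨h1, h2⟩ := (hT.eq_iff h x (T x)).1 rfl
    have hproj : g • x.1.proj = x'.1.proj := congrArg Bundle.TotalSpace.proj e
    refine ((hT.eq_iff h x' (T x)).2 ⟨?_, ?_⟩).symm
    · rw [← h1, ← hproj]
      exact ((h.right_eq_iff _ _).2 ⟨g, hg, rfl⟩).symm
    · rw [← hproj, ← covSmul_unshift h hg, ← h2, e]

theorem IsMomentumShift.surjective (hT : IsMomentumShift A ρ ϖ p T)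
    (h : IsOrbitDiagram (E := E) μ ρ ϖ p) : Surjective T := fun y ↦ by
  obtain ⟨q, hq⟩ := h.surjective_right (pr₁ p y)
  exact ⟨⟨unshift A μ ρ p q y, unshift_mem_level h A q y⟩, (hT.eq_iff h _ _).2 ⟨hq, rfl⟩⟩

variable {s : ℕ} [ChartedSpace (EuclideanSpace ℝ (Fin s)) (level E Q μ)]

theorem IsMomentumShift.contMDiff (hT : IsMomentumShift A ρ ϖ p T)
    (h : IsOrbitDiagram (E := E) μ ρ ϖ p)
    (hL : IsEmbeddedSubmanifold (covModel E k) (level E Q μ) s) :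
    ContMDiff (𝓡 s) (pullModel b c k) ∞ T := by
  intro x
  have hι : ContMDiff (𝓡 s) (covModel E k) ∞ (Subtype.val : level E Q μ → Cov E Q k) :=
    hL.isSmoothEmbedding.contMDiff
  have hq : ContMDiff (𝓡 s) 𝓘(ℝ, E) ∞ (fun x : level E Q μ ↦ x.1.proj) :=
    contMDiff_vcov_proj.comp hι
  refine contMDiffAt_pullCov_iff.2 ⟨?_, ?_⟩
  · simp only [hT.pr₁_eq]
    exact (h.contMDiff_right.comp hq) x
  · have h1 := contMDiffAt_mkCov_sub (s := fun x : level E Q μ ↦ x.1.proj) (hι x)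
      (((contMDiff_connCov μ A).comp hq) x)
    have h2 := contMDiffAt_mkCov_of_comp_tder (hq x) (h.contMDiff_left _)
      (h.surjective_tder_left _) (γ := fun x ↦ cov (pr₂ p (T x)))
      (by simp only [hT.pr₂_comp]; exact h1)
    refine h2.congr_of_eventuallyEq (Eventually.of_forall fun x ↦ vcov_ext ?_ rfl)
    exact (congrArg p (hT.pr₁_eq x)).trans (h.map_right _)

/-- A local section of `ϖ` gives a local section of the momentum shift, by means of `unshift`. -/
theorem IsMomentumShift.hasLocalSections (hT : IsMomentumShift A ρ ϖ p T)
    (h : IsOrbitDiagram (E := E) μ ρ ϖ p)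
    (hL : IsEmbeddedSubmanifold (covModel E k) (level E Q μ) s) :
    HasLocalSections (𝓡 s) (pullModel b c k) T := by
  intro x
  obtain ⟨V, σ, hV, hxV, hσ, hσx, hϖσ⟩ := h.sections_right x.1.proj
  have hVo : IsOpen (pr₁ (k := k) p ⁻¹' V) := hV.preimage contMDiff_pr₁.continuous
  refine ⟨pr₁ p ⁻¹' V, fun y ↦ ⟨unshift A μ ρ p (σ (pr₁ p y)) y, unshift_mem_level h A _ y⟩, hVo, ?_,
    ?_, ?_, fun y hy ↦ (hT.eq_iff h _ _).2 ⟨hϖσ _ hy, rfl⟩⟩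
  · rw [mem_preimage, hT.pr₁_eq]; exact hxV
  · intro y hy
    refine ContMDiffAt.contMDiffWithinAt ?_
    have hσy : ContMDiffAt (pullModel b c k) 𝓘(ℝ, E) ∞ (fun y : PullCov k p ↦ σ (pr₁ p y)) y :=
      (hσ.contMDiffAt (hV.mem_nhds hy)).comp y (contMDiff_pr₁ y)
    have h1 := contMDiffAt_mkCov_comp_tder (contMDiff_pr₂ y) hσy (h.contMDiff_left _) (by
      filter_upwards [hVo.mem_nhds hy] with z hz
      refine Eq.trans ?_ (h.map_right _)
      exact congrArg p (hϖσ _ hz).symm)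
    have h2 := contMDiffAt_mkCov_add h1 (((contMDiff_connCov μ A) _).comp y hσy)
    refine (ContMDiffAt.iff_comp_isImmersionAt
      (hL.isSmoothEmbedding.isImmersion.isImmersionAt _)).2 ⟨?_, h2⟩
    exact hL.isSmoothEmbedding.isEmbedding.continuousAt_iff.2 h2.continuousAt
  · refine Subtype.ext ?_
    have h3 := ((hT.eq_iff h x (T x)).1 rfl).2
    change unshift A μ ρ p (σ (pr₁ p (T x))) (T x) = x.1
    rw [hT.pr₁_eq, hσx]
    exact h3.symm

end Properties

end Shift

/-! ### Basic forms -/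

section Basic

variable {E : Type*} [NormedAddCommGroup E] [NormedSpace ℝ E] [FiniteDimensional ℝ E]
  {M : Type*} [TopologicalSpace M] [ChartedSpace E M] [IsManifold 𝓘(ℝ, E) ∞ M]
  {E' : Type*} [NormedAddCommGroup E'] [NormedSpace ℝ E'] [FiniteDimensional ℝ E']
  {M' : Type*} [TopologicalSpace M'] [ChartedSpace E' M'] [IsManifold 𝓘(ℝ, E') ∞ M']

theorem twoForm_ext {V : Type*} [NormedAddCommGroup V] [NormedSpace ℝ V]
    {η η' : V [⋀^Fin 2]→L[ℝ] ℝ} (h : ∀ v w, η ![v, w] = η' ![v, w]) : η = η' := by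
  ext u
  have e : u = ![u 0, u 1] := by ext i; fin_cases i <;> rfl
  rw [e]; exact h _ _

theorem HasLocalSections.surjective_tder {f : M → M'} (hf : ContMDiff 𝓘(ℝ, E) 𝓘(ℝ, E') ∞ f)
    (hs : HasLocalSections 𝓘(ℝ, E) 𝓘(ℝ, E') f) (x : M) :
    Surjective (tder 𝓘(ℝ, E) 𝓘(ℝ, E') f x) := hs.surjective_mfderiv hf x

/-- A smooth two-form whose values only depend on the images under `f` of the points and of the
tangent vectors is the pullback of a smooth form. -/
theorem exists_pullback_eq_of_basic {f : M → M'} (hf : ContMDiff 𝓘(ℝ, E) 𝓘(ℝ, E') ∞ f)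
    (hs : HasLocalSections 𝓘(ℝ, E) 𝓘(ℝ, E') f) (hsurj : Surjective f) {Ω : DForm 𝓘(ℝ, E) M 2}
    (hΩ : IsSmoothForm 𝓘(ℝ, E) Ω)
    (hb : ∀ (x x' : M) (v v' w w' : E), f x = f x' →
      tder 𝓘(ℝ, E) 𝓘(ℝ, E') f x v = tder 𝓘(ℝ, E) 𝓘(ℝ, E') f x' v' →
      tder 𝓘(ℝ, E) 𝓘(ℝ, E') f x w = tder 𝓘(ℝ, E) 𝓘(ℝ, E') f x' w' →
      formAt 𝓘(ℝ, E) Ω x ![v, w] = formAt 𝓘(ℝ, E) Ω x' ![v', w']) :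
    ∃ β : DForm 𝓘(ℝ, E') M' 2, IsSmoothForm 𝓘(ℝ, E') β ∧
      pullback 𝓘(ℝ, E) 𝓘(ℝ, E') f β = Ω := by
  choose x hx using hsurj
  have hR : ∀ y : M', ∃ R : E' →L[ℝ] E,
      (tder 𝓘(ℝ, E) 𝓘(ℝ, E') f (x y)).comp R = ContinuousLinearMap.id ℝ E' := fun y ↦
    ContinuousLinearMap.exists_rightInverse_of_surjective _
      (LinearMap.range_eq_top.2 (hs.surjective_tder hf (x y)))
  choose R hR using hR
  have hR' : ∀ y v, tder 𝓘(ℝ, E) 𝓘(ℝ, E') f (x y) (R y v) = v := fun y v ↦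
    congrArg (fun L : E' →L[ℝ] E' ↦ L v) (hR y)
  -- evaluate `Ω` on arbitrary lifts of the point and of the tangent vectors
  let β : DForm 𝓘(ℝ, E') M' 2 := fun y ↦ (formAt 𝓘(ℝ, E) Ω (x y)).compContinuousLinearMap (R y)
  have hβ : ∀ y (v w : E'), formAt 𝓘(ℝ, E') β y ![v, w] =
      formAt 𝓘(ℝ, E) Ω (x y) ![R y v, R y w] := by
    intro y v w
    refine congrArg (formAt 𝓘(ℝ, E) Ω (x y)) ?_
    ext i; fin_cases i <;> rfl
  refine ⟨β, ?_, ?_⟩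
  -- near a point, `β` is the pullback of `Ω` by a smooth section
  · refine (isSmoothForm_iff 𝓘(ℝ, E')).2 fun y₀ ↦ ?_
    obtain ⟨V, σ, hV, hyV, hσ, -, hfσ⟩ := hs (x y₀)
    rw [hx] at hyV
    have hσy := fun y (hy : y ∈ V) ↦ hσ.contMDiffAt (hV.mem_nhds hy)
    refine smoothFormAt_congr 𝓘(ℝ, E') ?_ (((isSmoothForm_iff 𝓘(ℝ, E)).1 hΩ (σ y₀)).pullback
      𝓘(ℝ, E') 𝓘(ℝ, E) (hσy y₀ hyV))
    filter_upwards [hV.mem_nhds hyV] with y hy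
    have hfs : ∀ v, tder 𝓘(ℝ, E) 𝓘(ℝ, E') f (σ y) (tder 𝓘(ℝ, E') 𝓘(ℝ, E) σ y v) = v := by
      intro v
      rw [← tder_comp_apply_of_eq (f := σ) rfl (hf.mdifferentiable (by simp) _)
        ((hσy y hy).mdifferentiableAt (by simp))]
      have h1 : tder 𝓘(ℝ, E') 𝓘(ℝ, E') (fun z ↦ f (σ z)) y =
          tder 𝓘(ℝ, E') 𝓘(ℝ, E') (fun z ↦ z) y := by
        refine tder_congr ?_
        filter_upwards [hV.mem_nhds hy] with z hz using hfσ z hz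
      rw [h1, tder_id]; rfl
    refine twoForm_ext fun v w ↦ ?_
    rw [formAt_pullback_two, hβ]
    exact hb _ _ _ _ _ _ ((hfσ y hy).trans (hx y).symm) ((hfs v).trans (hR' y v).symm)
      ((hfs w).trans (hR' y w).symm)
  · refine form_ext 𝓘(ℝ, E) fun z ↦ twoForm_ext fun v w ↦ ?_
    rw [formAt_pullback_two, hβ]
    exact hb _ _ _ _ _ _ (hx _) (hR' _ _) (hR' _ _)

end Basic

/-! ### The curvature forms of the connection -/

section Curvature

theorem fderiv_comp_fst_apply {V W F : Type*} [NormedAddCommGroup V] [NormedSpace ℝ V]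
    [NormedAddCommGroup W] [NormedSpace ℝ W] [NormedAddCommGroup F] [NormedSpace ℝ F]
    (g : V → F) (y : V × W) (w : W) : fderiv ℝ (fun y : V × W ↦ g y.1) y (0, w) = 0 := by
  by_cases h : DifferentiableAt ℝ (fun y : V × W ↦ g y.1) y
  · have h1 := HasFDerivAt.comp (g := fun y : V × W ↦ g y.1) (f := fun z : W ↦ (y.1, z)) y.2
      h.hasFDerivAt (hasFDerivAt_prodMk_right y.1 y.2)
    have h2 : HasFDerivAt (fun _ : W ↦ g y.1) (0 : W →L[ℝ] F) y.2 := hasFDerivAt_const _ _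
    exact congrArg (fun L : W →L[ℝ] F ↦ L w) (h1.unique h2)
  · rw [fderiv_zero_of_not_differentiableAt h]; rfl

theorem fderiv_apply_inl {V W F : Type*} [NormedAddCommGroup V] [NormedSpace ℝ V]
    [NormedAddCommGroup W] [NormedSpace ℝ W] [NormedAddCommGroup F] [NormedSpace ℝ F]
    {g : V × W → F} {y : V × W} (h : DifferentiableAt ℝ g y) (v : V) :
    fderiv ℝ g y (v, 0) = fderiv ℝ (fun u ↦ g (u, y.2)) y.1 v :=
  (congrArg (fun L : V →L[ℝ] F ↦ L v) (HasFDerivAt.comp (g := g) (f := fun u : V ↦ (u, y.2)) y.1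
    h.hasFDerivAt (hasFDerivAt_prodMk_left y.1 y.2)).fderiv).symm

section Partial

variable {V W : Type*} [NormedAddCommGroup V] [NormedSpace ℝ V]
    [NormedAddCommGroup W] [NormedSpace ℝ W]
    {E : Type*} [NormedAddCommGroup E] [NormedSpace ℝ E] {M : Type*} [TopologicalSpace M]
    [ChartedSpace E M]

theorem tder_apply_inl {f : V × W → M} {y : V × W}
    (h : MDifferentiableAt 𝓘(ℝ, V × W) 𝓘(ℝ, E) f y) (v : V) :
    tder 𝓘(ℝ, V × W) 𝓘(ℝ, E) f y (v, 0) = tder 𝓘(ℝ, V) 𝓘(ℝ, E) (fun u ↦ f (u, y.2)) y.1 v := by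
  have h1 : HasFDerivAt (fun u : V ↦ (u, y.2)) (ContinuousLinearMap.inl ℝ V W) y.1 :=
    hasFDerivAt_prodMk_left y.1 y.2
  rw [tder_comp_apply_of_eq (g := f) (f := fun u : V ↦ (u, y.2)) rfl h
    h1.hasMFDerivAt.mdifferentiableAt]
  have h2 : tder 𝓘(ℝ, V) 𝓘(ℝ, V × W) (fun u : V ↦ (u, y.2)) y.1 = ContinuousLinearMap.inl ℝ V W :=
    h1.hasMFDerivAt.mfderiv
  rw [h2]; rfl

theorem tder_apply_inr {f : V × W → M} {y : V × W}
    (h : MDifferentiableAt 𝓘(ℝ, V × W) 𝓘(ℝ, E) f y) (w : W) :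
    tder 𝓘(ℝ, V × W) 𝓘(ℝ, E) f y (0, w) = tder 𝓘(ℝ, W) 𝓘(ℝ, E) (fun u ↦ f (y.1, u)) y.2 w := by
  have h1 : HasFDerivAt (fun u : W ↦ (y.1, u)) (ContinuousLinearMap.inr ℝ V W) y.2 :=
    hasFDerivAt_prodMk_right y.1 y.2
  rw [tder_comp_apply_of_eq (g := f) (f := fun u : W ↦ (y.1, u)) rfl h
    h1.hasMFDerivAt.mdifferentiableAt]
  have h2 : tder 𝓘(ℝ, W) 𝓘(ℝ, V × W) (fun u : W ↦ (y.1, u)) y.2 = ContinuousLinearMap.inr ℝ V W :=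
    h1.hasMFDerivAt.mfderiv
  rw [h2]; rfl

end Partial

variable {EG : Type*} [NormedAddCommGroup EG] [NormedSpace ℝ EG] [FiniteDimensional ℝ EG]
  {G : Type*} [TopologicalSpace G] [ChartedSpace EG G] [Group G] [LieGroup 𝓘(ℝ, EG) ∞ G]
  {E : Type*} [NormedAddCommGroup E] [NormedSpace ℝ E] [FiniteDimensional ℝ E]
  {Q : Type*} [TopologicalSpace Q] [ChartedSpace E Q] [IsManifold 𝓘(ℝ, E) ∞ Q]
  [MulAction G Q] [ContMDiffSMul 𝓘(ℝ, EG) 𝓘(ℝ, E) ∞ G Q] {k : ℕ}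
  (A : PrincipalConnection EG G E Q) (μ : Fin k → LieDual EG G)

theorem isSmoothForm_component (ν : LieDual EG G) : IsSmoothForm 𝓘(ℝ, E) (A.component ν) :=
  isSmoothForm_oneForm 𝓘(ℝ, E)
    ((ContinuousLinearMap.contMDiff (E := EG) (F := ℝ) (n := ∞) ν).comp A.smooth)

theorem formAt_component (ν : LieDual EG G) (q : Q) (v : E) :
    formAt 𝓘(ℝ, E) (A.component ν) q ![v] = ν (A.form q v) := rfl

theorem formAt_component_smul (a : Fin k) (g : G) (q : Q) (v : E) :
    formAt 𝓘(ℝ, E) (A.component (μ a)) (g • q)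
      ![tder 𝓘(ℝ, E) 𝓘(ℝ, E) (fun y : Q ↦ g • y) q v] = coadMap μ g a (A.form q v) :=
  congrArg (μ a) (A.equivariant g q v)

/-- The contraction of the exterior derivative of `𝒜_{μ_a}` with an infinitesimal generator is the
derivative of `g ↦ ⟨μ_a, Ad_g 𝒜(w)⟩`: along `(g, x) ↦ g • x`, the form `𝒜` is `Ad_g 𝒜` on vectors
in the direction of `x`, and does not depend on `x` in the direction of the group. -/
theorem formAt_dExt_component_infGen (a : Fin k) (q : Q) (ξ : EG) (w : E) :
    formAt 𝓘(ℝ, E) (dExt 𝓘(ℝ, E) (A.component (μ a))) q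
      ![tder 𝓘(ℝ, EG) 𝓘(ℝ, E) (fun g : G ↦ g • q) 1 ξ, w] =
      tder 𝓘(ℝ, EG) 𝓘(ℝ, Fin k → (EG →L[ℝ] ℝ)) (coadMap μ) 1 ξ a (A.form q w) := by
  -- `f` is the action `(g, x) ↦ g • x` in charts of `G` at `1` and of `Q` at `q`
  let φ := extChartAt 𝓘(ℝ, EG) (1 : G)
  let ψ := extChartAt 𝓘(ℝ, E) q
  let f : EG × E → Q := fun y ↦ φ.symm y.1 • ψ.symm y.2
  let y₀ : EG × E := (φ 1, ψ q)
  have h1φ : (1 : G) ∈ φ.source := mem_extChartAt_source 1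
  have hqψ : q ∈ ψ.source := mem_extChartAt_source q
  have e1 : φ.symm (φ 1) = 1 := φ.left_inv h1φ
  have eq' : ψ.symm (ψ q) = q := ψ.left_inv hqψ
  have hf0 : f y₀ = q := by
    change φ.symm (φ 1) • ψ.symm (ψ q) = q
    rw [e1, eq', one_smul]
  have hC : ∀ u ∈ φ.target, ContMDiffAt 𝓘(ℝ, EG) 𝓘(ℝ, EG) ∞ φ.symm u := fun u hu ↦
    contMDiffAt_extChart_symm hu
  have hX : ∀ u ∈ ψ.target, ContMDiffAt 𝓘(ℝ, E) 𝓘(ℝ, E) ∞ ψ.symm u := fun u hu ↦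
    contMDiffAt_extChart_symm hu
  have hnhds : ∀ᶠ y : EG × E in 𝓝 y₀, y.1 ∈ φ.target ∧ y.2 ∈ ψ.target :=
    (((isOpen_extChartAt_target (I := 𝓘(ℝ, EG)) (1 : G)).prod
      (isOpen_extChartAt_target (I := 𝓘(ℝ, E)) q)).mem_nhds
        ⟨φ.map_source h1φ, ψ.map_source hqψ⟩)
  have hf : ∀ y : EG × E, y.1 ∈ φ.target → y.2 ∈ ψ.target →
      ContMDiffAt 𝓘(ℝ, EG × E) 𝓘(ℝ, E) ∞ f y := fun y h1 h2 ↦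
    ((hC _ h1).comp y (f := (Prod.fst : EG × E → EG)) (contDiff_fst.contMDiff y)).smul
      ((hX _ h2).comp y (f := (Prod.snd : EG × E → E)) (contDiff_snd.contMDiff y))
  let ξ' : EG := tder 𝓘(ℝ, EG) 𝓘(ℝ, EG) φ 1 ξ
  let w' : E := tder 𝓘(ℝ, E) 𝓘(ℝ, E) ψ q w
  have hξ' : tder 𝓘(ℝ, EG) 𝓘(ℝ, EG) φ.symm (φ 1) ξ' = ξ :=
    congrArg (fun L : EG →L[ℝ] EG ↦ L ξ) (tder_extChart_symm_comp 𝓘(ℝ, EG) h1φ)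
  have hw' : tder 𝓘(ℝ, E) 𝓘(ℝ, E) ψ.symm (ψ q) w' = w :=
    congrArg (fun L : E →L[ℝ] E ↦ L w) (tder_extChart_symm_comp 𝓘(ℝ, E) hqψ)
  -- the partial derivative of `f` along the second factor
  have hfs : ∀ y : EG × E, y.1 ∈ φ.target → y.2 ∈ ψ.target →
      tder 𝓘(ℝ, EG × E) 𝓘(ℝ, E) f y (0, w') =
        tder 𝓘(ℝ, E) 𝓘(ℝ, E) (fun x : Q ↦ φ.symm y.1 • x) (ψ.symm y.2)
          (tder 𝓘(ℝ, E) 𝓘(ℝ, E) ψ.symm y.2 w') := by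
    intro y h1 h2
    rw [tder_apply_inr ((hf y h1 h2).mdifferentiableAt (by simp))]
    exact tder_comp_apply_of_eq (g := fun x : Q ↦ φ.symm y.1 • x) (f := ψ.symm) rfl
      ((contMDiff_act EG _).mdifferentiable (by simp) _) ((hX _ h2).mdifferentiableAt (by simp)) w'
  -- the partial derivative of `f` along the first factor
  have hft : ∀ y : EG × E, y.1 ∈ φ.target → y.2 ∈ ψ.target →
      tder 𝓘(ℝ, EG × E) 𝓘(ℝ, E) f y (ξ', 0) =
        tder 𝓘(ℝ, EG) 𝓘(ℝ, E) (fun g : G ↦ g • f y) 1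
          (tder 𝓘(ℝ, EG) 𝓘(ℝ, EG) (fun u ↦ φ.symm u * (φ.symm y.1)⁻¹) y.1 ξ') := by
    intro y h1 h2
    rw [tder_apply_inl ((hf y h1 h2).mdifferentiableAt (by simp))]
    have h3 : ContMDiffAt 𝓘(ℝ, EG) 𝓘(ℝ, EG) ∞ (fun u ↦ φ.symm u * (φ.symm y.1)⁻¹) y.1 :=
      (hC _ h1).mul contMDiffAt_const
    have h4 : ContMDiff 𝓘(ℝ, EG) 𝓘(ℝ, E) ∞ (fun g : G ↦ g • f y) :=
      (contMDiff_id (I := 𝓘(ℝ, EG))).smul (contMDiff_const (c := f y))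
    rw [← tder_comp_apply_of_eq (g := fun g : G ↦ g • f y)
      (f := fun u ↦ φ.symm u * (φ.symm y.1)⁻¹) (mul_inv_cancel _)
      (h4.mdifferentiable (by simp) 1) (h3.mdifferentiableAt (by simp))]
    refine congrArg (fun F : EG → Q ↦ tder 𝓘(ℝ, EG) 𝓘(ℝ, E) F y.1 ξ') (funext fun u ↦ ?_)
    change φ.symm u • ψ.symm y.2 = (φ.symm u * (φ.symm y.1)⁻¹) • φ.symm y.1 • ψ.symm y.2
    rw [smul_smul, inv_mul_cancel_right]
  have hy₁ : y₀.1 ∈ φ.target := φ.map_source h1φ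
  have hy₂ : y₀.2 ∈ ψ.target := ψ.map_source hqψ
  have hF0 := dExt_apply_tder 𝓘(ℝ, E) (hf y₀ hy₁ hy₂)
    ((isSmoothForm_iff 𝓘(ℝ, E)).1 (isSmoothForm_component A (μ a)) _) (ξ', 0) (0, w')
  let η : E → EG := fun z ↦ A.form (ψ.symm z) (tder 𝓘(ℝ, E) 𝓘(ℝ, E) ψ.symm z w')
  -- in the direction of `Q`, equivariance gives `⟨μ_a, Ad_g 𝒜(w)⟩`
  have hs : (fun y ↦ formAt 𝓘(ℝ, E) (A.component (μ a)) (f y)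
      ![tder 𝓘(ℝ, EG × E) 𝓘(ℝ, E) f y (0, w')]) =ᶠ[𝓝 y₀]
      fun y ↦ coadMap μ (φ.symm y.1) a (η y.2) := by
    filter_upwards [hnhds] with y hy
    rw [hfs y hy.1 hy.2]
    exact formAt_component_smul A μ a _ _ _
  -- in the direction of `G`, the value does not depend on the point of `Q`, because `𝒜(ξ_Q) = ξ`
  have ht : (fun y ↦ formAt 𝓘(ℝ, E) (A.component (μ a)) (f y)
      ![tder 𝓘(ℝ, EG × E) 𝓘(ℝ, E) f y (ξ', 0)]) =ᶠ[𝓝 y₀]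
      fun y ↦ μ a (tder 𝓘(ℝ, EG) 𝓘(ℝ, EG) (fun u ↦ φ.symm u * (φ.symm y.1)⁻¹) y.1 ξ') := by
    filter_upwards [hnhds] with y hy
    rw [hft y hy.1 hy.2]
    exact congrArg (μ a) (A.apply_infGen _ _)
  rw [hs.fderiv_eq, ht.fderiv_eq] at hF0
  have hcoad : ContMDiffAt 𝓘(ℝ, EG) 𝓘(ℝ, Fin k → (EG →L[ℝ] ℝ)) ∞
      (fun u ↦ coadMap μ (φ.symm u)) y₀.1 := (contMDiff_coadMap μ _).comp y₀.1 (hC _ hy₁)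
  have hH : DifferentiableAt ℝ (fun y : EG × E ↦ coadMap μ (φ.symm y.1) a (η y.2)) y₀ := by
    have h1 : DifferentiableAt ℝ (fun u ↦ coadMap μ (φ.symm u) a) y₀.1 :=
      differentiableAt_pi.1 (hcoad.contDiffAt.differentiableAt (by simp)) a
    have h2 : DifferentiableAt ℝ η y₀.2 :=
      (((contDiffOn_apply_tder_symm 𝓘(ℝ, E) A.smooth q w').contDiffAt
        ((isOpen_extChartAt_target q).mem_nhds hy₂))).differentiableAt (by simp)
    exact (DifferentiableAt.comp (g := fun u ↦ coadMap μ (φ.symm u) a)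
      (f := (Prod.fst : EG × E → EG)) y₀ h1 differentiableAt_fst).clm_apply
      (DifferentiableAt.comp (g := η) (f := (Prod.snd : EG × E → E)) y₀ h2 differentiableAt_snd)
  rw [fderiv_apply_inl hH,
    fderiv_comp_fst_apply (fun u ↦ μ a
      (tder 𝓘(ℝ, EG) 𝓘(ℝ, EG) (fun z ↦ φ.symm z * (φ.symm u)⁻¹) u ξ')),
    sub_zero, hft y₀ hy₁ hy₂, hfs y₀ hy₁ hy₂] at hF0
  have hη : η y₀.2 = A.form q w := by
    have hA : ∀ q', q' = q → (A.form q' : E →L[ℝ] EG) = A.form q := by rintro _ rfl; rfl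
    exact (congrArg (fun L : E →L[ℝ] EG ↦ L _) (hA _ eq')).trans (congrArg (A.form q) hw')
  have h1 : tder 𝓘(ℝ, EG) 𝓘(ℝ, EG) (fun u ↦ φ.symm u * (φ.symm y₀.1)⁻¹) y₀.1 ξ' = ξ := by
    have h2 : (fun u ↦ φ.symm u * (φ.symm y₀.1)⁻¹) = φ.symm := funext fun u ↦ by
      rw [show φ.symm y₀.1 = 1 from e1, inv_one, mul_one]
    rw [h2]; exact hξ'
  have h2 : tder 𝓘(ℝ, E) 𝓘(ℝ, E) (fun x : Q ↦ φ.symm y₀.1 • x) (ψ.symm y₀.2)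
      (tder 𝓘(ℝ, E) 𝓘(ℝ, E) ψ.symm y₀.2 w') = w := by
    have h3 : (fun x : Q ↦ φ.symm y₀.1 • x) = fun x ↦ x := funext fun x ↦ by
      rw [show φ.symm y₀.1 = 1 from e1, one_smul]
    rw [h3, tder_id]; exact hw'
  have h3 : fderiv ℝ (fun u ↦ coadMap μ (φ.symm u) a (η y₀.2)) y₀.1 ξ' =
      tder 𝓘(ℝ, EG) 𝓘(ℝ, Fin k → (EG →L[ℝ] ℝ)) (coadMap μ) 1 ξ a (A.form q w) := by
    let L : (Fin k → (EG →L[ℝ] ℝ)) →L[ℝ] ℝ := (ContinuousLinearMap.apply ℝ ℝ (η y₀.2)).comp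
      (ContinuousLinearMap.proj (R := ℝ) (φ := fun _ : Fin k ↦ EG →L[ℝ] ℝ) a)
    have h4 : HasFDerivAt (fun u ↦ L (coadMap μ (φ.symm u)))
        (L.comp (fderiv ℝ (fun u ↦ coadMap μ (φ.symm u)) y₀.1)) y₀.1 :=
      L.hasFDerivAt.comp y₀.1 (hcoad.contDiffAt.differentiableAt (by simp)).hasFDerivAt
    have h5 : fderiv ℝ (fun u ↦ coadMap μ (φ.symm u)) y₀.1 ξ' =
        tder 𝓘(ℝ, EG) 𝓘(ℝ, Fin k → (EG →L[ℝ] ℝ)) (coadMap μ) 1 ξ := by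
      rw [← mfderiv_eq_fderiv, ← hξ']
      exact tder_comp_apply_of_eq (g := coadMap μ) (f := φ.symm) e1
        ((contMDiff_coadMap μ).mdifferentiable (by simp) 1)
        ((hC _ hy₁).mdifferentiableAt (by simp)) ξ'
    refine (congrArg (fun L : EG →L[ℝ] ℝ ↦ L ξ') h4.fderiv).trans ?_
    change fderiv ℝ (fun u ↦ coadMap μ (φ.symm u)) y₀.1 ξ' a (η y₀.2) = _
    rw [h5, hη]
  rw [h1, h2, h3, hf0] at hF0
  exact hF0

end Curvature

/-! ### Descent of the curvature forms -/

section Descent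

variable {EG : Type*} [NormedAddCommGroup EG] [NormedSpace ℝ EG] [FiniteDimensional ℝ EG]
  {G : Type*} [TopologicalSpace G] [ChartedSpace EG G] [Group G] [LieGroup 𝓘(ℝ, EG) ∞ G]
  {E : Type*} [NormedAddCommGroup E] [NormedSpace ℝ E] [FiniteDimensional ℝ E]
  {Q : Type*} [TopologicalSpace Q] [ChartedSpace E Q] [IsManifold 𝓘(ℝ, E) ∞ Q]
  [MulAction G Q] [ContMDiffSMul 𝓘(ℝ, EG) 𝓘(ℝ, E) ∞ G Q] {k : ℕ}
  {b c : ℕ} {B : Type*} [TopologicalSpace B] [ChartedSpace (EuclideanSpace ℝ (Fin b)) B]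
  [IsManifold (𝓡 b) ∞ B] {C : Type*} [TopologicalSpace C]
  [ChartedSpace (EuclideanSpace ℝ (Fin c)) C] [IsManifold (𝓡 c) ∞ C]
  {μ : Fin k → LieDual EG G} {ρ : Q → B} {ϖ : Q → C} {p : C^∞⟮𝓡 c, C; 𝓡 b, B⟯}
  (A : PrincipalConnection EG G E Q)

theorem oneForm_ext {V : Type*} [NormedAddCommGroup V] [NormedSpace ℝ V]
    {η η' : V [⋀^Fin 1]→L[ℝ] ℝ} (h : ∀ v, η ![v] = η' ![v]) : η = η' := by
  ext u
  have e : u = ![u 0] := by ext i; fin_cases i; rfl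
  rw [e]; exact h _

theorem pullback_smul_component {g : G} (hg : g ∈ isotropy μ) (a : Fin k) :
    pullback 𝓘(ℝ, E) 𝓘(ℝ, E) (fun q : Q ↦ g • q) (A.component (μ a)) = A.component (μ a) := by
  refine form_ext 𝓘(ℝ, E) fun q ↦ oneForm_ext fun v ↦ ?_
  rw [formAt_pullback_one, formAt_component_smul, formAt_component,
    congrFun ((mem_isotropy_iff μ g).1 hg) a, coadMap, Ad_one]
  rfl

theorem formAt_dExt_component_smul {g : G} (hg : g ∈ isotropy μ) (a : Fin k) (q : Q) (v w : E) :
    formAt 𝓘(ℝ, E) (dExt 𝓘(ℝ, E) (A.component (μ a))) (g • q)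
      ![tder 𝓘(ℝ, E) 𝓘(ℝ, E) (fun y : Q ↦ g • y) q v,
        tder 𝓘(ℝ, E) 𝓘(ℝ, E) (fun y : Q ↦ g • y) q w] =
      formAt 𝓘(ℝ, E) (dExt 𝓘(ℝ, E) (A.component (μ a))) q ![v, w] := by
  rw [← formAt_pullback_two 𝓘(ℝ, E) 𝓘(ℝ, E) (fun y : Q ↦ g • y),
    ← dExt_pullback 𝓘(ℝ, E) 𝓘(ℝ, E) (contMDiff_act EG g)
      ((isSmoothForm_iff _).1 (isSmoothForm_component A (μ a))), pullback_smul_component A hg]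

theorem twoForm_swap {V : Type*} [NormedAddCommGroup V] [NormedSpace ℝ V]
    (η : V [⋀^Fin 2]→L[ℝ] ℝ) (v w : V) : η ![v, w] = -η ![w, v] := by
  refine Eq.trans (congrArg η ?_) (η.toAlternatingMap.map_swap ![w, v] (i := 0) (j := 1) (by decide))
  ext i; fin_cases i <;> rfl

theorem twoForm_sub_left {V : Type*} [NormedAddCommGroup V] [NormedSpace ℝ V]
    (η : V [⋀^Fin 2]→L[ℝ] ℝ) (v v' w : V) : η ![v - v', w] = η ![v, w] - η ![v', w] := by
  simp

theorem IsOrbitDiagram.tder_right_smul (h : IsOrbitDiagram (E := E) μ ρ ϖ p) {g : G}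
    (hg : g ∈ isotropy μ) (q : Q) (v : E) :
    tder 𝓘(ℝ, E) (𝓡 c) ϖ (g • q) (tder 𝓘(ℝ, E) 𝓘(ℝ, E) (fun y : Q ↦ g • y) q v) =
      tder 𝓘(ℝ, E) (𝓡 c) ϖ q v := by
  rw [← tder_comp_apply_of_eq (g := ϖ) (f := fun y : Q ↦ g • y) rfl
    (h.contMDiff_right.mdifferentiable (by simp) _)
    ((contMDiff_act EG g).mdifferentiable (by simp) _)]
  exact congrArg (fun f : Q → C ↦ tder 𝓘(ℝ, E) (𝓡 c) f q v)
    (funext fun y ↦ ((h.right_eq_iff y (g • y)).2 ⟨g, hg, rfl⟩).symm)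

/-- A vector that is vertical for `ϖ` lies in the kernel of the curvature forms. -/
theorem IsOrbitDiagram.formAt_dExt_component_eq_zero [T2Space Q] [ProperSMul G Q]
    (h : IsOrbitDiagram (E := E) μ ρ ϖ p) (hfree : ∀ (g : G) (q : Q), g • q = q → g = 1)
    (a : Fin k) {q : Q} {v : E} (hv : tder 𝓘(ℝ, E) (𝓡 c) ϖ q v = 0) (w : E) :
    formAt 𝓘(ℝ, E) (dExt 𝓘(ℝ, E) (A.component (μ a))) q ![v, w] = 0 := by
  obtain ⟨ξ, hξ, rfl⟩ := exists_infGen_eq_of_tder_eq_zero hfree A.injective_infGen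
    (contMDiff_coadMap μ) (coadMap_mul μ) h.contMDiff_right h.sections_right (fun q q' hq ↦ by
      obtain ⟨g, hg, hgq⟩ := (h.right_eq_iff q q').1 hq
      exact ⟨g, (mem_isotropy_iff μ g).1 hg, hgq⟩) hv
  rw [formAt_dExt_component_infGen, hξ]
  rfl

/-- The two-forms `d𝒜_{μ_a}` descend to `Q/G_μ`. -/
theorem IsOrbitDiagram.exists_curvature [T2Space Q] [ProperSMul G Q]
    (h : IsOrbitDiagram (E := E) μ ρ ϖ p) (hfree : ∀ (g : G) (q : Q), g • q = q → g = 1)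
    (a : Fin k) :
    ∃ β : DForm (𝓡 c) C 2, IsSmoothForm (𝓡 c) β ∧
      pullback 𝓘(ℝ, E) (𝓡 c) ϖ β = dExt 𝓘(ℝ, E) (A.component (μ a)) := by
  refine exists_pullback_eq_of_basic h.contMDiff_right h.sections_right h.surjective_right
    ((isSmoothForm_component A (μ a)).dExt 𝓘(ℝ, E)) fun q q' v v' w w' hq hv hw ↦ ?_
  obtain ⟨g, hg, rfl⟩ := (h.right_eq_iff q q').1 hq
  -- by invariance both points may be taken equal; then the arguments differ by vertical vectors
  rw [← formAt_dExt_component_smul A hg]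
  rw [← h.tder_right_smul hg, ← sub_eq_zero, ← map_sub] at hv hw
  have h1 := h.formAt_dExt_component_eq_zero A hfree a hv
    (tder 𝓘(ℝ, E) 𝓘(ℝ, E) (fun y : Q ↦ g • y) q w)
  have h2 := h.formAt_dExt_component_eq_zero A hfree a hw v'
  rw [twoForm_sub_left, sub_eq_zero] at h1 h2
  rw [h1, twoForm_swap, h2, ← twoForm_swap]

theorem IsOrbitDiagram.dExt_curvature (h : IsOrbitDiagram (E := E) μ ρ ϖ p) {a : Fin k}
    {β : DForm (𝓡 c) C 2} (hβ : IsSmoothForm (𝓡 c) β)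
    (hβA : pullback 𝓘(ℝ, E) (𝓡 c) ϖ β = dExt 𝓘(ℝ, E) (A.component (μ a))) :
    dExt (𝓡 c) β = 0 := by
  refine pullback_injective 𝓘(ℝ, E) (𝓡 c) h.surjective_right h.surjective_tder_right ?_
  rw [← dExt_pullback 𝓘(ℝ, E) (𝓡 c) h.contMDiff_right ((isSmoothForm_iff _).1 hβ), hβA,
    dExt_dExt 𝓘(ℝ, E) (isSmoothForm_component A (μ a))]
  rfl

/-- The curvature forms have no common kernel on the vertical spaces of `p`. -/
theorem IsOrbitDiagram.curvature_nondegenerate [T2Space Q] [ProperSMul G Q]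
    (h : IsOrbitDiagram (E := E) μ ρ ϖ p) (hfree : ∀ (g : G) (q : Q), g • q = q → g = 1)
    {β : Fin k → DForm (𝓡 c) C 2}
    (hβA : ∀ a, pullback 𝓘(ℝ, E) (𝓡 c) ϖ (β a) = dExt 𝓘(ℝ, E) (A.component (μ a)))
    (y : C) (u : EuclideanSpace ℝ (Fin c)) (hu : tder (𝓡 c) (𝓡 b) p y u = 0)
    (hβ : ∀ (a : Fin k) (u' : EuclideanSpace ℝ (Fin c)), tder (𝓡 c) (𝓡 b) p y u' = 0 →
      formAt (𝓡 c) (β a) y ![u, u'] = 0) : u = 0 := by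
  obtain ⟨q, rfl⟩ := h.surjective_right y
  obtain ⟨v, rfl⟩ := h.surjective_tder_right q u
  rw [← h.tder_left_eq_comp] at hu
  obtain ⟨ξ, rfl⟩ := h.exists_infGen hfree A hu
  refine tder_infGen_eq_zero (contMDiff_coadMap μ) (coadMap_mul μ) h.contMDiff_right
    (fun q g hg ↦ ((h.right_eq_iff q (g • q)).2 ⟨g, (mem_isotropy_iff μ g).2 hg, rfl⟩).symm) q ?_
  refine funext fun a ↦ ContinuousLinearMap.ext fun η ↦ ?_
  have h1 := hβ a (tder 𝓘(ℝ, E) (𝓡 c) ϖ q (tder 𝓘(ℝ, EG) 𝓘(ℝ, E) (fun g : G ↦ g • q) 1 η)) (by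
    rw [← h.tder_left_eq_comp]
    exact congrArg (fun L : EG →L[ℝ] EuclideanSpace ℝ (Fin b) ↦ L η) (h.tder_left_comp_infGen q))
  rw [← formAt_pullback_two, hβA, formAt_dExt_component_infGen] at h1
  refine Eq.trans ?_ h1
  exact congrArg _ (A.apply_infGen q η).symm

end Descent

/-! ### The momentum shift and the canonical forms -/

section ShiftForms

variable {EG : Type*} [NormedAddCommGroup EG] [NormedSpace ℝ EG] [FiniteDimensional ℝ EG]
  {G : Type*} [TopologicalSpace G] [ChartedSpace EG G] [Group G] [LieGroup 𝓘(ℝ, EG) ∞ G]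
  {E : Type*} [NormedAddCommGroup E] [NormedSpace ℝ E] [FiniteDimensional ℝ E]
  {Q : Type*} [TopologicalSpace Q] [ChartedSpace E Q] [IsManifold 𝓘(ℝ, E) ∞ Q]
  [MulAction G Q] [ContMDiffSMul 𝓘(ℝ, EG) 𝓘(ℝ, E) ∞ G Q] {k : ℕ}
  {b c s : ℕ} {B : Type*} [TopologicalSpace B] [ChartedSpace (EuclideanSpace ℝ (Fin b)) B]
  [IsManifold (𝓡 b) ∞ B] {C : Type*} [TopologicalSpace C]
  [ChartedSpace (EuclideanSpace ℝ (Fin c)) C] [IsManifold (𝓡 c) ∞ C]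
  {μ : Fin k → LieDual EG G} {ρ : Q → B} {ϖ : Q → C} {p : C^∞⟮𝓡 c, C; 𝓡 b, B⟯}
  {A : PrincipalConnection EG G E Q} {T : level E Q μ → PullCov k p}
  [ChartedSpace (EuclideanSpace ℝ (Fin s)) (level E Q μ)]

attribute [local instance] topologicalSpacePullCov chartedSpacePullCov isManifold_pullCov

/-- The momentum shift changes the tautological one-forms by the pullbacks of the one-forms
`𝒜_{μ_a}`. -/
theorem IsMomentumShift.pullback_tautForm (hT : IsMomentumShift A ρ ϖ p T)
    (h : IsOrbitDiagram (E := E) μ ρ ϖ p)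
    (hL : IsEmbeddedSubmanifold (covModel E k) (level E Q μ) s) (a : Fin k) :
    pullback (𝓡 s) (cotModel (EuclideanSpace ℝ (Fin b))) (fun x ↦ covProj a (pr₂ p (T x)))
      (tautForm (EuclideanSpace ℝ (Fin b)) B) = fun x ↦
      pullback (𝓡 s) (cotModel E) (fun x : level E Q μ ↦ covProj a x.1) (tautForm E Q) x -
      pullback (𝓡 s) 𝓘(ℝ, E) (fun x : level E Q μ ↦ x.1.proj) (A.component (μ a)) x := by
  have := hL.isSmoothManifold.isManifold
  have hι : ContMDiff (𝓡 s) (covModel E k) ∞ (Subtype.val : level E Q μ → Cov E Q k) :=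
    hL.isSmoothEmbedding.contMDiff
  have hq : ContMDiff (𝓡 s) 𝓘(ℝ, E) ∞ (fun x : level E Q μ ↦ x.1.proj) :=
    contMDiff_vcov_proj.comp hι
  have hT' := hT.contMDiff h hL
  let f : level E Q μ → Cot (EuclideanSpace ℝ (Fin b)) B := fun x ↦ covProj a (pr₂ p (T x))
  have hf : ContMDiff (𝓡 s) (cotModel (EuclideanSpace ℝ (Fin b))) ∞ f :=
    ((contMDiff_covProj a).comp contMDiff_pr₂).comp hT'
  let i : level E Q μ → Cot E Q := fun x ↦ covProj a x.1
  have hi : ContMDiff (𝓡 s) (cotModel E) ∞ i := (contMDiff_covProj a).comp hι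
  refine form_ext (𝓡 s) fun x ↦ oneForm_ext fun v ↦ ?_
  have e1 : formAt (𝓡 s) (pullback (𝓡 s) (cotModel (EuclideanSpace ℝ (Fin b))) f
      (tautForm (EuclideanSpace ℝ (Fin b)) B)) x ![v] =
      cov (pr₂ p (T x)) (tder 𝓘(ℝ, E) (𝓡 b) ρ x.1.proj
        (tder (𝓡 s) 𝓘(ℝ, E) (fun x : level E Q μ ↦ x.1.proj) x v)) a := by
    rw [formAt_pullback_one, formAt_tautForm]
    change cov (f x) (tder (cotModel (EuclideanSpace ℝ (Fin b))) (𝓡 b)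
      (fun z : Cot (EuclideanSpace ℝ (Fin b)) B ↦ z.proj) (f x)
      (tder (𝓡 s) (cotModel (EuclideanSpace ℝ (Fin b))) f x v)) = _
    rw [← tder_comp_apply_of_eq (f := f)
      (g := fun z : Cot (EuclideanSpace ℝ (Fin b)) B ↦ z.proj) rfl
      (contMDiff_vcov_proj.mdifferentiable (by simp) _) (hf.mdifferentiable (by simp) x),
      ← tder_comp_apply_of_eq (f := fun x : level E Q μ ↦ x.1.proj) (g := ρ) rfl
      (h.contMDiff_left.mdifferentiable (by simp) _) (hq.mdifferentiable (by simp) x)]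
    have e : (fun z ↦ (f z).proj) = fun z : level E Q μ ↦ ρ z.1.proj := funext fun z ↦
      (congrArg p (hT.pr₁_eq z)).trans (h.map_right _)
    rw [e]; rfl
  have e2 : formAt (𝓡 s) (pullback (𝓡 s) (cotModel E) i (tautForm E Q)) x ![v] =
      cov x.1 (tder (𝓡 s) 𝓘(ℝ, E) (fun x : level E Q μ ↦ x.1.proj) x v) a := by
    rw [formAt_pullback_one, formAt_tautForm]
    change cov (i x) (tder (cotModel E) 𝓘(ℝ, E) (fun z : Cot E Q ↦ z.proj) (i x)
      (tder (𝓡 s) (cotModel E) i x v)) = _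
    rw [← tder_comp_apply_of_eq (f := i) (g := fun z : Cot E Q ↦ z.proj) rfl
      (contMDiff_vcov_proj.mdifferentiable (by simp) _) (hi.mdifferentiable (by simp) x)]
    rfl
  have e3 : formAt (𝓡 s) (pullback (𝓡 s) 𝓘(ℝ, E) (fun x : level E Q μ ↦ x.1.proj)
      (A.component (μ a))) x ![v] =
      connCov μ A x.1.proj (tder (𝓡 s) 𝓘(ℝ, E) (fun x : level E Q μ ↦ x.1.proj) x v) a := by
    rw [formAt_pullback_one]; rfl
  refine e1.trans ?_
  refine Eq.trans ?_ (congrArg₂ (· - ·) e2 e3).symm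
  exact congrFun (congrArg (fun L : E →L[ℝ] (Fin k → ℝ) ↦
    L (tder (𝓡 s) 𝓘(ℝ, E) (fun x : level E Q μ ↦ x.1.proj) x v)) (hT.pr₂_comp x)) a

/-- The momentum shift pulls the magnetic forms back to the canonical forms: the terms
`d𝒜_{μ_a}` produced by the tautological forms and by the curvature forms cancel. -/
theorem IsMomentumShift.pullback_magneticForm (hT : IsMomentumShift A ρ ϖ p T)
    (h : IsOrbitDiagram (E := E) μ ρ ϖ p)
    (hL : IsEmbeddedSubmanifold (covModel E k) (level E Q μ) s) {β : Fin k → DForm (𝓡 c) C 2}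
    (hβA : ∀ a, pullback 𝓘(ℝ, E) (𝓡 c) ϖ (β a) = dExt 𝓘(ℝ, E) (A.component (μ a))) (a : Fin k) :
    pullback (𝓡 s) (pullModel b c k) T (magneticForm p β a) =
      pullback (𝓡 s) (covModel E k) (Subtype.val : level E Q μ → Cov E Q k) (covForm E Q k a) := by
  have := hL.isSmoothManifold.isManifold
  have hι : ContMDiff (𝓡 s) (covModel E k) ∞ (Subtype.val : level E Q μ → Cov E Q k) :=
    hL.isSmoothEmbedding.contMDiff
  have hq : ContMDiff (𝓡 s) 𝓘(ℝ, E) ∞ (fun x : level E Q μ ↦ x.1.proj) :=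
    contMDiff_vcov_proj.comp hι
  have hT' := hT.contMDiff h hL
  let EB := EuclideanSpace ℝ (Fin b)
  have hc : ContMDiff (pullModel b c k) (cotModel EB) ∞
      (fun y : PullCov k p ↦ covProj a (pr₂ p y)) := (contMDiff_covProj a).comp contMDiff_pr₂
  have hi : ContMDiff (𝓡 s) (cotModel E) ∞ (fun x : level E Q μ ↦ covProj a x.1) :=
    (contMDiff_covProj a).comp hι
  have hB := (isSmoothForm_iff _).1 (isSmoothForm_tautForm (E := EB) (M := B))
  have hE := (isSmoothForm_iff _).1 (isSmoothForm_tautForm (E := E) (M := Q))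
  have hα := (isSmoothForm_iff _).1 (isSmoothForm_component A (μ a))
  -- the canonical part, by differentiating `pullback_tautForm`
  have e1 : pullback (𝓡 s) (pullModel b c k) T (pullback (pullModel b c k) (cotModel EB)
      (fun y : PullCov k p ↦ covProj a (pr₂ p y)) (dExt (cotModel EB) (tautForm EB B))) =
      fun x ↦ pullback (𝓡 s) (cotModel E) (fun x : level E Q μ ↦ covProj a x.1)
        (dExt (cotModel E) (tautForm E Q)) x -
        pullback (𝓡 s) 𝓘(ℝ, E) (fun x : level E Q μ ↦ x.1.proj)
          (dExt 𝓘(ℝ, E) (A.component (μ a))) x := by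
    rw [← pullback_comp (𝓡 s) (pullModel b c k) (cotModel EB) hc hT',
      ← dExt_pullback (𝓡 s) (cotModel EB) (f := fun x ↦ covProj a (pr₂ p (T x))) (hc.comp hT') hB,
      ← dExt_pullback (𝓡 s) (cotModel E) hi hE, ← dExt_pullback (𝓡 s) 𝓘(ℝ, E) hq hα,
      ← dExt_sub (𝓡 s) (fun x ↦ (hE _).pullback (𝓡 s) (cotModel E) (hi x))
        (fun x ↦ (hα _).pullback (𝓡 s) 𝓘(ℝ, E) (hq x))]
    exact congrArg _ (hT.pullback_tautForm h hL a)
  -- the curvature part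
  have e2 : pullback (𝓡 s) (pullModel b c k) T (pullback (pullModel b c k) (𝓡 c) (pr₁ p) (β a)) =
      pullback (𝓡 s) 𝓘(ℝ, E) (fun x : level E Q μ ↦ x.1.proj)
          (dExt 𝓘(ℝ, E) (A.component (μ a))) := by
    rw [← pullback_comp (𝓡 s) (pullModel b c k) (𝓡 c) contMDiff_pr₁ hT', ← hβA,
      ← pullback_comp (𝓡 s) 𝓘(ℝ, E) (𝓡 c) h.contMDiff_right hq]
    exact congrArg (fun f : level E Q μ → C ↦ pullback (𝓡 s) (𝓡 c) f (β a)) (funext hT.pr₁_eq)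
  have e3 : pullback (𝓡 s) (covModel E k) (Subtype.val : level E Q μ → Cov E Q k)
      (covForm E Q k a) = pullback (𝓡 s) (cotModel E) (fun x : level E Q μ ↦ covProj a x.1)
        (canForm E Q) :=
    (pullback_comp (𝓡 s) (covModel E k) (cotModel E) (contMDiff_covProj a) hι _).symm
  rw [e3]
  refine form_ext (𝓡 s) fun x ↦ twoForm_ext fun v w ↦ ?_
  have e1' := congrArg (fun Ω : DForm (𝓡 s) (level E Q μ) 2 ↦ formAt (𝓡 s) Ω x ![v, w]) e1
  have e2' := congrArg (fun Ω : DForm (𝓡 s) (level E Q μ) 2 ↦ formAt (𝓡 s) Ω x ![v, w]) e2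
  have l1 : formAt (𝓡 s) (pullback (𝓡 s) (pullModel b c k) T (magneticForm p β a)) x ![v, w] =
      -formAt (𝓡 s) (pullback (𝓡 s) (pullModel b c k) T (pullback (pullModel b c k) (cotModel EB)
        (fun y : PullCov k p ↦ covProj a (pr₂ p y)) (dExt (cotModel EB) (tautForm EB B)))) x ![v, w] -
      formAt (𝓡 s) (pullback (𝓡 s) (pullModel b c k) T
        (pullback (pullModel b c k) (𝓡 c) (pr₁ p) (β a))) x ![v, w] := rfl
  have l2 : formAt (𝓡 s) (pullback (𝓡 s) (cotModel E) (fun x : level E Q μ ↦ covProj a x.1)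
      (canForm E Q)) x ![v, w] = -formAt (𝓡 s) (pullback (𝓡 s) (cotModel E)
        (fun x : level E Q μ ↦ covProj a x.1) (dExt (cotModel E) (tautForm E Q))) x ![v, w] := rfl
  have l3 : ∀ Ω Ω' : DForm (𝓡 s) (level E Q μ) 2,
      formAt (𝓡 s) (fun x ↦ Ω x - Ω' x) x ![v, w] =
        formAt (𝓡 s) Ω x ![v, w] - formAt (𝓡 s) Ω' x ![v, w] := fun _ _ ↦ rfl
  rw [l1, l2]
  rw [e1', e2', l3]
  ring

end ShiftForms

/-! ### Quotients identified with the target of a submersion -/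

section SubmersionQuotient

variable {E : Type*} [NormedAddCommGroup E] [NormedSpace ℝ E] [FiniteDimensional ℝ E]
  {H : Type*} [TopologicalSpace H] {I : ModelWithCorners ℝ E H} [I.Boundaryless]
  {X : Type*} [TopologicalSpace X] [ChartedSpace H X] [IsManifold I ∞ X]
  {E' : Type*} [NormedAddCommGroup E'] [NormedSpace ℝ E'] [FiniteDimensional ℝ E']
  {H' : Type*} [TopologicalSpace H'] {I' : ModelWithCorners ℝ E' H'} [I'.Boundaryless]
  {P : Type*} [TopologicalSpace P] [ChartedSpace H' P] [IsManifold I' ∞ P]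

/-- The quotient by the fibres of a smooth map with local sections is a manifold. -/
theorem exists_isQuotientManifold_of_hasLocalSections [SecondCountableTopology X] [T2Space P]
    {T : X → P} (hT : ContMDiff I I' ∞ T) (hs : HasLocalSections I I' T) (r : Setoid X)
    (hr : ∀ x y, r x y ↔ T x = T y) :
    ∃ (n : ℕ) (_ : ChartedSpace (EuclideanSpace ℝ (Fin n)) (Quotient r)),
      IsQuotientManifold I r n := by
  have hsurj : ∀ x, Surjective (tder I I' T x) := fun x ↦ hs.surjective_mfderiv hT x
  let L : E' ≃L[ℝ] EuclideanSpace ℝ (Fin (Module.finrank ℝ E')) :=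
    ContinuousLinearEquiv.ofFinrankEq finrank_euclideanSpace_fin.symm
  refine ⟨Module.finrank ℝ E', exists_isQuotientManifold
    (m := Module.finrank ℝ E - Module.finrank ℝ E') I r ?_ ?_ ?_ ?_ ?_⟩
  · let T' : Quotient r → P := Quotient.lift T fun x y h ↦ (hr x y).1 h
    refine T2Space.of_injective_continuous (f := T') ?_ (hT.continuous.quotient_lift _)
    rintro ⟨x⟩ ⟨y⟩ h
    exact Quotient.sound ((hr x y).2 h)
  · intro U hU
    change IsOpen (Quotient.mk r ⁻¹' (Quotient.mk r '' U))
    have h1 : Quotient.mk r ⁻¹' (Quotient.mk r '' U) = T ⁻¹' (T '' U) := by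
      ext x
      constructor
      · rintro ⟨y, hy, h⟩
        exact ⟨y, hy, (hr y x).1 (Quotient.exact h)⟩
      · rintro ⟨y, hy, h⟩
        exact ⟨y, hy, Quotient.sound ((hr y x).2 h)⟩
    rw [h1]
    exact (hs.isOpenMap U hU).preimage hT.continuous
  · intro x
    have h1 := LinearMap.finrank_le_finrank_of_surjective
      (f := (tder I I' T x : E →ₗ[ℝ] E')) (hsurj x)
    omega
  · intro x
    -- the classes are the fibres of `T` in a chart
    let φ := extChartAt I' (T x)
    have hφ : ∀ y ∈ T ⁻¹' φ.source, ContMDiffAt I 𝓘(ℝ, E') ∞ (fun z ↦ φ (T z)) y := fun y hy ↦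
      (contMDiffAt_extChartAt' (by simpa [φ] using hy)).comp y (hT y)
    have hLφ : ∀ y ∈ T ⁻¹' φ.source, ContMDiffAt I (𝓡 (Module.finrank ℝ E')) ∞
        (fun z ↦ L (φ (T z))) y := fun y hy ↦
      ContMDiffAt.comp (g := L) y
        ((L : E' →L[ℝ] EuclideanSpace ℝ (Fin (Module.finrank ℝ E'))).contMDiff _) (hφ y hy)
    have hx : T x ∈ φ.source := mem_extChartAt_source (T x)
    refine ⟨T ⁻¹' φ.source, fun z ↦ L (φ (T z)), (isOpen_extChartAt_source (T x)).preimage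
      hT.continuous, hx, fun y hy ↦ (hLφ y hy).contMDiffWithinAt, ?_, fun y hy z hz ↦ ?_⟩
    · have h1 : ∀ v, tder I (𝓡 (Module.finrank ℝ E')) (fun z ↦ L (φ (T z))) x v =
          L (tder I' 𝓘(ℝ, E') φ (T x) (tder I I' T x v)) := by
        intro v
        let Lc : E' →L[ℝ] EuclideanSpace ℝ (Fin (Module.finrank ℝ E')) := L
        have h2 := tder_comp_apply_of_eq (g := Lc) (f := fun z ↦ φ (T z)) rfl
          (Lc.contMDiff.mdifferentiable (n := ∞) (by simp) _)
          ((hφ x hx).mdifferentiableAt (by simp)) v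
        rw [tder_clm, tder_comp_apply_of_eq (g := φ) (f := T) rfl (mdifferentiableAt_extChart I' hx)
          (hT.mdifferentiable (by simp) x)] at h2
        exact h2
      have hφs : Surjective (tder I' 𝓘(ℝ, E') φ (T x)) := fun w ↦ by
        have h := tder_extChart_comp_symm I' (φ.map_source hx)
        rw [show φ.symm (φ (T x)) = T x from φ.left_inv hx] at h
        exact ⟨_, congrArg (fun A : E' →L[ℝ] E' ↦ A w) h⟩
      intro w
      obtain ⟨v, hv⟩ := (L.surjective.comp (hφs.comp (hsurj x))) w
      exact ⟨v, (h1 v).trans hv⟩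
    · rw [hr, L.injective.eq_iff]
      exact ⟨congrArg φ, fun h ↦ φ.injOn hy hz h⟩
  · intro x y hxy
    -- equivalent points are related by `σ ∘ T` for a local section `σ`
    obtain ⟨V, σ, hV, hyV, hσ, hσy, hTσ⟩ := hs y
    have e := (hr x y).1 hxy
    refine ⟨T ⁻¹' V, fun z ↦ σ (T z), hV.preimage hT.continuous, ?_,
      hσ.comp hT.contMDiffOn fun z hz ↦ hz, ?_, fun z hz ↦ (hr _ _).2 (hTσ _ hz).symm⟩
    · rw [mem_preimage, e]; exact hyV
    · change σ (T x) = y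
      rw [e, hσy]

variable {E'' : Type*} [NormedAddCommGroup E''] [NormedSpace ℝ E'']
  {H'' : Type*} [TopologicalSpace H''] {I'' : ModelWithCorners ℝ E'' H''}
  {R : Type*} [TopologicalSpace R] [ChartedSpace H'' R]

/-- Two smooth surjections with local sections and with the same fibres have diffeomorphic
targets. -/
theorem exists_diffeomorph_of_hasLocalSections {T : X → P} {f : X → R}
    (hT : ContMDiff I I' ∞ T) (hTs : HasLocalSections I I' T) (hTsurj : Surjective T)
    (hf : ContMDiff I I'' ∞ f) (hfs : HasLocalSections I I'' f) (hfsurj : Surjective f)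
    (h : ∀ x y, f x = f y ↔ T x = T y) :
    ∃ τ : Diffeomorph I'' I' R P ∞, ∀ x, τ (f x) = T x := by
  let t : R → P := fun y ↦ T (surjInv hfsurj y)
  let t' : P → R := fun z ↦ f (surjInv hTsurj z)
  have ht : ∀ x, t (f x) = T x := fun x ↦ (h _ _).1 (surjInv_eq hfsurj (f x))
  have ht' : ∀ x, t' (T x) = f x := fun x ↦ (h _ _).2 (surjInv_eq hTsurj (T x))
  have htc : ContMDiff I'' I' ∞ t := hfs.contMDiff_of_comp hfsurj <| by
    rw [show (t ∘ f) = T from funext ht]; exact hT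
  have htc' : ContMDiff I' I'' ∞ t' := hTs.contMDiff_of_comp hTsurj <| by
    rw [show (t' ∘ T) = f from funext ht']; exact hf
  refine ⟨⟨⟨t, t', fun y ↦ ?_, fun z ↦ ?_⟩, htc, htc'⟩, ht⟩
  · obtain ⟨x, rfl⟩ := hfsurj y
    rw [ht, ht']
  · obtain ⟨x, rfl⟩ := hTsurj z
    rw [ht', ht]

end SubmersionQuotient

/-! ### Polysymplectic structures and diffeomorphisms -/

section PolysymplecticPullback

variable {E : Type*} [NormedAddCommGroup E] [NormedSpace ℝ E] [FiniteDimensional ℝ E]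
  {H : Type*} [TopologicalSpace H] {I : ModelWithCorners ℝ E H} [I.Boundaryless]
  {X : Type*} [TopologicalSpace X] [ChartedSpace H X] [IsManifold I ∞ X]
  {E' : Type*} [NormedAddCommGroup E'] [NormedSpace ℝ E'] [FiniteDimensional ℝ E']
  {H' : Type*} [TopologicalSpace H'] {I' : ModelWithCorners ℝ E' H'} [I'.Boundaryless]
  {P : Type*} [TopologicalSpace P] [ChartedSpace H' P] [IsManifold I' ∞ P]

theorem IsPolysymplectic.pullback_diffeomorph {k : ℕ} {Ω : Fin k → DForm I' P 2}
    (hΩ : IsPolysymplectic I' Ω) (τ : Diffeomorph I I' X P ∞) :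
    IsPolysymplectic I fun a ↦ pullback I I' τ (Ω a) := by
  refine ⟨fun a ↦ (hΩ.smooth a).pullback I I' τ.contMDiff, fun a ↦ ?_, fun x v hv ↦ ?_⟩
  · rw [dExt_pullback I I' τ.contMDiff ((isSmoothForm_iff I').1 (hΩ.smooth a)), hΩ.closed a]
    rfl
  · have hl : ∀ v : E, tder I' I τ.symm (τ x) (tder I I' τ x v) = v := by
      intro v
      rw [← tder_comp_apply_of_eq (g := τ.symm) (f := τ) rfl
        (τ.symm.contMDiff.mdifferentiable (by simp) _) (τ.contMDiff.mdifferentiable (by simp) _)]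
      have h1 : (fun z ↦ τ.symm (τ z)) = fun z : X ↦ z := funext fun z ↦ τ.symm_apply_apply z
      rw [h1, tder_id]; rfl
    have hr : ∀ w : E', ∃ v : E, tder I I' τ x v = w := by
      intro w
      refine ⟨tder I' I τ.symm (τ x) w, ?_⟩
      rw [← tder_comp_apply_of_eq (g := τ) (f := τ.symm) (τ.symm_apply_apply x)
        (τ.contMDiff.mdifferentiable (by simp) _) (τ.symm.contMDiff.mdifferentiable (by simp) _)]
      have h1 : (fun z ↦ τ (τ.symm z)) = fun z : P ↦ z := funext fun z ↦ τ.apply_symm_apply z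
      rw [h1, tder_id]; rfl
    have h0 : tder I I' τ x v = 0 := by
      refine hΩ.nondegenerate (τ x) _ fun a w ↦ ?_
      obtain ⟨u, rfl⟩ := hr w
      exact (formAt_pullback_two I I' τ (Ω a) x v u).symm.trans (hv a u)
    have h2 := hl v
    rw [h0, map_zero] at h2
    exact h2.symm

end PolysymplecticPullback

/-! ### The manifolds of the reduction -/

section Reduction

variable {EG : Type*} [NormedAddCommGroup EG] [NormedSpace ℝ EG] [FiniteDimensional ℝ EG]
  {G : Type*} [TopologicalSpace G] [ChartedSpace EG G] [Group G] [LieGroup 𝓘(ℝ, EG) ∞ G]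
  {E : Type*} [NormedAddCommGroup E] [NormedSpace ℝ E] [FiniteDimensional ℝ E]
  {Q : Type*} [TopologicalSpace Q] [ChartedSpace E Q] [IsManifold 𝓘(ℝ, E) ∞ Q]
  [T2Space Q] [SecondCountableTopology Q] [MulAction G Q]
  [ContMDiffSMul 𝓘(ℝ, EG) 𝓘(ℝ, E) ∞ G Q] [ProperSMul G Q]
  {k : ℕ}

theorem exists_isQuotientManifold_orbSpace (hfree : ∀ (g : G) (q : Q), g • q = q → g = 1)
    (A : PrincipalConnection EG G E Q) :
    ∃ (b : ℕ) (_ : ChartedSpace (EuclideanSpace ℝ (Fin b)) (OrbSpace G Q)),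
      IsQuotientManifold 𝓘(ℝ, E) (MulAction.orbitRel G Q) b := by
  refine exists_isQuotientManifold_orbits hfree A.injective_infGen
    (F := fun _ : G ↦ (0 : ℝ)) contMDiff_const (fun _ ↦ ⟨.refl ℝ ℝ, fun _ ↦ rfl⟩) _ fun q q' ↦ ?_
  rw [← Setoid.comm']
  exact ⟨fun ⟨g, hg⟩ ↦ ⟨g, rfl, hg⟩, fun ⟨g, _, hg⟩ ↦ ⟨g, hg⟩⟩

theorem orbitRel_isotropy_iff (μ : Fin k → LieDual EG G) (q q' : Q) :
    MulAction.orbitRel (isotropy μ) Q q q' ↔ ∃ g ∈ isotropy μ, g • q = q' := by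
  rw [← Setoid.comm']
  exact ⟨fun ⟨g, hg⟩ ↦ ⟨g.1, g.2, hg⟩, fun ⟨g, h, hg⟩ ↦ ⟨⟨g, h⟩, hg⟩⟩

theorem exists_isQuotientManifold_orbSpaceMu (hfree : ∀ (g : G) (q : Q), g • q = q → g = 1)
    (A : PrincipalConnection EG G E Q) (μ : Fin k → LieDual EG G) :
    ∃ (c : ℕ) (_ : ChartedSpace (EuclideanSpace ℝ (Fin c)) (OrbSpaceMu Q μ)),
      IsQuotientManifold 𝓘(ℝ, E) (MulAction.orbitRel (isotropy μ) Q) c := by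
  refine exists_isQuotientManifold_orbits hfree A.injective_infGen (contMDiff_coadMap μ)
    (coadMap_mul μ) _ fun q q' ↦ ?_
  rw [orbitRel_isotropy_iff]
  simp only [mem_isotropy_iff]

theorem exists_isEmbeddedSubmanifold_level (μ : Fin k → LieDual EG G)
    (hμ : IsRegularValue E Q μ) :
    ∃ (s : ℕ) (_ : ChartedSpace (EuclideanSpace ℝ (Fin s)) (level E Q μ)),
      IsEmbeddedSubmanifold (covModel E k) (level E Q μ) s := by
  have : T2Space (Cov E Q k) := t2Space_vcov
  have : SecondCountableTopology (Cov E Q k) := secondCountableTopology_vcov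
  let J : Cov E Q k → (Fin k → (EG →L[ℝ] ℝ)) := fun x ↦ momentum EG G x
  refine ⟨Module.finrank ℝ (E × (E →L[ℝ] (Fin k → ℝ))) - Module.finrank ℝ (Fin k → (EG →L[ℝ] ℝ)),
    exists_isEmbeddedSubmanifold (covModel E k) (J := J) (c := μ) (fun x ↦ Iff.rfl)
    (contMDiff_momentum EG G E Q k) hμ fun x ↦ ?_⟩
  let L : (E × (E →L[ℝ] (Fin k → ℝ))) →L[ℝ] (Fin k → (EG →L[ℝ] ℝ)) :=
    tder (covModel E k) 𝓘(ℝ, Fin k → (EG →L[ℝ] ℝ)) J x.1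
  have hs : Surjective L := hμ x.1 x.2
  have h := LinearMap.finrank_le_finrank_of_surjective (f := L.toLinearMap) hs
  omega

variable {b c : ℕ} [ChartedSpace (EuclideanSpace ℝ (Fin b)) (OrbSpace G Q)]
  [IsManifold (𝓡 b) ∞ (OrbSpace G Q)] {μ : Fin k → LieDual EG G}
  [ChartedSpace (EuclideanSpace ℝ (Fin c)) (OrbSpaceMu Q μ)]

theorem exists_isOrbitDiagram (hB : IsQuotientManifold 𝓘(ℝ, E) (MulAction.orbitRel G Q) b)
    (hC : IsQuotientManifold 𝓘(ℝ, E) (MulAction.orbitRel (isotropy μ) Q) c) :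
    ∃ p : C^∞⟮𝓡 c, OrbSpaceMu Q μ; 𝓡 b, OrbSpace G Q⟯,
      IsOrbitDiagram (E := E) μ (Quotient.mk (MulAction.orbitRel G Q))
        (Quotient.mk (MulAction.orbitRel (isotropy μ) Q)) p := by
  have hBs := HasLocalSections.of_isSubmersion hB.isSubmersion
  have hCs := HasLocalSections.of_isSubmersion hC.isSubmersion
  let p : OrbSpaceMu Q μ → OrbSpace G Q := Quotient.map' id fun q q' h ↦ by
    obtain ⟨g, -, hg⟩ := (orbitRel_isotropy_iff μ q q').1 h
    exact Setoid.symm' _ ⟨g, hg⟩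
  have hp : ContMDiff (𝓡 c) (𝓡 b) ∞ p :=
    hCs.contMDiff_of_comp Quotient.mk_surjective hB.isSubmersion.contMDiff
  refine ⟨⟨p, hp⟩, hB.isSubmersion.contMDiff, hBs, fun q q' ↦ ?_,
    hC.isSubmersion.contMDiff, hCs, Quotient.mk_surjective, fun q q' ↦ ?_, fun q ↦ rfl⟩
  · rw [Quotient.eq, Setoid.comm']
    exact Iff.rfl
  · rw [Quotient.eq, orbitRel_isotropy_iff]

/-- The classes in the level set are the fibres of the momentum shift, so that the quotient inherits
a manifold structure. -/
theorem exists_isQuotientManifold_redSpace (hfree : ∀ (g : G) (q : Q), g • q = q → g = 1)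
    (A : PrincipalConnection EG G E Q)
    (hB : IsQuotientManifold 𝓘(ℝ, E) (MulAction.orbitRel G Q) b)
    (hC : IsQuotientManifold 𝓘(ℝ, E) (MulAction.orbitRel (isotropy μ) Q) c) {s : ℕ}
    [ChartedSpace (EuclideanSpace ℝ (Fin s)) (level E Q μ)]
    (hL : IsEmbeddedSubmanifold (covModel E k) (level E Q μ) s) :
    ∃ (r : ℕ) (_ : ChartedSpace (EuclideanSpace ℝ (Fin r)) (RedSpace E Q μ)),
      IsQuotientManifold (𝓡 s) (levelRel (E := E) (Q := Q) μ) r := by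
  obtain ⟨p, h⟩ := exists_isOrbitDiagram hB hC
  have := hC.isSmoothManifold.isManifold
  have := hB.isSmoothManifold.t2
  have := hC.isSmoothManifold.t2
  have := hL.isSmoothManifold.isManifold
  have := hL.isSmoothManifold.secondCountable
  obtain ⟨T, hT⟩ := exists_isMomentumShift h hfree A
  have : T2Space (PullCov k p) := t2Space_pullCov
  exact exists_isQuotientManifold_of_hasLocalSections (hT.contMDiff h hL)
    (hT.hasLocalSections h hL) _ fun x y ↦ (hT.apply_eq_iff h x y).symm

/-- Cotangent bundle reduction, for given manifold structures on the quotients and on the level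
set. -/
theorem exists_reduction (hfree : ∀ (g : G) (q : Q), g • q = q → g = 1) (hk : 1 ≤ k)
    (A : PrincipalConnection EG G E Q) {s r : ℕ}
    [ChartedSpace (EuclideanSpace ℝ (Fin s)) (level E Q μ)]
    [ChartedSpace (EuclideanSpace ℝ (Fin r)) (RedSpace E Q μ)]
    (hB : IsQuotientManifold 𝓘(ℝ, E) (MulAction.orbitRel G Q) b)
    (hC : IsQuotientManifold 𝓘(ℝ, E) (MulAction.orbitRel (isotropy μ) Q) c)
    (hL : IsEmbeddedSubmanifold (covModel E k) (level E Q μ) s)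
    (hR : IsQuotientManifold (𝓡 s) (levelRel (E := E) (Q := Q) μ) r) :
    ∃ (p : C^∞⟮𝓡 c, OrbSpaceMu Q μ; 𝓡 b, OrbSpace G Q⟯)
      (β : Fin k → DForm (𝓡 c) (OrbSpaceMu Q μ) 2) (ωred : Fin k → DForm (𝓡 r) (RedSpace E Q μ) 2),
      (∀ q : Q, p (Quotient.mk _ q) = Quotient.mk _ q) ∧
      (∀ a, IsSmoothForm (𝓡 c) (β a)) ∧
      (∀ (a : Fin k) (η : DForm (𝓡 c) (OrbSpaceMu Q μ) 2),
        pullback 𝓘(ℝ, E) (𝓡 c) (Quotient.mk _) η = dExt 𝓘(ℝ, E) (A.component (μ a)) ↔ η = β a) ∧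
      IsPolysymplectic (𝓡 r) ωred ∧
      (∀ (a : Fin k) (η : DForm (𝓡 r) (RedSpace E Q μ) 2),
        pullback (𝓡 s) (𝓡 r) (Quotient.mk _) η =
            pullback (𝓡 s) (covModel E k) (Subtype.val : level E Q μ → Cov E Q k)
              (covForm E Q k a) ↔ η = ωred a) ∧
      IsPolysymplectic (pullModel b c k) (magneticForm p β) ∧
      ∃ τ : Diffeomorph (𝓡 r) (pullModel b c k) (RedSpace E Q μ) (PullCov k p) ∞,
        (∀ a, pullback (𝓡 r) (pullModel b c k) τ (magneticForm p β a) = ωred a) ∧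
        ∀ x : level E Q μ, pr₁ p (τ (Quotient.mk _ x)) = Quotient.mk _ x.1.proj ∧
          (cov (pr₂ p (τ (Quotient.mk _ x)))).comp
            (tder 𝓘(ℝ, E) (𝓡 b) (Quotient.mk (MulAction.orbitRel G Q)) x.1.proj) =
            cov x.1 - connCov μ A x.1.proj := by
  obtain ⟨p, h⟩ := exists_isOrbitDiagram hB hC
  have := hC.isSmoothManifold.isManifold
  have := hL.isSmoothManifold.isManifold
  have := hR.isSmoothManifold.isManifold
  obtain ⟨T, hT⟩ := exists_isMomentumShift h hfree A
  choose β hβs hβA using h.exists_curvature A hfree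
  have hRs := HasLocalSections.of_isSubmersion hR.isSubmersion
  have hRc : ContMDiff (𝓡 s) (𝓡 r) ∞ (Quotient.mk (levelRel (E := E) (Q := Q) μ)) :=
    hR.isSubmersion.contMDiff
  have hTc := hT.contMDiff h hL
  obtain ⟨τ, hτ⟩ := exists_diffeomorph_of_hasLocalSections hTc (hT.hasLocalSections h hL)
    (hT.surjective h) hRc hRs Quotient.mk_surjective fun x y ↦ by
      rw [Quotient.eq, hT.apply_eq_iff h]
  have hmag : IsPolysymplectic (pullModel b c k) (magneticForm p β) :=
    ⟨isSmoothForm_magneticForm hβs, dExt_magneticForm hβs fun a ↦ h.dExt_curvature A (hβs a) (hβA a),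
      magneticForm_nondegenerate hk (fun y ↦ by
        obtain ⟨q, rfl⟩ := h.surjective_right y
        intro w
        obtain ⟨v, rfl⟩ := h.surjective_tder_left q w
        exact ⟨_, (h.tder_left_eq_comp q v).symm⟩)
        (h.curvature_nondegenerate A hfree hβA)⟩
  have hpull : ∀ a, pullback (𝓡 s) (𝓡 r) (Quotient.mk (levelRel (E := E) (Q := Q) μ))
      (pullback (𝓡 r) (pullModel b c k) τ (magneticForm p β a)) =
      pullback (𝓡 s) (covModel E k) (Subtype.val : level E Q μ → Cov E Q k) (covForm E Q k a) := by
    intro a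
    rw [← hT.pullback_magneticForm h hL hβA a,
      ← pullback_comp (𝓡 s) (𝓡 r) (pullModel b c k) τ.contMDiff hRc]
    exact congrArg (fun f : level E Q μ → PullCov k p ↦
      pullback (𝓡 s) (pullModel b c k) f (magneticForm p β a)) (funext hτ)
  refine ⟨p, β, fun a ↦ pullback (𝓡 r) (pullModel b c k) τ (magneticForm p β a), h.map_right, hβs,
    fun a η ↦ ⟨fun e ↦ ?_, ?_⟩, hmag.pullback_diffeomorph τ, fun a η ↦ ⟨fun e ↦ ?_, ?_⟩, hmag, τ,
    fun a ↦ rfl, fun x ↦ ?_⟩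
  · exact pullback_injective 𝓘(ℝ, E) (𝓡 c) h.surjective_right h.surjective_tder_right
      (e.trans (hβA a).symm)
  · rintro rfl; exact hβA a
  · exact pullback_injective (𝓡 s) (𝓡 r) Quotient.mk_surjective
      (fun x ↦ hRs.surjective_mfderiv hRc x) (e.trans (hpull a).symm)
  · rintro rfl; exact hpull a
  · rw [hτ]
    exact ⟨hT.pr₁_eq x, hT.pr₂_comp x⟩

end Reduction

end PolyRed

end

open PolyRed in
theorem mainTheorem1
    {EG : Type*} [NormedAddCommGroup EG] [NormedSpace ℝ EG] [FiniteDimensional ℝ EG]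
    {G : Type*} [TopologicalSpace G] [ChartedSpace EG G] [Group G]
    [LieGroup 𝓘(ℝ, EG) ∞ G] [T2Space G] [SecondCountableTopology G]
    {E : Type*} [NormedAddCommGroup E] [NormedSpace ℝ E] [FiniteDimensional ℝ E]
    {Q : Type*} [TopologicalSpace Q] [ChartedSpace E Q] [IsManifold 𝓘(ℝ, E) ∞ Q]
    [T2Space Q] [SecondCountableTopology Q]
    [MulAction G Q] [ContMDiffSMul 𝓘(ℝ, EG) 𝓘(ℝ, E) ∞ G Q] [ProperSMul G Q]
    (hfree : ∀ (g : G) (q : Q), g • q = q → g = 1)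
    {k : ℕ} (hk : 1 ≤ k) (μ : Fin k → LieDual EG G) (hμ : IsRegularValue E Q μ)
    (A : PrincipalConnection EG G E Q) :
    -- `Q/G`, `Q/G_μ`, `J⁻¹(μ)` and `J⁻¹(μ)/G_μ` are smooth manifolds
    (∃ (b : ℕ) (_ : ChartedSpace (EuclideanSpace ℝ (Fin b)) (OrbSpace G Q)),
      IsQuotientManifold 𝓘(ℝ, E) (MulAction.orbitRel G Q) b) ∧
    (∃ (c : ℕ) (_ : ChartedSpace (EuclideanSpace ℝ (Fin c)) (OrbSpaceMu Q μ)),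
      IsQuotientManifold 𝓘(ℝ, E) (MulAction.orbitRel (isotropy μ) Q) c) ∧
    (∃ (s r : ℕ) (_ : ChartedSpace (EuclideanSpace ℝ (Fin s)) (level E Q μ))
      (_ : ChartedSpace (EuclideanSpace ℝ (Fin r)) (RedSpace E Q μ)),
      IsEmbeddedSubmanifold (covModel E k) (level E Q μ) s ∧
      IsQuotientManifold (𝓡 s) (levelRel (E := E) (Q := Q) μ) r) ∧
    -- and, for these manifold structures, the following holds
    ∀ (b c s r : ℕ)
      [ChartedSpace (EuclideanSpace ℝ (Fin b)) (OrbSpace G Q)]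
      [IsManifold (𝓡 b) ∞ (OrbSpace G Q)]
      [ChartedSpace (EuclideanSpace ℝ (Fin c)) (OrbSpaceMu Q μ)]
      [ChartedSpace (EuclideanSpace ℝ (Fin s)) (level E Q μ)]
      [ChartedSpace (EuclideanSpace ℝ (Fin r)) (RedSpace E Q μ)],
      IsQuotientManifold 𝓘(ℝ, E) (MulAction.orbitRel G Q) b →
      IsQuotientManifold 𝓘(ℝ, E) (MulAction.orbitRel (isotropy μ) Q) c →
      IsEmbeddedSubmanifold (covModel E k) (level E Q μ) s →
      IsQuotientManifold (𝓡 s) (levelRel (E := E) (Q := Q) μ) r →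
      ∃ (p : C^∞⟮𝓡 c, OrbSpaceMu Q μ; 𝓡 b, OrbSpace G Q⟯)
        (β : Fin k → DForm (𝓡 c) (OrbSpaceMu Q μ) 2)
        (ωred : Fin k → DForm (𝓡 r) (RedSpace E Q μ) 2),
        -- `p` is the projection `p_μ : Q/G_μ → Q/G`
        (∀ q : Q, p (Quotient.mk _ q) = Quotient.mk _ q) ∧
        -- `β a` is the unique form on `Q/G_μ` that lifts to `d𝒜_{μ_a}`
        (∀ a, IsSmoothForm (𝓡 c) (β a)) ∧
        (∀ (a : Fin k) (η : DForm (𝓡 c) (OrbSpaceMu Q μ) 2),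
          pullback 𝓘(ℝ, E) (𝓡 c) (Quotient.mk _) η = dExt 𝓘(ℝ, E) (A.component (μ a)) ↔
            η = β a) ∧
        -- `ωred` is the reduced polysymplectic structure on `J⁻¹(μ)/G_μ`
        IsPolysymplectic (𝓡 r) ωred ∧
        (∀ (a : Fin k) (η : DForm (𝓡 r) (RedSpace E Q μ) 2),
          pullback (𝓡 s) (𝓡 r) (Quotient.mk _) η =
              pullback (𝓡 s) (covModel E k) (Subtype.val : level E Q μ → Cov E Q k)
                (covForm E Q k a) ↔
            η = ωred a) ∧
        -- the magnetic forms are a polysymplectic structure on the pullback bundle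
        IsPolysymplectic (pullModel b c k) (magneticForm p β) ∧
        -- the polysymplectomorphism induced by the momentum shift
        ∃ τ : Diffeomorph (𝓡 r) (pullModel b c k) (RedSpace E Q μ) (PullCov k p) ∞,
          (∀ a, pullback (𝓡 r) (pullModel b c k) τ (magneticForm p β a) = ωred a) ∧
          ∀ x : level E Q μ,
            pr₁ p (τ (Quotient.mk _ x)) = Quotient.mk _ x.1.proj ∧
            ∃ γ : CovFib (EuclideanSpace ℝ (Fin b)) (OrbSpace G Q) k (Quotient.mk _ x.1.proj),
              pr₂ p (τ (Quotient.mk _ x)) = ⟨Quotient.mk _ x.1.proj, γ⟩ ∧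
              ∀ (a : Fin k) (v : TangentSpace 𝓘(ℝ, E) x.1.proj),
                γ.covector a (mfderiv 𝓘(ℝ, E) (𝓡 b)
                  (Quotient.mk (MulAction.orbitRel G Q)) x.1.proj v) =
                  x.1.2.covector a v - μ a (A.form x.1.proj v) := by
  obtain ⟨b, csB, hB⟩ := exists_isQuotientManifold_orbSpace hfree A
  obtain ⟨c, csC, hC⟩ := exists_isQuotientManifold_orbSpaceMu hfree A μ
  obtain ⟨s, csL, hL⟩ := exists_isEmbeddedSubmanifold_level μ hμ
  refine ⟨⟨b, csB, hB⟩, ⟨c, csC, hC⟩, ?_, ?_⟩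
  · have : IsManifold (modelWithCornersSelf ℝ (EuclideanSpace ℝ (Fin b))) ∞ (OrbSpace G Q) :=
      hB.isSmoothManifold.isManifold
    obtain ⟨r, csR, hR⟩ := exists_isQuotientManifold_redSpace hfree A hB hC hL
    exact ⟨s, r, csL, csR, hL, hR⟩
  clear hB hC hL csB csC csL b c s
  intro b c s r _ _ _ _ _ hB hC hL hR
  obtain ⟨p, β, ωred, hp, hβ, hβu, hω, hωu, hm, τ, hτ, hτx⟩ :=
    exists_reduction hfree hk A hB hC hL hR
  refine ⟨p, β, ωred, hp, hβ, hβu, hω, hωu, hm, τ, hτ, fun x ↦ ?_⟩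
  obtain ⟨h1, h2⟩ := hτx x
  refine ⟨h1, cov (pr₂ p (τ (Quotient.mk _ x))),
    vcov_ext ((congrArg p h1).trans (hp x.1.proj)) rfl, fun a v ↦ ?_⟩
  exact congrFun (congrArg (fun L : E →L[ℝ] (Fin k → ℝ) ↦ L v) h2) a
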